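/- Let $k=\mathbf F_q$ be a finite field and let $X$ be a normal surface over $k$ (an integral normal separated $k$-scheme of finite type of dimension $2$), with function field $k(X)$. A Cartier divisor $D=(U_i,f_i)_i$ on $X$ is given by an open covering $(U_i)$ and $f_i\in k(X)^\times$ with $f_i/f_j\in\mathcal O_X(U_i\cap U_j)^\times$; put $H^0(X,D)=\{s\in k(X) : sf_i\in\mathcal O_X(U_i)\ \text{for all } i\}$. For a set $\mathcal P$ of rational points of $X$, the evaluation code $\mathcal C_X(D,\mathcal P)\subseteq k^{\mathcal P}$ is the set of the words $\big((sf_{i_x})(x)\big)_{x\in\mathcal P}$, $s\in H^0(X,D)$, where $i_x$ is a fixed index with $x\in U_{i_x}$. A section $s\in H^0(X,D)$ has multiplicity at least $n$ at a point $p$ if its local equation $sf_i$ at $p$ lies in $\mathfrak m_p^n\subseteq\mathcal O_{X,p}$. Two codes are equivalent if one is obtained from the other by a bijection of the coordinates followed by the multiplication of each coordinate by a nonzero scalar. Let $p$ be a closed point of $X$, let $\pi:Y\to X$ be the blowing-up of $X$ at $p$, and let $D$ be a Cartier divisor on $X$, with pullback $\pi^*D=(\pi^{-1}U_i,f_i\circ\pi)_i$.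 If $p$ is a regular point of $X$, then the sum $\mathcal E$ of the exceptional curves of $\pi$, that is, the reduced divisor with support $\pi^{-1}(p)$, is a Cartier divisor of $Y$. 1. Suppose that $p$ has degree $[\kappa(p):k]>1$. Then $\pi$ induces a bijection $Y(k)\to X(k)$, and by means of it the codes $\mathcal C_X(D,X(k))$ and $\mathcal C_Y(\pi^*D,Y(k))$ are equivalent. If moreover $p$ is a regular point of $X$, then for every integer $n\ge 0$ the code $\mathcal C_Y(\pi^*D-n\mathcal E,Y(k))$ is equivalent, by means of the same bijection, to the subcode of $\mathcal C_X(D,X(k))$ obtained by evaluating only the sections $s\in H^0(X,D)$ of multiplicity at least $n$ at $p$. 2. Suppose that $p$ is rational and is a regular point of $X$, and let $u,v$ be generators of $\mathfrak m_p$. Then there is a bijection of $Y(k)$ with $(X(k)\setminus\{p\})\sqcup\mathbf P^1(k)$, under which a point $x\in X(k)\setminus\{p\}$ corresponds to a point of $Y(k)$ above $x$ and the points of $\mathbf P^1(k)$ correspond to the points of $Y(k)$ above $p$, and by means of which, for every integer $n\ge 0$, the code $\mathcal C_Y(\pi^*D-n\mathcal E,Y(k))$ is equivalent to the code of the following words,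 where $s$ runs through the sections in $H^0(X,D)$ of multiplicity at least $n$ at $p$: the evaluations of $s$ at the points of $X(k)\setminus\{p\}$, followed by the $q+1$ evaluations, at (fixed representatives of) the points of $\mathbf P^1(k)$, of the homogeneous component of degree $n$ of the local equation of $s$ at $p$, that is, of the homogeneous polynomial $F\in k[U,V]$ of degree $n$ with $sf_{i_p}\equiv F(u,v)\bmod \mathfrak m_p^{n+1}$. -/

import Mathlib

open AlgebraicGeometry CategoryTheory

universe u

noncomputable section

namespace BlowUpCode

/-! ### The structure of a `k`-algebra on local rings and residue fields -/

section OverField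

variable (k : Type u) [Field k] (X : Scheme.{u}) [X.Over (Spec (CommRingCat.of k))]

/-- The constants of a `k`-scheme, as germs at a point. -/
def constantGerm (x : X) : k →+* X.presheaf.stalk x :=
  ((Scheme.ΓSpecIso (CommRingCat.of k)).inv ≫ (X ↘ Spec (CommRingCat.of k)).appTop ≫
    X.presheaf.germ ⊤ x trivial).hom

instance algebraStalk (x : X) : Algebra k (X.presheaf.stalk x) :=
  (constantGerm k X x).toAlgebra

instance algebraResidueField (x : X) : Algebra k (X.residueField x) :=
  ((X.residue x).hom.comp (constantGerm k X x)).toAlgebra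

/-- The set `X(k)` of rational points: the points whose residue field is `k`. -/
def RationalPoint : Type u :=
  {x : X // Function.Bijective (algebraMap k (X.residueField x))}

/-- The degree `[κ(x) : k]` of a closed point. -/
def degree (x : X) : ℕ := Module.finrank k (X.residueField x)

/-- `X`, an integral scheme over `k`, is a normal surface: it is separated and of finite type
over `k`, of dimension two, and its local rings are integrally closed. -/
structure IsNormalSurface [IsIntegral X] : Prop where
  separated : IsSeparated (X ↘ Spec (CommRingCat.of k))
  locallyOfFiniteType : LocallyOfFiniteType (X ↘ Spec (CommRingCat.of k))
  quasiCompact : QuasiCompact (X ↘ Spec (CommRingCat.of k))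
  dim_eq_two : topologicalKrullDim X = 2
  normal : ∀ x : X, IsIntegrallyClosed (X.presheaf.stalk x)

variable {k X} in
theorem algebraMap_stalk_functionField [IsIntegral X] (x : X) (c : k) :
    algebraMap (X.presheaf.stalk x) X.functionField (algebraMap k (X.presheaf.stalk x) c) =
      algebraMap k X.functionField c := by
  have h : X.presheaf.germ ⊤ x trivial ≫
      X.presheaf.stalkSpecializes ((genericPoint_spec X).specializes trivial) =
      X.presheaf.germ ⊤ (genericPoint X) trivial := X.presheaf.germ_stalkSpecializes _ _
  exact congr($(h).hom ((X ↘ Spec (CommRingCat.of k)).appTop.hom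
    ((Scheme.ΓSpecIso (CommRingCat.of k)).inv.hom c)))

end OverField

/-! ### Regular functions and Cartier divisors on an integral scheme -/

section Cartier

variable {X Y : Scheme.{u}} [IsIntegral X] [IsIntegral Y]

/-- The section `a` of the structure sheaf over `U` is the rational function `g`. -/
def Represents {U : X.Opens} (a : Γ(X, U)) (g : X.functionField) : Prop :=
  ∀ (x : X) (hx : x ∈ U),
    algebraMap (X.presheaf.stalk x) X.functionField (X.presheaf.germ U x hx a) = g

/-- The rational function `g` is regular on `U`. -/
def IsRegularOn (U : X.Opens) (g : X.functionField) : Prop :=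
  ∃ a : Γ(X, U), Represents a g

theorem IsRegularOn.mul {U : X.Opens} {g h : X.functionField} (hg : IsRegularOn U g)
    (hh : IsRegularOn U h) : IsRegularOn U (g * h) := by
  obtain ⟨a, ha⟩ := hg
  obtain ⟨b, hb⟩ := hh
  exact ⟨a * b, fun x hx => by rw [map_mul, map_mul, ha x hx, hb x hx]⟩

theorem IsRegularOn.add {U : X.Opens} {g h : X.functionField} (hg : IsRegularOn U g)
    (hh : IsRegularOn U h) : IsRegularOn U (g + h) := by
  obtain ⟨a, ha⟩ := hg
  obtain ⟨b, hb⟩ := hh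
  exact ⟨a + b, fun x hx => by rw [map_add, map_add, ha x hx, hb x hx]⟩

theorem isRegularOn_zero (U : X.Opens) : IsRegularOn U (0 : X.functionField) :=
  ⟨0, fun x hx => by rw [map_zero, map_zero]⟩

theorem IsRegularOn.pow {U : X.Opens} {g : X.functionField} (hg : IsRegularOn U g) (n : ℕ) :
    IsRegularOn U (g ^ n) := by
  obtain ⟨a, ha⟩ := hg
  exact ⟨a ^ n, fun x hx => by rw [map_pow, map_pow, ha x hx]⟩

theorem IsRegularOn.mono {U V : X.Opens} (hVU : V ≤ U) {g : X.functionField}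
    (hg : IsRegularOn U g) : IsRegularOn V g := by
  obtain ⟨a, ha⟩ := hg
  refine ⟨X.presheaf.map (homOfLE hVU).op a, fun x hx => ?_⟩
  rw [X.presheaf.germ_res_apply (homOfLE hVU) x hx a]
  exact ha x (hVU hx)

theorem isRegularOn_const (k : Type u) [Field k] [X.Over (Spec (CommRingCat.of k))]
    (U : X.Opens) (c : k) : IsRegularOn U (algebraMap k X.functionField c) := by
  refine IsRegularOn.mono le_top ⟨(X ↘ Spec (CommRingCat.of k)).appTop.hom
    ((Scheme.ΓSpecIso (CommRingCat.of k)).inv.hom c), fun x hx => ?_⟩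
  exact algebraMap_stalk_functionField x c

variable (X) in
/-- A Cartier divisor `(U i, f i)`: an open covering with nonzero rational functions whose
quotients `f i / f j` (and so, exchanging `i` and `j`, their inverses) are regular on
`U i ∩ U j`. -/
structure CartierDivisor where
  ι : Type u
  U : ι → X.Opens
  f : ι → X.functionField
  cover : ∀ x : X, ∃ i, x ∈ U i
  ne_zero : ∀ i, f i ≠ 0
  compat : ∀ i j, IsRegularOn (U i ⊓ U j) (f i / f j)

namespace CartierDivisor

/-- A choice, for each point, of a member of the covering which contains it. -/
def index (D : CartierDivisor X) (x : X) : D.ι := (D.cover x).choose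

theorem mem_index (D : CartierDivisor X) (x : X) : x ∈ D.U (D.index x) :=
  (D.cover x).choose_spec

/-- The difference `(U i ∩ V j, f i / g j)` of `(U i, f i)` and `(V j, g j)`. -/
def sub (D E : CartierDivisor X) : CartierDivisor X where
  ι := D.ι × E.ι
  U i := D.U i.1 ⊓ E.U i.2
  f i := D.f i.1 / E.f i.2
  cover x := ⟨(D.index x, E.index x), D.mem_index x, E.mem_index x⟩
  ne_zero i := div_ne_zero (D.ne_zero _) (E.ne_zero _)
  compat i j := by
    have h := ((D.compat i.1 j.1).mono (V := (D.U i.1 ⊓ E.U i.2) ⊓ (D.U j.1 ⊓ E.U j.2))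
      (inf_le_inf inf_le_left inf_le_left)).mul ((E.compat j.2 i.2).mono
      (V := (D.U i.1 ⊓ E.U i.2) ⊓ (D.U j.1 ⊓ E.U j.2))
      (le_inf (inf_le_right.trans inf_le_right) (inf_le_left.trans inf_le_right)))
    convert h using 1
    have := D.ne_zero j.1
    have := E.ne_zero i.2
    have := E.ne_zero j.2
    field_simp

instance : Sub (CartierDivisor X) := ⟨sub⟩

/-- The multiple `(U i, f i ^ n)` of `(U i, f i)`. -/
def nsmul (n : ℕ) (D : CartierDivisor X) : CartierDivisor X where
  ι := D.ι
  U := D.U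
  f i := D.f i ^ n
  cover := D.cover
  ne_zero i := pow_ne_zero _ (D.ne_zero i)
  compat i j := by
    rw [← div_pow]
    exact (D.compat i j).pow n

instance : SMul ℕ (CartierDivisor X) := ⟨nsmul⟩

end CartierDivisor

theorem specializes_genericPoint (π : Y ⟶ X) (hπ : IsDominant π) :
    π (genericPoint Y) ⤳ genericPoint X := by
  have h : IsGenericPoint (π (genericPoint Y)) (Set.univ : Set X) := by
    have h1 := (genericPoint_spec Y).image π.continuous
    rwa [Set.image_univ, hπ.denseRange.closure_range] at h1
  exact h.specializes trivial

/-- The composition `g ↦ g ∘ π` of a rational function with a dominant morphism. -/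
def functionFieldMap (π : Y ⟶ X) (hπ : IsDominant π) : X.functionField →+* Y.functionField :=
  (X.presheaf.stalkSpecializes (specializes_genericPoint π hπ) ≫
    π.stalkMap (genericPoint Y)).hom

theorem IsRegularOn.comp {U : X.Opens} {g : X.functionField} (hg : IsRegularOn U g) (π : Y ⟶ X)
    (hπ : IsDominant π) : IsRegularOn (π ⁻¹ᵁ U) (functionFieldMap π hπ g) := by
  obtain ⟨a, ha⟩ := hg
  refine ⟨π.app U a, fun y hy => ?_⟩
  have hy' : π y ∈ U := hy
  have hU : genericPoint X ∈ U :=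
    ((genericPoint_spec X).mem_open_set_iff U.isOpen).mpr ⟨_, trivial, hy'⟩
  have hV : genericPoint Y ∈ π ⁻¹ᵁ U :=
    ((genericPoint_spec Y).mem_open_set_iff (π ⁻¹ᵁ U).isOpen).mpr ⟨_, trivial, hy⟩
  have h1 : X.presheaf.germ U (genericPoint X) hU a = g := by
    rw [← ha (π y) hy']
    exact (congr($(X.presheaf.germ_stalkSpecializes hy'
      ((genericPoint_spec X).specializes trivial)).hom a)).symm
  have h2 : algebraMap (Y.presheaf.stalk y) Y.functionField
      (Y.presheaf.germ (π ⁻¹ᵁ U) y hy (π.app U a)) =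
      Y.presheaf.germ (π ⁻¹ᵁ U) (genericPoint Y) hV (π.app U a) :=
    congr($(Y.presheaf.germ_stalkSpecializes hy
      ((genericPoint_spec Y).specializes trivial)).hom (π.app U a))
  have h3 : X.presheaf.germ U (genericPoint X) hU ≫
      X.presheaf.stalkSpecializes (specializes_genericPoint π hπ) ≫ π.stalkMap (genericPoint Y) =
      π.app U ≫ Y.presheaf.germ (π ⁻¹ᵁ U) (genericPoint Y) hV := by
    rw [← Category.assoc, X.presheaf.germ_stalkSpecializes, Scheme.Hom.germ_stalkMap]
  rw [h2, ← h1]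
  exact (congr($(h3).hom a)).symm

/-- The pullback `(π⁻¹ (U i), f i ∘ π)` of `(U i, f i)` by a dominant morphism. -/
def CartierDivisor.pullback (D : CartierDivisor X) (π : Y ⟶ X) (hπ : IsDominant π) :
    CartierDivisor Y where
  ι := D.ι
  U i := π ⁻¹ᵁ D.U i
  f i := functionFieldMap π hπ (D.f i)
  cover y := D.cover (π y)
  ne_zero i := (map_ne_zero _).mpr (D.ne_zero i)
  compat i j := by
    have h := (D.compat i j).comp π hπ
    rwa [map_div₀] at h

end Cartier

/-! ### Global sections, multiplicities and evaluation codes -/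

section Codes

variable (k : Type u) [Field k] {X : Scheme.{u}} [IsIntegral X]
  [X.Over (Spec (CommRingCat.of k))]

/-- The space `H⁰(X, D)`: the rational functions `s` such that every `s * f i` is regular
on `U i`. -/
def globalSections (D : CartierDivisor X) : Submodule k X.functionField where
  carrier := {s | ∀ i, IsRegularOn (D.U i) (s * D.f i)}
  zero_mem' i := by
    rw [zero_mul]
    exact isRegularOn_zero _
  add_mem' {s t} hs ht i := by
    rw [add_mul]
    exact (hs i).add (ht i)
  smul_mem' c s hs i := by
    rw [Algebra.smul_def, mul_assoc]
    exact (isRegularOn_const k _ c).mul (hs i)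

/-- The rational function `g` is the germ at `p` of an element of `𝔪_p ^ n`. -/
def VanishesToOrder (p : X) (n : ℕ) (g : X.functionField) : Prop :=
  ∃ a ∈ IsLocalRing.maximalIdeal (X.presheaf.stalk p) ^ n,
    algebraMap (X.presheaf.stalk p) X.functionField a = g

/-- The global sections of `D` which have multiplicity at least `n` at `p`: the local equation
`s * f i` belongs to `𝔪_p ^ n`. -/
def sectionsOfMultiplicity (D : CartierDivisor X) (p : X) (n : ℕ) :
    Submodule k X.functionField where
  carrier := {s | s ∈ globalSections k D ∧ ∀ i, p ∈ D.U i → VanishesToOrder p n (s * D.f i)}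
  zero_mem' := ⟨zero_mem _, fun i _ => ⟨0, zero_mem _, by rw [map_zero, zero_mul]⟩⟩
  add_mem' := by
    rintro s t ⟨hs, hs'⟩ ⟨ht, ht'⟩
    refine ⟨add_mem hs ht, fun i hi => ?_⟩
    obtain ⟨a, ha, ha'⟩ := hs' i hi
    obtain ⟨b, hb, hb'⟩ := ht' i hi
    exact ⟨a + b, add_mem ha hb, by rw [map_add, ha', hb', add_mul]⟩
  smul_mem' := by
    rintro c s ⟨hs, hs'⟩
    refine ⟨Submodule.smul_mem _ c hs, fun i hi => ?_⟩
    obtain ⟨a, ha, ha'⟩ := hs' i hi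
    refine ⟨algebraMap k _ c * a, Ideal.mul_mem_left _ _ ha, ?_⟩
    rw [map_mul, ha', Algebra.smul_def, mul_assoc, algebraMap_stalk_functionField]

/-- The rational function `g` is regular at the point `x`, with value `c ∈ k` there. -/
def HasValueAt (x : X) (g : X.functionField) (c : k) : Prop :=
  ∃ a : X.presheaf.stalk x, algebraMap (X.presheaf.stalk x) X.functionField a = g ∧
    (X.residue x).hom a = algebraMap k (X.residueField x) c

variable {k} in
theorem HasValueAt.add {x : X} {g h : X.functionField} {c d : k} (hg : HasValueAt k x g c)
    (hh : HasValueAt k x h d) : HasValueAt k x (g + h) (c + d) := by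
  obtain ⟨a, ha, ha'⟩ := hg
  obtain ⟨b, hb, hb'⟩ := hh
  exact ⟨a + b, by rw [map_add, ha, hb], by rw [map_add, map_add, ha', hb']⟩

variable {k} in
theorem HasValueAt.smul {x : X} {g : X.functionField} {c : k} (d : k)
    (hg : HasValueAt k x g c) : HasValueAt k x (d • g) (d * c) := by
  obtain ⟨a, ha, ha'⟩ := hg
  refine ⟨algebraMap k _ d * a, ?_, ?_⟩
  · rw [map_mul, ha, Algebra.smul_def, algebraMap_stalk_functionField]
  · rw [map_mul, map_mul, ha']
    rfl

theorem hasValueAt_zero (x : X) : HasValueAt k x (0 : X.functionField) 0 :=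
  ⟨0, by rw [map_zero], by rw [map_zero, map_zero]⟩

/-- The words obtained by evaluating the sections in `V ⊆ H⁰(X, D)` at the rational points
`P j`: the coordinate of `s` at a point `x` is `(s * f i)(x)`, where `i` is the chosen index with
`x ∈ U i`. -/
def codeOfSections (D : CartierDivisor X) {J : Type u} (P : J → RationalPoint k X)
    (V : Submodule k X.functionField) : Submodule k (J → k) where
  carrier := {w | ∃ s ∈ V, ∀ j, HasValueAt k (P j).1 (s * D.f (D.index (P j).1)) (w j)}
  zero_mem' := ⟨0, zero_mem _, fun j => by
    rw [zero_mul]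
    exact hasValueAt_zero k _⟩
  add_mem' := by
    rintro v w ⟨s, hs, hs'⟩ ⟨t, ht, ht'⟩
    refine ⟨s + t, add_mem hs ht, fun j => ?_⟩
    rw [add_mul]
    exact (hs' j).add (ht' j)
  smul_mem' := by
    rintro c w ⟨s, hs, hs'⟩
    refine ⟨c • s, Submodule.smul_mem _ c hs, fun j => ?_⟩
    rw [smul_mul_assoc]
    exact (hs' j).smul c

/-- The evaluation code `C_X(D, P)`. -/
def evaluationCode (D : CartierDivisor X) {J : Type u} (P : J → RationalPoint k X) :
    Submodule k (J → k) :=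
  codeOfSections k D P (globalSections k D)

/-- `F` is a homogeneous component of degree `n` of `g`, a rational function which belongs to
`𝔪_p ^ n`, in the coordinates `u, v` at `p`: it is homogeneous of degree `n` and
`g ≡ F(u, v)` modulo `𝔪_p ^ (n + 1)`. -/
def IsHomogeneousComponent (p : X) (u v : X.presheaf.stalk p) (n : ℕ) (g : X.functionField)
    (F : MvPolynomial (Fin 2) k) : Prop :=
  F.IsHomogeneous n ∧ ∃ a : X.presheaf.stalk p,
    algebraMap (X.presheaf.stalk p) X.functionField a = g ∧
    a - MvPolynomial.aeval ![u, v] F ∈ IsLocalRing.maximalIdeal (X.presheaf.stalk p) ^ (n + 1)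

/-- The evaluations, at the rational points different from `p`, of the global sections `s` of `D`
of multiplicity at least `n` at `p`, to which one adds the evaluations at the points of `ℙ¹(k)` of
the homogeneous component of degree `n` of the local equation of `s` at `p`. -/
def extendedCode (D : CartierDivisor X) (p : X) (u v : X.presheaf.stalk p) (n : ℕ) :
    Submodule k ({x : RationalPoint k X // x.1 ≠ p} ⊕ Projectivization k (Fin 2 → k) → k) where
  carrier := {w | ∃ s ∈ sectionsOfMultiplicity k D p n,
    (∀ x : {x : RationalPoint k X // x.1 ≠ p},
      HasValueAt k x.1.1 (s * D.f (D.index x.1.1)) (w (Sum.inl x))) ∧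
    ∃ F : MvPolynomial (Fin 2) k,
      IsHomogeneousComponent k p u v n (s * D.f (D.index p)) F ∧
      ∀ t : Projectivization k (Fin 2 → k), w (Sum.inr t) = MvPolynomial.eval t.rep F}
  zero_mem' := by
    refine ⟨0, zero_mem _, fun x => ?_, 0, ⟨MvPolynomial.isHomogeneous_zero _ _ _, 0, ?_, ?_⟩,
      fun t => ?_⟩
    · rw [zero_mul]
      exact hasValueAt_zero k _
    · rw [map_zero, zero_mul]
    · rw [map_zero, sub_zero]
      exact zero_mem _
    · rw [map_zero]
      rfl
  add_mem' := by
    rintro w w' ⟨s, hs, hw, F, ⟨hF, a, ha, ha'⟩, hwF⟩ ⟨t, ht, hw', G, ⟨hG, b, hb, hb'⟩, hwG⟩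
    refine ⟨s + t, add_mem hs ht, fun x => ?_, F + G, ⟨hF.add hG, a + b, ?_, ?_⟩, fun t => ?_⟩
    · rw [add_mul]
      exact (hw x).add (hw' x)
    · rw [map_add, ha, hb, add_mul]
    · rw [map_add, add_sub_add_comm]
      exact add_mem ha' hb'
    · rw [Pi.add_apply, hwF, hwG, map_add]
  smul_mem' := by
    rintro c w ⟨s, hs, hw, F, ⟨hF, a, ha, ha'⟩, hwF⟩
    refine ⟨c • s, Submodule.smul_mem _ c hs, fun x => ?_, c • F,
      ⟨Submodule.smul_mem (MvPolynomial.homogeneousSubmodule _ _ n) c hF, algebraMap k _ c * a, ?_, ?_⟩,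
      fun t => ?_⟩
    · rw [smul_mul_assoc]
      exact (hw x).smul c
    · rw [map_mul, ha, algebraMap_stalk_functionField, smul_mul_assoc, Algebra.smul_def]
    · rw [map_smul, Algebra.smul_def, ← mul_sub]
      exact Ideal.mul_mem_left _ _ ha'
    · rw [Pi.smul_apply, hwF, MvPolynomial.smul_eval, smul_eq_mul]

variable {k} in
/-- Two linear codes are equivalent by means of the bijection `e` of the coordinates: they
correspond to each other up to the multiplication of each coordinate by a nonzero scalar. -/
def EquivalentVia {J J' : Type u} (e : J ≃ J') (C : Submodule k (J → k))
    (C' : Submodule k (J' → k)) : Prop :=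
  ∃ a : J → kˣ, ∀ w : J' → k, w ∈ C' ↔ (fun j => (a j : k) * w (e j)) ∈ C

end Codes

/-! ### Blowing up a closed point -/

section BlowUp

/-- The inverse image ideal sheaf by `g : T ⟶ X` of a quasi-coherent ideal sheaf of `X` is
invertible: locally it is generated by a nonzerodivisor. -/
def InverseImageInvertible {T X : Scheme.{u}} (I : X.IdealSheafData) (g : T ⟶ X) : Prop :=
  ∀ t : T, ∃ (U : X.affineOpens) (W : T.affineOpens) (h : W.1 ≤ g ⁻¹ᵁ U.1), t ∈ W.1 ∧
    ∃ a ∈ nonZeroDivisors Γ(T, W.1),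
      (I.ideal U).map (g.appLE U.1 W.1 h).hom = Ideal.span {a}

/-- The ideal sheaf of the (reduced) closed point `p`. -/
def pointIdeal {X : Scheme.{u}} (p : X) (hp : IsClosed {p}) : X.IdealSheafData :=
  Scheme.IdealSheafData.vanishingIdeal ⟨{p}, hp⟩

/-- `π : Y ⟶ X` is the blowing-up of `X` at the closed point `p`: the final object among the
schemes over `X` on which the inverse image of the ideal sheaf of `p` is invertible. -/
structure IsBlowUpAt {X Y : Scheme.{u}} (π : Y ⟶ X) (p : X) (hp : IsClosed {p}) : Prop where
  invertible : InverseImageInvertible (pointIdeal p hp) π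
  existsUnique_lift : ∀ (T : Scheme.{u}) (g : T ⟶ X),
    InverseImageInvertible (pointIdeal p hp) g → ∃! h : T ⟶ Y, h ≫ π = g

/-- The Cartier divisor `E` of `Y` is the sum of the exceptional curves of `π : Y ⟶ X` above `p`:
its local equations are regular and generate the ideal of the functions which vanish on
`π⁻¹(p)`, that is, `E` is the reduced divisor with support `π⁻¹(p)`. -/
def IsSumOfExceptionalCurves {X Y : Scheme.{u}} [IsIntegral Y] (π : Y ⟶ X) (p : X)
    (hp : IsClosed {p}) (E : CartierDivisor Y) : Prop :=
  ∀ (j : E.ι) (W : Y.affineOpens), W.1 ≤ E.U j → ∃ a : Γ(Y, W.1), Represents a (E.f j) ∧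
    (Scheme.IdealSheafData.vanishingIdeal ⟨π ⁻¹' {p}, hp.preimage π.continuous⟩).ideal W =
      Ideal.span {a}

theorem IsBlowUpAt.isDominant {X Y : Scheme.{u}} [IsIntegral X] {π : Y ⟶ X} {p : X}
    {hp : IsClosed {p}} (hπ : IsBlowUpAt π p hp) (hX : topologicalKrullDim X = 2) :
    IsDominant π := by
  have hgen : genericPoint X ≠ p := by
    intro h
    have h1 : closure {genericPoint X} = (Set.univ : Set X) := genericPoint_spec X
    rw [h, hp.closure_eq] at h1
    have : Subsingleton X := ⟨fun x y => by
      have hx : x ∈ ({p} : Set X) := h1 ▸ trivial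
      have hy : y ∈ ({p} : Set X) := h1 ▸ trivial
      rw [hx, hy]⟩
    have h2 := topologicalKrullDim_zero_of_discreteTopology X
    rw [hX] at h2
    exact absurd h2 (by decide)
  let V : X.Opens := ⟨{p}ᶜ, hp.isOpen_compl⟩
  have hV : InverseImageInvertible (pointIdeal p hp) V.ι := by
    intro t
    obtain ⟨_, ⟨U, hU', rfl⟩, htU, hUV⟩ :=
      X.isBasis_affineOpens.exists_subset_of_mem_open t.2 V.isOpen
    have hU : IsAffineOpen U := hU'
    have hW : IsAffineOpen (V.ι ⁻¹ᵁ U) := hU.preimage_of_isOpenImmersion V.ι (by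
      rw [Scheme.Opens.opensRange_ι]
      exact hUV)
    refine ⟨⟨U, hU⟩, ⟨V.ι ⁻¹ᵁ U, hW⟩, le_rfl, htU, 1, one_mem _, ?_⟩
    have h1 : (pointIdeal p hp).ideal ⟨U, hU⟩ = ⊤ := by
      have h2 : hU.fromSpec ⁻¹' {p} = ∅ := by
        ext x
        simp only [Set.mem_preimage, Set.mem_singleton_iff, Set.mem_empty_iff_false, iff_false]
        intro hx
        have h3 : hU.fromSpec x ∈ (U : Set X) := by
          rw [← hU.range_fromSpec]
          exact ⟨x, rfl⟩
        exact hUV h3 hx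
      exact (congrArg PrimeSpectrum.vanishingIdeal h2).trans PrimeSpectrum.vanishingIdeal_empty
    rw [h1, Ideal.map_top, Ideal.span_singleton_one]
  obtain ⟨h, hh, -⟩ := hπ.existsUnique_lift _ V.ι hV
  refine ⟨fun x => ?_⟩
  have hgenV : genericPoint X ∈ V := hgen
  let z : V.toScheme := ⟨genericPoint X, hgenV⟩
  have h1 : genericPoint X ∈ Set.range π :=
    ⟨h z, (Scheme.Hom.comp_apply h π z).symm.trans
      (congrArg (fun f : V.toScheme ⟶ X => f z) hh)⟩
  have h2 : closure {genericPoint X} = (Set.univ : Set X) := genericPoint_spec X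
  exact closure_mono (Set.singleton_subset_iff.mpr h1) (h2 ▸ trivial)

end BlowUp

end BlowUpCode

end

open BlowUpCode

/-! ### Local subrings of a field -/

namespace BlowUpCode

open IsLocalRing

section LocalSubrings

variable {L : Type*} [Field L]

theorem isUnit_subring_iff {A : Subring L} {x : L} (hx : x ∈ A) :
    IsUnit (⟨x, hx⟩ : A) ↔ x ≠ 0 ∧ x⁻¹ ∈ A := by
  constructor
  · intro h
    obtain ⟨⟨b, hb⟩, hab⟩ := isUnit_iff_exists_inv.mp h
    have hab' : x * b = 1 := congrArg Subtype.val hab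
    exact ⟨left_ne_zero_of_mul_eq_one hab', by rwa [inv_eq_of_mul_eq_one_right hab']⟩
  · rintro ⟨h0, h⟩
    exact isUnit_iff_exists_inv.mpr ⟨⟨x⁻¹, h⟩, Subtype.ext (mul_inv_cancel₀ h0)⟩

theorem localSubring_le_iff {A B : LocalSubring L} :
    A ≤ B ↔ A.toSubring ≤ B.toSubring ∧
      ∀ x ∈ A.toSubring, x⁻¹ ∈ B.toSubring → x⁻¹ ∈ A.toSubring := by
  constructor
  · rintro ⟨h, hl⟩
    refine ⟨h, fun x hx hxB => ?_⟩
    by_cases h0 : x = 0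
    · rw [h0, inv_zero]
      exact zero_mem _
    · have h1 : IsUnit (Subring.inclusion h ⟨x, hx⟩) :=
        (isUnit_subring_iff (h hx)).mpr ⟨h0, hxB⟩
      exact ((isUnit_subring_iff hx).mp (hl.map_nonunit _ h1)).2
  · rintro ⟨h, hl⟩
    refine ⟨h, ⟨fun ⟨x, hx⟩ hu => ?_⟩⟩
    have h1 := (isUnit_subring_iff (h hx)).mp hu
    exact (isUnit_subring_iff hx).mpr ⟨h1.1, hl x hx h1.2⟩

theorem mem_ofPrime_iff {A : Subring L} {q : Ideal A} [q.IsPrime] {x : L} :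
    x ∈ (LocalSubring.ofPrime A q).toSubring ↔ ∃ a s : A, s ∉ q ∧ x = a / s := by
  constructor
  · intro hx
    obtain ⟨⟨a, s⟩, h⟩ := IsLocalization.surj q.primeCompl
      (⟨x, hx⟩ : (LocalSubring.ofPrime A q).toSubring)
    have h' : x * (s : A) = a := congrArg Subtype.val h
    refine ⟨a, s, s.2, ?_⟩
    have h0 : ((s : A) : L) ≠ 0 := fun h0 => s.2 (by
      rw [show (s : A) = 0 from Subtype.ext h0]
      exact zero_mem _)
    rw [← h', mul_div_cancel_right₀ _ h0]
  · rintro ⟨a, s, hs, rfl⟩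
    have h1 := IsLocalization.map_units (LocalSubring.ofPrime A q).toSubring
      (⟨s, hs⟩ : q.primeCompl)
    have h2 := (isUnit_subring_iff (LocalSubring.le_ofPrime A q s.2)).mp h1
    rw [div_eq_mul_inv]
    exact mul_mem (LocalSubring.le_ofPrime A q a.2) h2.2

theorem inv_mem_ofPrime_iff {A : Subring L} {q : Ideal A} [q.IsPrime] {a : A} (h0 : a ≠ 0) :
    (a : L)⁻¹ ∈ (LocalSubring.ofPrime A q).toSubring ↔ a ∉ q := by
  constructor
  · rintro h ha
    obtain ⟨b, s, hs, h⟩ := mem_ofPrime_iff.mp h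
    have hs0 : (s : L) ≠ 0 := fun h0 => hs (by
      rw [show s = 0 from Subtype.ext h0]
      exact zero_mem _)
    have ha0 : (a : L) ≠ 0 := fun h => h0 (Subtype.ext h)
    have : s = b * a := Subtype.ext (by
      push_cast
      field_simp at h
      rw [h, mul_comm])
    exact hs (this ▸ Ideal.mul_mem_left _ _ ha)
  · intro h
    exact mem_ofPrime_iff.mpr ⟨1, a, h, by simp⟩

/-- The localization of a subring at the contraction of the maximal ideal of a larger local
subring is dominated by the latter. -/
theorem exists_ofPrime_le {A : Subring L} (O : LocalSubring L) (h : A ≤ O.toSubring) :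
    ∃ (q : Ideal A) (_ : q.IsPrime), LocalSubring.ofPrime A q ≤ O ∧
      ∀ a : A, a ∈ q ↔ ¬ IsUnit (⟨a, h a.2⟩ : O.toSubring) := by
  refine ⟨(maximalIdeal O.toSubring).comap (Subring.inclusion h), inferInstance, ?_,
    fun a => Iff.rfl⟩
  rw [localSubring_le_iff]
  have key : ∀ s : A, s ∉ (maximalIdeal O.toSubring).comap (Subring.inclusion h) →
      (s : L)⁻¹ ∈ O.toSubring := by
    intro s hs
    have : IsUnit (⟨s, h s.2⟩ : O.toSubring) := not_not.mp hs
    exact ((isUnit_subring_iff _).mp this).2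
  constructor
  · intro x hx
    obtain ⟨a, s, hs, rfl⟩ := mem_ofPrime_iff.mp hx
    rw [div_eq_mul_inv]
    exact mul_mem (h a.2) (key s hs)
  · intro x hx hxO
    obtain ⟨a, s, hs, rfl⟩ := mem_ofPrime_iff.mp hx
    rw [inv_div] at hxO ⊢
    refine mem_ofPrime_iff.mpr ?_
    by_cases ha : a ∈ (maximalIdeal O.toSubring).comap (Subring.inclusion h)
    · by_cases h0 : (a : L) = 0
      · exact ⟨0, 1, by simp, by simp [h0]⟩
      · exfalso
        have h1 : (a : L)⁻¹ ∈ O.toSubring := by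
          have := mul_mem hxO (key s hs)
          have hs0 : (s : L) ≠ 0 := fun h0 => hs (by
            rw [show s = 0 from Subtype.ext h0]
            exact zero_mem _)
          rwa [show (s : L) / a * (s : L)⁻¹ = (a : L)⁻¹ by field_simp] at this
        exact ha ((isUnit_subring_iff (h a.2)).mpr ⟨h0, h1⟩)
    · exact ⟨s, a, ha, rfl⟩

end LocalSubrings

/-! ### Ideals which become principal in a subring of a field -/

section Generators

variable {R L : Type*} [CommRing R] [Field L]

/-- The ideal generated by the image of `I` in the subring `O` of the field `L` is generated by
the nonzero element `e`. -/
structure IsGenerator (φ : R →+* L) (I : Ideal R) (O : Subring L) (e : L) : Prop where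
  ne_zero : e ≠ 0
  div_mem : ∀ a ∈ I, φ a / e ∈ O
  mem_span : e ∈ Submodule.span O (φ '' I)

variable {φ : R →+* L} {I : Ideal R} {O O' : Subring L} {e e' : L}

theorem IsGenerator.mono (h : IsGenerator φ I O e) (hO : O ≤ O') : IsGenerator φ I O' e where
  ne_zero := h.ne_zero
  div_mem a ha := hO (h.div_mem a ha)
  mem_span := by
    have : ∀ x ∈ Submodule.span O (φ '' I), x ∈ Submodule.span O' (φ '' I) := by
      intro x hx
      induction hx using Submodule.span_induction with
      | mem x hx => exact Submodule.subset_span hx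
      | zero => exact zero_mem _
      | add x y _ _ hx hy => exact add_mem hx hy
      | smul c x _ hx => exact Submodule.smul_mem _ (⟨c, hO c.2⟩ : O') hx
    exact this e h.mem_span

theorem IsGenerator.span_div_mem (h : IsGenerator φ I O e) {x : L}
    (hx : x ∈ Submodule.span O (φ '' I)) : x / e ∈ O := by
  induction hx using Submodule.span_induction with
  | mem x hx =>
    obtain ⟨a, ha, rfl⟩ := hx
    exact h.div_mem a ha
  | zero => simp
  | add x y _ _ hx hy =>
    rw [add_div]
    exact add_mem hx hy
  | smul c x _ hx =>
    rw [Subring.smul_def, smul_eq_mul, mul_div_assoc]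
    exact mul_mem c.2 hx

theorem IsGenerator.div_mem_of_isGenerator (h : IsGenerator φ I O e) (h' : IsGenerator φ I O e') :
    e' / e ∈ O :=
  h.span_div_mem h'.mem_span

theorem IsGenerator.of_div_mem (h : IsGenerator φ I O e) (h0 : e' ≠ 0) (h1 : e / e' ∈ O)
    (h2 : e' / e ∈ O) : IsGenerator φ I O e' where
  ne_zero := h0
  div_mem a ha := by
    have := mul_mem (h.div_mem a ha) h1
    rwa [div_mul_div_cancel₀ h.ne_zero] at this
  mem_span := by
    have := Submodule.smul_mem _ (⟨_, h2⟩ : O) h.mem_span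
    rwa [Subring.smul_def, smul_eq_mul, div_mul_cancel₀ _ h.ne_zero] at this

theorem IsGenerator.div_pow_mem (h : IsGenerator φ I O e) (hφ : ∀ r, φ r ∈ O) (n : ℕ) :
    ∀ a ∈ I ^ n, φ a / e ^ n ∈ O := by
  induction n with
  | zero =>
    intro a _
    simpa using hφ a
  | succ n ih =>
    intro a ha
    rw [pow_succ] at ha
    refine Submodule.mul_induction_on ha (fun x hx y hy => ?_) (fun x y hx hy => ?_)
    · have := mul_mem (ih x hx) (h.div_mem y hy)
      rwa [div_mul_div_comm, ← map_mul, ← pow_succ] at this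
    · rw [map_add, add_div]
      exact add_mem hx hy

theorem isGenerator_range {O : Type*} [CommRing O] (j : O →+* L) (hj : Function.Injective j)
    (ψ : R →+* O) (I : Ideal R) {a : O} (ha : a ≠ 0) (h : I.map ψ = Ideal.span {a}) :
    IsGenerator (j.comp ψ) I j.range (j a) where
  ne_zero := (map_ne_zero_iff j hj).mpr ha
  div_mem r hr := by
    have : ψ r ∈ Ideal.span {a} := h ▸ Ideal.mem_map_of_mem ψ hr
    obtain ⟨c, hc⟩ := Ideal.mem_span_singleton.mp this
    refine ⟨c, ?_⟩
    rw [RingHom.comp_apply, hc, map_mul, mul_div_cancel_left₀ _ ((map_ne_zero_iff j hj).mpr ha)]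
  mem_span := by
    have ha' : a ∈ I.map ψ := h ▸ Ideal.mem_span_singleton_self a
    have : ∀ x ∈ I.map ψ, j x ∈ Submodule.span j.range (j.comp ψ '' I) := by
      intro x hx
      refine Submodule.span_induction ?_ ?_ ?_ ?_ hx
      · rintro _ ⟨r, hr, rfl⟩
        exact Submodule.subset_span ⟨r, hr, rfl⟩
      · rw [map_zero]
        exact zero_mem _
      · intro x y _ _ hx hy
        rw [map_add]
        exact add_mem hx hy
      · intro c x _ hx
        rw [smul_eq_mul, map_mul]
        exact Submodule.smul_mem _ (⟨j c, c, rfl⟩ : j.range) hx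
    exact this a ha'

theorem exists_mem_map_of_mem_span (hφ : ∀ r, φ r ∈ O) {x : L}
    (hx : x ∈ Submodule.span O (φ '' I)) :
    ∃ hx : x ∈ O, (⟨x, hx⟩ : O) ∈ I.map (φ.codRestrict O hφ) := by
  induction hx using Submodule.span_induction with
  | mem x hx =>
    obtain ⟨a, ha, rfl⟩ := hx
    exact ⟨hφ a, Ideal.mem_map_of_mem (φ.codRestrict O hφ) ha⟩
  | zero => exact ⟨zero_mem _, zero_mem _⟩
  | add x y _ _ hx hy =>
    obtain ⟨hx, hx'⟩ := hx
    obtain ⟨hy, hy'⟩ := hy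
    exact ⟨add_mem hx hy, add_mem hx' hy'⟩
  | smul c x _ hx =>
    obtain ⟨hx, hx'⟩ := hx
    exact ⟨mul_mem c.2 hx, Ideal.mul_mem_left _ c hx'⟩

theorem IsGenerator.mem (h : IsGenerator φ I O e) (hφ : ∀ r, φ r ∈ O) : e ∈ O :=
  (exists_mem_map_of_mem_span hφ h.mem_span).1

theorem IsGenerator.map_eq_span (h : IsGenerator φ I O e) (hφ : ∀ r, φ r ∈ O) :
    I.map (φ.codRestrict O hφ) = Ideal.span {(⟨e, h.mem hφ⟩ : O)} := by
  apply le_antisymm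
  · rw [Ideal.map_le_iff_le_comap]
    intro a ha
    refine Ideal.mem_span_singleton.mpr ⟨⟨_, h.div_mem a ha⟩, Subtype.ext ?_⟩
    change φ a = e * (φ a / e)
    rw [mul_div_cancel₀ _ h.ne_zero]
  · rw [Ideal.span_singleton_le_iff_mem]
    exact (exists_mem_map_of_mem_span hφ h.mem_span).2

/-- A finitely generated nonzero ideal becomes principal in a valuation ring. -/
theorem exists_isGenerator_valuationSubring (hφ : Function.Injective φ) (hI : I.FG) (hI0 : I ≠ ⊥)
    (V : ValuationSubring L) (hV : ∀ r, φ r ∈ V.toSubring) :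
    ∃ e, IsGenerator φ I V.toSubring e := by
  let ψ : R →+* V := φ.codRestrict V hV
  have hp : (I.map ψ).IsPrincipal := IsBezout.isPrincipal_of_FG _ (hI.map ψ)
  obtain ⟨a, ha⟩ := hp
  have hψ : Function.Injective ψ := fun x y hxy => hφ (congrArg Subtype.val hxy)
  have ha0 : a ≠ 0 := by
    rintro rfl
    apply hI0
    rw [← Ideal.map_eq_bot_iff_of_injective hψ, ha]
    simp
  have h := isGenerator_range V.subtype Subtype.val_injective ψ I ha0 ha
  refine ⟨a, ?_⟩
  have h1 : V.subtype.range = V.toSubring := by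
    ext x
    exact ⟨fun ⟨y, hy⟩ => hy ▸ y.2, fun hx => ⟨⟨x, hx⟩, rfl⟩⟩
  rw [h1] at h
  exact h

end Generators

/-! ### The affine charts of the blowing-up of a two-dimensional regular local ring -/

section Chart

open Polynomial

theorem exists_sum_of_mem_span_pair_pow {R : Type*} [CommRing R] {u v : R} (n : ℕ) :
    ∀ a ∈ Ideal.span {u, v} ^ n, ∃ c : ℕ → R,
      a = ∑ i ∈ Finset.range (n + 1), c i * (u ^ (n - i) * v ^ i) := by
  induction n with
  | zero =>
    intro a _
    exact ⟨fun _ => a, by simp⟩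
  | succ n ih =>
    intro a ha
    rw [pow_succ, show Ideal.span {u, v} ^ n * Ideal.span {u, v} =
      Ideal.span {u, v} ^ n * (Ideal.span {u} ⊔ Ideal.span {v}) by rw [Ideal.span_insert],
      Ideal.mul_sup] at ha
    obtain ⟨x, hx, y, hy, rfl⟩ := Submodule.mem_sup.mp ha
    obtain ⟨x, hx', rfl⟩ := Ideal.mem_mul_span_singleton.mp hx
    obtain ⟨y, hy', rfl⟩ := Ideal.mem_mul_span_singleton.mp hy
    obtain ⟨c, hc⟩ := ih x hx'
    obtain ⟨d, hd⟩ := ih y hy'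
    refine ⟨fun i => (if i ≤ n then c i else 0) + (if i = 0 then 0 else d (i - 1)), ?_⟩
    simp only [add_mul, Finset.sum_add_distrib]
    congr 1
    · rw [Finset.sum_range_succ, if_neg (by omega), zero_mul, add_zero, hc, Finset.sum_mul]
      refine Finset.sum_congr rfl fun i hi => ?_
      have hi' : i ≤ n := by simpa [Nat.lt_succ_iff] using hi
      rw [if_pos hi', show n + 1 - i = n - i + 1 by omega]
      ring
    · rw [Finset.sum_range_succ', if_pos rfl, zero_mul, add_zero, hd, Finset.sum_mul]
      refine Finset.sum_congr rfl fun i hi => ?_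
      rw [if_neg (by omega), Nat.add_sub_cancel, show n + 1 - (i + 1) = n - i by omega]
      ring

/-- The elements `u, v` of a local ring generate the maximal ideal, and they form a regular
sequence. -/
structure IsParameterPair {R : Type*} [CommRing R] [IsLocalRing R] (u v : R) : Prop where
  span_eq : maximalIdeal R = Ideal.span {u, v}
  ne_zero : u ≠ 0
  dvd_of_dvd_mul : ∀ c, u ∣ v * c → u ∣ c

section Basic

variable {R L : Type*} [CommRing R] [Field L] (φ : R →+* L) (u v : R)

/-- The subring `R[v / u]` of the field `L`. -/
noncomputable def chart : Subring L := (eval₂RingHom φ (φ v / φ u)).range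

variable {φ u v}

theorem map_mem_chart (r : R) : φ r ∈ chart φ u v := ⟨C r, by simp⟩

theorem div_mem_chart : φ v / φ u ∈ chart φ u v := ⟨X, by simp⟩

theorem eval₂_mem_chart (P : R[X]) : P.eval₂ φ (φ v / φ u) ∈ chart φ u v := ⟨P, rfl⟩

theorem chart_le {O : Subring L} (h : ∀ r, φ r ∈ O) (h' : φ v / φ u ∈ O) : chart φ u v ≤ O := by
  rintro _ ⟨P, rfl⟩
  rw [coe_eval₂RingHom, eval₂_eq_sum]
  exact sum_mem fun i _ => mul_mem (h _) (pow_mem h' _)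

theorem exists_map_eq_pow_mul_eval₂ (hu : φ u ≠ 0) (Q : R[X]) (n : ℕ) (hQ : Q.natDegree ≤ n) :
    ∃ r, φ r = φ u ^ n * Q.eval₂ φ (φ v / φ u) := by
  refine ⟨∑ i ∈ Finset.range (n + 1), Q.coeff i * (u ^ (n - i) * v ^ i), ?_⟩
  rw [eval₂_eq_sum_range' φ (Nat.lt_succ_of_le hQ), Finset.mul_sum, map_sum]
  refine Finset.sum_congr rfl fun i hi => ?_
  have hi' : i ≤ n := by simpa [Nat.lt_succ_iff] using hi
  rw [map_mul, map_mul, map_pow, map_pow, div_pow,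
    show φ u ^ n = φ u ^ (n - i) * φ u ^ i by rw [← pow_add, Nat.sub_add_cancel hi']]
  field_simp

end Basic

variable {R L : Type*} [CommRing R] [IsLocalRing R] [Field L] {φ : R →+* L} {u v : R}

theorem isGenerator_of_div_mem (hφ : Function.Injective φ)
    (huv : maximalIdeal R = Ideal.span {u, v}) (hu : u ≠ 0) {O : Subring L}
    (h : ∀ r, φ r ∈ O) (h' : φ v / φ u ∈ O) :
    IsGenerator φ (maximalIdeal R) O (φ u) where
  ne_zero := (map_ne_zero_iff φ hφ).mpr hu
  div_mem a ha := by
    have hu0 : φ u ≠ 0 := (map_ne_zero_iff φ hφ).mpr hu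
    rw [huv] at ha
    obtain ⟨x, y, rfl⟩ := Ideal.mem_span_pair.mp ha
    have : φ (x * u + y * v) / φ u = φ x + φ y * (φ v / φ u) := by
      rw [map_add, map_mul, map_mul]
      field_simp
    rw [this]
    exact add_mem (h x) (mul_mem (h y) h')
  mem_span := Submodule.subset_span ⟨u, by
    rw [huv]
    exact Ideal.subset_span (by simp), rfl⟩

theorem IsParameterPair.coeff_mem_of_eval₂_eq_zero (hφ : Function.Injective φ)
    (huv : IsParameterPair u v) (n : ℕ) : ∀ P : R[X], P.natDegree ≤ n →
    P.eval₂ φ (φ v / φ u) = 0 → ∀ i, P.coeff i ∈ maximalIdeal R := by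
  have hu0 : φ u ≠ 0 := (map_ne_zero_iff φ hφ).mpr huv.ne_zero
  have hu : u ∈ maximalIdeal R := huv.span_eq ▸ Ideal.subset_span (by simp)
  have hv : v ∈ maximalIdeal R := huv.span_eq ▸ Ideal.subset_span (by simp)
  induction n with
  | zero =>
    intro P hP h i
    rw [eq_C_of_natDegree_le_zero hP, eval₂_C, map_eq_zero_iff φ hφ] at h
    rw [eq_C_of_natDegree_le_zero hP, h, C_0, coeff_zero]
    exact zero_mem _
  | succ n ih =>
    intro P hP h i
    set a := P.coeff (n + 1) with ha
    have hQ : (P - C a * X ^ (n + 1)).natDegree ≤ n := by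
      rw [natDegree_le_iff_coeff_eq_zero]
      intro N hN
      rw [coeff_sub, coeff_C_mul_X_pow]
      split_ifs with h1
      · rw [h1, ha, sub_self]
      · rw [sub_zero]
        exact coeff_eq_zero_of_natDegree_lt (by omega)
    obtain ⟨r, hr⟩ := exists_map_eq_pow_mul_eval₂ (v := v) hu0 _ n hQ
    have hdvd : ∀ k c, u ∣ v ^ k * c → u ∣ c := by
      intro k
      induction k with
      | zero => simp
      | succ k ihk =>
        intro c hc
        rw [pow_succ', mul_assoc] at hc
        exact ihk c (huv.dvd_of_dvd_mul _ hc)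
    obtain ⟨c, hc⟩ : u ∣ a := by
      refine hdvd (n + 1) a ⟨-r, hφ ?_⟩
      rw [eval₂_sub, h, zero_sub, eval₂_mul, eval₂_C, eval₂_X_pow] at hr
      rw [map_mul, map_mul, map_neg, hr, map_pow, div_pow]
      field_simp
      ring
    have hQ' : (P - C a * X ^ (n + 1) + C (c * v) * X ^ n).natDegree ≤ n :=
      natDegree_add_le_of_degree_le hQ (natDegree_C_mul_X_pow_le _ _)
    have h0 := ih _ hQ' (by
      rw [eval₂_add, eval₂_sub, h, eval₂_mul, eval₂_C, eval₂_X_pow, eval₂_mul, eval₂_C, eval₂_X_pow,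
        hc, map_mul, map_mul, div_pow, div_pow]
      field_simp
      ring)
    have h1 := h0 i
    rw [coeff_add, coeff_sub, coeff_C_mul_X_pow, coeff_C_mul_X_pow] at h1
    have h2 : (if i = n + 1 then a else 0) ∈ maximalIdeal R := by
      split_ifs
      · rw [hc]
        exact Ideal.mul_mem_right _ _ hu
      · exact zero_mem _
    have h3 : (if i = n then c * v else 0) ∈ maximalIdeal R := by
      split_ifs
      · exact Ideal.mul_mem_left _ _ hv
      · exact zero_mem _
    have h4 := add_mem (sub_mem h1 h3) h2
    simpa using h4

/-- A polynomial in `v / u` is divisible by `u` in `R[v / u]` if and only if its coefficients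
belong to the maximal ideal of `R`. -/
theorem IsParameterPair.eval₂_div_mem_chart_iff (hφ : Function.Injective φ)
    (huv : IsParameterPair u v) (P : R[X]) :
    P.eval₂ φ (φ v / φ u) / φ u ∈ chart φ u v ↔ ∀ i, P.coeff i ∈ maximalIdeal R := by
  have hu0 : φ u ≠ 0 := (map_ne_zero_iff φ hφ).mpr huv.ne_zero
  have hu : u ∈ maximalIdeal R := huv.span_eq ▸ Ideal.subset_span (by simp)
  constructor
  · rintro ⟨Q, hQ⟩ i
    rw [coe_eval₂RingHom, eq_div_iff hu0] at hQ
    have h := huv.coeff_mem_of_eval₂_eq_zero hφ _ (P - C u * Q) le_rfl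
      (by rw [eval₂_sub, eval₂_mul, eval₂_C, ← hQ, mul_comm, sub_self]) i
    rw [coeff_sub, coeff_C_mul] at h
    simpa using add_mem h (Ideal.mul_mem_right (Q.coeff i) _ hu)
  · intro h
    rw [eval₂_eq_sum, sum_def, Finset.sum_div]
    refine sum_mem fun i _ => ?_
    rw [mul_div_right_comm]
    exact mul_mem ((isGenerator_of_div_mem hφ huv.span_eq huv.ne_zero map_mem_chart
      div_mem_chart).div_mem _ (h i)) (pow_mem div_mem_chart _)

/-- The ideal generated by `u` in `R[v / u]` is prime. -/
theorem IsParameterPair.isPrime_span (hφ : Function.Injective φ) (huv : IsParameterPair u v) :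
    (Ideal.span {(⟨φ u, map_mem_chart u⟩ : chart φ u v)}).IsPrime := by
  have hu0 : φ u ≠ 0 := (map_ne_zero_iff φ hφ).mpr huv.ne_zero
  have key : ∀ P : R[X], (⟨_, eval₂_mem_chart P⟩ : chart φ u v) ∈
      Ideal.span {(⟨φ u, map_mem_chart u⟩ : chart φ u v)} ↔
      P ∈ (maximalIdeal R).map C := by
    intro P
    rw [Ideal.mem_map_C_iff, ← huv.eval₂_div_mem_chart_iff hφ, Ideal.mem_span_singleton]
    constructor
    · rintro ⟨c, hc⟩
      have hc' : P.eval₂ φ (φ v / φ u) = φ u * c := congrArg Subtype.val hc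
      rw [hc', mul_div_cancel_left₀ _ hu0]
      exact c.2
    · intro h
      exact ⟨⟨_, h⟩, Subtype.ext (mul_div_cancel₀ _ hu0).symm⟩
  have hprime : ((maximalIdeal R).map (C : R →+* R[X])).IsPrime :=
    Ideal.isPrime_map_C_of_isPrime
  constructor
  · intro h
    apply hprime.one_notMem
    rw [← key, h]
    trivial
  · rintro ⟨_, P, rfl⟩ ⟨_, Q, rfl⟩ h
    have h' : (⟨_, eval₂_mem_chart (P * Q)⟩ : chart φ u v) ∈
        Ideal.span {(⟨φ u, map_mem_chart u⟩ : chart φ u v)} := by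
      convert h using 1
      exact Subtype.ext (eval₂_mul _ _)
    rw [key] at h'
    exact (hprime.mem_or_mem h').imp (key P).mpr (key Q).mpr

theorem IsParameterPair.div_mem_of_mem_span (hφ : Function.Injective φ)
    (huv : IsParameterPair u v) {O : Subring L} {a : chart φ u v}
    (h : chart φ u v ≤ O) (ha : a ∈ Ideal.span {(⟨φ u, map_mem_chart u⟩ : chart φ u v)}) :
    (a : L) / φ u ∈ O := by
  have hu0 : φ u ≠ 0 := (map_ne_zero_iff φ hφ).mpr huv.ne_zero
  obtain ⟨c, rfl⟩ := Ideal.mem_span_singleton.mp ha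
  rw [Subring.coe_mul, mul_div_cancel_left₀ _ hu0]
  exact h c.2

/-- The ideal generated by `u` is radical in every localization of `R[v / u]`. -/
theorem IsParameterPair.div_mem_of_pow_div_mem (hφ : Function.Injective φ)
    (huv : IsParameterPair u v) (q : Ideal (chart φ u v)) [q.IsPrime] {x : L}
    (hx : x ∈ (LocalSubring.ofPrime _ q).toSubring) {n : ℕ}
    (h : x ^ n / φ u ∈ (LocalSubring.ofPrime _ q).toSubring) :
    x / φ u ∈ (LocalSubring.ofPrime _ q).toSubring := by
  have hu0 : φ u ≠ 0 := (map_ne_zero_iff φ hφ).mpr huv.ne_zero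
  have hne : ∀ s : chart φ u v, s ∉ q → (s : L) ≠ 0 := fun s hs h0 => hs (by
    rw [show s = 0 from Subtype.ext h0]
    exact zero_mem _)
  obtain ⟨a, s, hs, rfl⟩ := mem_ofPrime_iff.mp hx
  obtain ⟨b, t, ht, h⟩ := mem_ofPrime_iff.mp h
  have hs0 := hne s hs
  have ht0 := hne t ht
  have hprime := huv.isPrime_span hφ
  have hmem : a ^ n * t ∈ Ideal.span {(⟨φ u, map_mem_chart u⟩ : chart φ u v)} := by
    refine Ideal.mem_span_singleton.mpr ⟨b * s ^ n, Subtype.ext ?_⟩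
    push_cast
    rw [div_pow] at h
    field_simp at h
    linear_combination h
  rcases hprime.mem_or_mem hmem with h1 | h1
  · have h2 := huv.div_mem_of_mem_span hφ le_rfl (hprime.mem_of_pow_mem _ h1)
    exact mem_ofPrime_iff.mpr ⟨⟨_, h2⟩, s, hs, by rw [div_right_comm]⟩
  · by_cases hu : (⟨φ u, map_mem_chart u⟩ : chart φ u v) ∈ q
    · exact absurd ((Ideal.span_singleton_le_iff_mem _).mpr hu h1) ht
    · rw [div_div]
      refine mem_ofPrime_iff.mpr ⟨a, s * ⟨φ u, map_mem_chart u⟩, fun h => ?_, rfl⟩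
      rcases Ideal.IsPrime.mem_or_mem inferInstance h with h | h
      exacts [hs h, hu h]

/-- An element of `R` which is divisible by `u ^ n` in the localization of `R[v / u]` at the prime
ideal generated by `u` belongs to the power `n` of the maximal ideal. -/
theorem IsParameterPair.mem_pow_of_div_mem (hφ : Function.Injective φ)
    (huv : IsParameterPair u v)
    [(Ideal.span {(⟨φ u, map_mem_chart u⟩ : chart φ u v)}).IsPrime] (n : ℕ) (a : R)
    (h : φ a / φ u ^ n ∈ (LocalSubring.ofPrime _
      (Ideal.span {(⟨φ u, map_mem_chart u⟩ : chart φ u v)})).toSubring) :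
    a ∈ maximalIdeal R ^ n := by
  have hu0 : φ u ≠ 0 := (map_ne_zero_iff φ hφ).mpr huv.ne_zero
  induction n with
  | zero => simp
  | succ n ih =>
    have h1 : a ∈ maximalIdeal R ^ n := by
      apply ih
      have := mul_mem h (LocalSubring.le_ofPrime _ _ (map_mem_chart u))
      rwa [pow_succ, ← div_div, div_mul_cancel₀ _ hu0] at this
    have h2 := h1
    rw [huv.span_eq] at h2
    obtain ⟨c, hc⟩ := exists_sum_of_mem_span_pair_pow n a h2
    let P : R[X] := ∑ i ∈ Finset.range (n + 1), C (c i) * X ^ i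
    have hP : φ a / φ u ^ n = P.eval₂ φ (φ v / φ u) := by
      rw [eval₂_finsetSum, hc, map_sum, Finset.sum_div]
      refine Finset.sum_congr rfl fun i hi => ?_
      have hi' : i ≤ n := by simpa [Nat.lt_succ_iff] using hi
      rw [eval₂_mul, eval₂_C, eval₂_X_pow, map_mul, map_mul, map_pow, map_pow, div_pow,
        show φ u ^ n = φ u ^ (n - i) * φ u ^ i by rw [← pow_add, Nat.sub_add_cancel hi']]
      field_simp
    rw [pow_succ, ← div_div, hP] at h
    obtain ⟨b, s, hs, h⟩ := mem_ofPrime_iff.mp h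
    have hs0 : (s : L) ≠ 0 := fun h0 => hs (by
      rw [show s = 0 from Subtype.ext h0]
      exact zero_mem _)
    have h3 : (⟨_, eval₂_mem_chart P⟩ : chart φ u v) * s ∈
        Ideal.span {(⟨φ u, map_mem_chart u⟩ : chart φ u v)} := by
      refine Ideal.mem_span_singleton.mpr ⟨b, Subtype.ext ?_⟩
      push_cast
      field_simp at h
      linear_combination h
    have h4 := (Ideal.IsPrime.mem_or_mem inferInstance h3).resolve_right hs
    have h5 := (huv.eval₂_div_mem_chart_iff hφ P).mp (huv.div_mem_of_mem_span hφ le_rfl h4)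
    rw [hc]
    refine sum_mem fun i hi => ?_
    have hi' : i ≤ n := by simpa [Nat.lt_succ_iff] using hi
    have h6 := h5 i
    rw [finsetSum_coeff] at h6
    simp only [coeff_C_mul_X_pow] at h6
    rw [Finset.sum_ite_eq, if_pos hi] at h6
    rw [pow_succ']
    refine Ideal.mul_mem_mul h6 ?_
    rw [show n = (n - i) + i by omega, pow_add, Nat.add_sub_cancel]
    exact Ideal.mul_mem_mul (Ideal.pow_mem_pow (huv.span_eq ▸ Ideal.subset_span (by simp)) _)
      (Ideal.pow_mem_pow (huv.span_eq ▸ Ideal.subset_span (by simp)) _)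

/-- The points of the exceptional curve in a chart: the residue map of `R` extends to `R[v / u]`,
with an arbitrary value at `v / u`. -/
theorem IsParameterPair.exists_ringHom (hφ : Function.Injective φ)
    (huv : IsParameterPair u v) {κ : Type*} [Field κ] (ε : R →+* κ)
    (hε : ∀ r ∈ maximalIdeal R, ε r = 0) (b : κ) :
    ∃ χ : chart φ u v →+* κ, (∀ r, χ ⟨φ r, map_mem_chart r⟩ = ε r) ∧
      χ ⟨φ v / φ u, div_mem_chart⟩ = b := by
  let f : R[X] →+* chart φ u v := (eval₂RingHom φ (φ v / φ u)).rangeRestrict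
  have hf : Function.Surjective f := RingHom.rangeRestrict_surjective _
  have hker : RingHom.ker f ≤ RingHom.ker (eval₂RingHom ε b) := by
    intro P hP
    have hP' : P.eval₂ φ (φ v / φ u) = 0 := congrArg Subtype.val hP
    rw [RingHom.mem_ker, coe_eval₂RingHom, eval₂_eq_sum]
    refine Finset.sum_eq_zero fun i _ => ?_
    change ε (P.coeff i) * b ^ i = 0
    rw [hε _ (huv.coeff_mem_of_eval₂_eq_zero hφ _ P le_rfl hP' i), zero_mul]
  have key := RingHom.liftOfRightInverse_comp_apply f _ (Function.rightInverse_surjInv hf)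
    ⟨eval₂RingHom ε b, hker⟩
  refine ⟨f.liftOfRightInverse _ (Function.rightInverse_surjInv hf) ⟨eval₂RingHom ε b, hker⟩,
    fun r => ?_, ?_⟩
  · have := key (C r)
    rw [show f (C r) = ⟨φ r, map_mem_chart r⟩ from Subtype.ext (eval₂_C _ _)] at this
    rw [this]
    exact eval₂_C _ _
  · have := key X
    rw [show f X = ⟨φ v / φ u, div_mem_chart⟩ from Subtype.ext (eval₂_X _ _)] at this
    rw [this]
    exact eval₂_X _ _

theorem exists_isUnit_div_of_isGenerator (hspan : maximalIdeal R = Ideal.span {u, v})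
    {O : LocalSubring L} (hO : ∀ r, φ r ∈ O.toSubring) {e : L}
    (h : IsGenerator φ (maximalIdeal R) O.toSubring e) :
    (u ≠ 0 ∧ e / φ u ∈ O.toSubring) ∨ (v ≠ 0 ∧ e / φ v ∈ O.toSubring) := by
  have hu : u ∈ maximalIdeal R := hspan ▸ Ideal.subset_span (by simp)
  have hv : v ∈ maximalIdeal R := hspan ▸ Ideal.subset_span (by simp)
  obtain ⟨x, y, hx, hy, he⟩ : ∃ x y, x ∈ O.toSubring ∧ y ∈ O.toSubring ∧
      e = x * φ u + y * φ v := by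
    have := h.mem_span
    have key : ∀ z ∈ Submodule.span O.toSubring (φ '' (maximalIdeal R)),
        z ∈ Submodule.span O.toSubring {φ u, φ v} := by
      refine fun z hz => Submodule.span_le.mpr ?_ hz
      rintro _ ⟨a, ha, rfl⟩
      rw [SetLike.mem_coe, hspan] at ha
      obtain ⟨x, y, rfl⟩ := Ideal.mem_span_pair.mp ha
      rw [map_add, map_mul, map_mul]
      exact Submodule.mem_span_pair.mpr ⟨⟨_, hO x⟩, ⟨_, hO y⟩, rfl⟩
    obtain ⟨x, y, hxy⟩ := Submodule.mem_span_pair.mp (key e this)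
    exact ⟨x, y, x.2, y.2, hxy.symm⟩
  have h1 : (⟨x, hx⟩ * ⟨_, h.div_mem u hu⟩ + ⟨y, hy⟩ * ⟨_, h.div_mem v hv⟩ : O.toSubring) = 1 := by
    refine Subtype.ext ?_
    have := h.ne_zero
    push_cast
    field_simp
    exact he.symm
  rcases IsLocalRing.isUnit_or_isUnit_of_add_one h1 with h2 | h2
  · left
    have h3 := (isUnit_subring_iff _).mp (isUnit_of_mul_isUnit_right h2)
    rw [inv_div] at h3
    exact ⟨fun h0 => h3.1 (by rw [h0]; simp), h3.2⟩
  · right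
    have h3 := (isUnit_subring_iff _).mp (isUnit_of_mul_isUnit_right h2)
    rw [inv_div] at h3
    exact ⟨fun h0 => h3.1 (by rw [h0]; simp), h3.2⟩

/-- A local subring, in which the maximal ideal of `R` becomes principal, and which is dominated
by a localization of `R[v / u]`, is equal to that localization. -/
theorem IsParameterPair.eq_ofPrime_of_le (hφ : Function.Injective φ)
    (huv : IsParameterPair u v) (q : Ideal (chart φ u v)) [q.IsPrime]
    {O : LocalSubring L} (hO : ∀ r, φ r ∈ O.toSubring) {e : L}
    (he : IsGenerator φ (maximalIdeal R) O.toSubring e) (h : O ≤ LocalSubring.ofPrime _ q) :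
    O = LocalSubring.ofPrime _ q := by
  have hu0 : φ u ≠ 0 := (map_ne_zero_iff φ hφ).mpr huv.ne_zero
  have hu : u ∈ maximalIdeal R := huv.span_eq ▸ Ideal.subset_span (by simp)
  have hv : v ∈ maximalIdeal R := huv.span_eq ▸ Ideal.subset_span (by simp)
  obtain ⟨h1, h2⟩ := localSubring_le_iff.mp h
  have hdiv : φ v / φ u ∈ O.toSubring := by
    rcases exists_isUnit_div_of_isGenerator huv.span_eq hO he with ⟨-, h3⟩ | ⟨hv0, h3⟩
    · have := mul_mem (he.div_mem v hv) h3
      rwa [div_mul_div_cancel₀ he.ne_zero] at this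
    · have h4 := mul_mem (he.div_mem u hu) h3
      rw [div_mul_div_cancel₀ he.ne_zero] at h4
      have := h2 _ h4 (by
        rw [inv_div]
        exact LocalSubring.le_ofPrime _ q div_mem_chart)
      rwa [inv_div] at this
  have hle := chart_le hO hdiv
  refine le_antisymm h (localSubring_le_iff.mpr ⟨?_, fun x hx hx' => h1 hx'⟩)
  intro x hx
  obtain ⟨a, s, hs, rfl⟩ := mem_ofPrime_iff.mp hx
  rw [div_eq_mul_inv]
  refine mul_mem (hle a.2) (h2 _ (hle s.2) ?_)
  exact mem_ofPrime_iff.mpr ⟨1, s, hs, by simp⟩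

end Chart

/-! ### The dimension of the local rings at the closed points -/

section Dimension

theorem height_eq_of_isMaximal_mvPolynomial (k : Type*) [Field k] (s : ℕ) :
    ∀ (M : Ideal (MvPolynomial (Fin s) k)) [M.IsMaximal], M.height = s := by
  induction s with
  | zero =>
    intro M hM
    let e := (MvPolynomial.isEmptyAlgEquiv k (Fin 0)).toRingEquiv
    have h1 : (M.map e).IsMaximal := Ideal.map_isMaximal_of_equiv e
    rw [← e.height_map, Ideal.eq_bot_of_prime (M.map e)]
    simp
  | succ s ih =>
    intro M hM
    let e := (MvPolynomial.finSuccEquiv k s).toRingEquiv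
    have h1 : (M.map e).IsMaximal := Ideal.map_isMaximal_of_equiv e
    have h2 : ((M.map e).comap Polynomial.C).IsMaximal :=
      Polynomial.isMaximal_comap_C_of_isJacobsonRing _
    have h3 : (M.map e).LiesOver ((M.map e).comap Polynomial.C) := ⟨rfl⟩
    rw [← e.height_map, Polynomial.height_eq_height_add_one ((M.map e).comap Polynomial.C), ih]
    simp

/-- The maximal ideals of a finitely generated domain over a field have the same height. -/
theorem exists_height_eq_of_finiteType {k A : Type*} [Field k] [CommRing A] [IsDomain A]
    (f : k →+* A) (hf : f.FiniteType) : ∃ d : ℕ, ∀ (M : Ideal A) [M.IsMaximal], M.height = d := by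
  algebraize [f]
  obtain ⟨d, g, hg, hgi⟩ := exists_integral_inj_algHom_of_fg k A
  have : IsNoetherianRing A := Algebra.FiniteType.isNoetherianRing k A
  algebraize [g.toRingHom]
  have hinteg : Algebra.IsIntegral (MvPolynomial (Fin d) k) A := ⟨hgi⟩
  have hinj : FaithfulSMul (MvPolynomial (Fin d) k) A :=
    (faithfulSMul_iff_algebraMap_injective _ _).mpr hg
  refine ⟨d, fun M hM => ?_⟩
  have h1 : (M.under (MvPolynomial (Fin d) k)).IsMaximal :=
    Ideal.isMaximal_comap_of_isIntegral_of_isMaximal M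
  have h2 := height_eq_of_isMaximal_mvPolynomial k d (M.under (MvPolynomial (Fin d) k))
  apply le_antisymm
  · have h3 := Order.height_le_height_apply_of_strictMono
      (PrimeSpectrum.comap (algebraMap (MvPolynomial (Fin d) k) A))
      (fun I J hIJ => Ideal.IsIntegral.comap_lt_comap (I := I.asIdeal) (J := J.asIdeal) hIJ)
      ⟨M, inferInstance⟩
    rw [← PrimeSpectrum.height_eq_orderHeight, ← PrimeSpectrum.height_eq_orderHeight] at h3
    exact h3.trans h2.le
  · rw [Ideal.height_eq_height_add_of_liesOver_of_hasGoingDown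
      (M.under (MvPolynomial (Fin d) k)) M, h2]
    exact le_self_add

variable {k : Type u} [Field k] {X : Scheme.{u}} [X.Over (Spec (CommRingCat.of k))] [IsIntegral X]

theorem exists_ringKrullDim_stalk_eq [LocallyOfFiniteType (X ↘ Spec (CommRingCat.of k))]
    {U : X.Opens} (hU : IsAffineOpen U) : ∃ d : ℕ, ∀ x ∈ U, IsClosed {x} →
      ringKrullDim (X.presheaf.stalk x) = d := by
  by_cases hne : Nonempty U
  swap
  · exact ⟨0, fun x hx => (hne ⟨⟨x, hx⟩⟩).elim⟩
  have h1 := (X ↘ Spec (CommRingCat.of k)).finiteType_appLE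
    (isAffineOpen_top (Spec (CommRingCat.of k))) hU (by simp)
  have h2 : (((X ↘ Spec (CommRingCat.of k)).appLE ⊤ U (by simp)).hom.comp
      (Scheme.ΓSpecIso (CommRingCat.of k)).inv.hom).FiniteType :=
    h1.comp (RingHom.FiniteType.of_surjective _
      (ConcreteCategory.bijective_of_isIso (Scheme.ΓSpecIso (CommRingCat.of k)).inv).2)
  obtain ⟨d, hd⟩ := exists_height_eq_of_finiteType (k := k) _ h2
  refine ⟨d, fun x hx hxc => ?_⟩
  have := hU.isLocalization_stalk ⟨x, hx⟩
  have := hU.primeIdealOf_isMaximal_of_isClosed ⟨x, hx⟩ hxc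
  let : Algebra Γ(X, U) (X.presheaf.stalk x) :=
    TopCat.Presheaf.algebra_section_stalk X.presheaf (⟨x, hx⟩ : U)
  rw [IsLocalization.AtPrime.ringKrullDim_eq_height (hU.primeIdealOf ⟨x, hx⟩).asIdeal
    (X.presheaf.stalk x), hd]
  rfl

theorem ringKrullDim_stalk_eq_topologicalKrullDim
    [LocallyOfFiniteType (X ↘ Spec (CommRingCat.of k))] {p : X} (hp : IsClosed {p}) :
    ringKrullDim (X.presheaf.stalk p) = topologicalKrullDim X := by
  have : JacobsonSpace X := LocallyOfFiniteType.jacobsonSpace (X ↘ Spec (CommRingCat.of k))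
  have key : ∀ x : X, IsClosed {x} →
      ringKrullDim (X.presheaf.stalk x) = ringKrullDim (X.presheaf.stalk p) := by
    intro x hx
    obtain ⟨_, ⟨U, hU, rfl⟩, hxU, -⟩ :=
      X.isBasis_affineOpens.exists_subset_of_mem_open (Set.mem_univ x) isOpen_univ
    obtain ⟨_, ⟨V, hV, rfl⟩, hpV, -⟩ :=
      X.isBasis_affineOpens.exists_subset_of_mem_open (Set.mem_univ p) isOpen_univ
    obtain ⟨w, ⟨hwU, hwV⟩, hw⟩ := nonempty_inter_closedPoints (Z := (U ∩ V : Set X))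
      (nonempty_preirreducible_inter U.isOpen V.isOpen ⟨x, hxU⟩ ⟨p, hpV⟩)
      (U.isOpen.inter V.isOpen).isLocallyClosed
    obtain ⟨d, hd⟩ := exists_ringKrullDim_stalk_eq (k := k) hU
    obtain ⟨d', hd'⟩ := exists_ringKrullDim_stalk_eq (k := k) hV
    rw [hd x hxU hx, hd' p hpV hp, ← hd w hwU hw, ← hd' w hwV hw]
  rw [topologicalKrullDim, Order.krullDim_eq_of_orderIso irreducibleSetEquivPoints,
    Order.krullDim_eq_iSup_coheight]
  apply le_antisymm
  · rw [ringKrullDim_stalk_eq_coheight]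
    exact le_iSup (fun x : X => ((Order.coheight x : ℕ∞) : WithBot ℕ∞)) p
  · refine iSup_le fun x => ?_
    obtain ⟨y, hy, hyc⟩ := nonempty_inter_closedPoints (Z := closure {x})
      (closure_nonempty_iff.mpr (Set.singleton_nonempty x)) isClosed_closure.isLocallyClosed
    rw [← key y hyc, ringKrullDim_stalk_eq_coheight]
    exact WithBot.coe_le_coe.mpr (Order.coheight_anti (specializes_iff_mem_closure.mpr hy))

end Dimension

/-! ### Regular parameters -/

section Parameters

variable {R : Type*} [CommRing R] [IsLocalRing R] [IsNoetherianRing R]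

/-- Two generators of the maximal ideal of a two-dimensional local ring form a regular sequence. -/
theorem isParameterPair_of_span_eq (hdim : ringKrullDim R = 2) {u v : R}
    (huv : maximalIdeal R = Ideal.span {u, v}) : IsParameterPair u v := by
  have hu : u ∈ maximalIdeal R := huv ▸ Ideal.subset_span (by simp)
  have hv : v ∈ maximalIdeal R := huv ▸ Ideal.subset_span (by simp)
  have hheight : ¬ (maximalIdeal R).height ≤ 1 := by
    intro h
    have h1 := IsLocalRing.maximalIdeal_height_eq_ringKrullDim (R := R)
    rw [hdim] at h1
    have h2 : (maximalIdeal R).height = 2 := WithBot.coe_injective h1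
    rw [h2] at h
    exact absurd h (by decide)
  have key : ∀ a : R, a ∈ maximalIdeal R →
      ¬ ∀ P : Ideal R, P.IsPrime → a ∈ P → maximalIdeal R ≤ P := by
    intro a ha h
    apply hheight
    refine Ideal.height_le_one_of_isPrincipal_of_mem_minimalPrimes (Ideal.span {a}) _
      ⟨⟨inferInstance, (Ideal.span_singleton_le_iff_mem _).mpr ha⟩, fun P hP _ => ?_⟩
    exact h P hP.1 ((Ideal.span_singleton_le_iff_mem _).mp hP.2)
  refine ⟨huv, fun h0 => key v hv fun P _ hvP => ?_, fun c hc => ?_⟩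
  · rw [huv, Ideal.span_le]
    rintro x (rfl | rfl)
    · exact h0 ▸ zero_mem _
    · exact hvP
  · by_contra hcu
    have hI : Ideal.span {u} ≠ ⊤ := fun h => (maximalIdeal.isMaximal R).ne_top
      (top_le_iff.mp (h ▸ (Ideal.span_singleton_le_iff_mem _).mpr hu))
    have : Nontrivial (R ⧸ Ideal.span {u}) := Ideal.Quotient.nontrivial_iff.mpr hI
    have : IsLocalRing (R ⧸ Ideal.span {u}) :=
      .of_surjective' (Ideal.Quotient.mk _) Ideal.Quotient.mk_surjective
    set V : R ⧸ Ideal.span {u} := Ideal.Quotient.mk _ v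
    have hV : ∀ d : R, Ideal.Quotient.mk (Ideal.span {u}) d ∉ Ideal.span {V} → IsUnit d := by
      intro d hd
      by_contra h
      have hd' : d ∈ maximalIdeal R := h
      rw [huv] at hd'
      obtain ⟨x, y, rfl⟩ := Ideal.mem_span_pair.mp hd'
      apply hd
      have : Ideal.Quotient.mk (Ideal.span {u}) u = 0 :=
        Ideal.Quotient.eq_zero_iff_mem.mpr (Ideal.mem_span_singleton_self u)
      rw [map_add, map_mul, map_mul, this, mul_zero, zero_add]
      exact Ideal.mul_mem_left _ _ (Ideal.mem_span_singleton_self V)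
    have hVtop : Ideal.span {V} ≠ ⊤ := by
      rw [Ne, Ideal.span_singleton_eq_top]
      intro h
      have := IsLocalHom.of_surjective (Ideal.Quotient.mk (Ideal.span {u}))
        Ideal.Quotient.mk_surjective
      exact hv (isUnit_of_map_unit (Ideal.Quotient.mk (Ideal.span {u})) v h)
    have hc0 : Ideal.Quotient.mk (Ideal.span {u}) c ≠ 0 := fun h =>
      hcu (Ideal.mem_span_singleton.mp (Ideal.Quotient.eq_zero_iff_mem.mp h))
    have hex : ∃ n, Ideal.Quotient.mk (Ideal.span {u}) c ∉ Ideal.span {V} ^ n := by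
      by_contra! h
      have h1 := Ideal.iInf_pow_eq_bot_of_isLocalRing _ hVtop
      have h2 := (Submodule.mem_iInf _).mpr h
      rw [h1] at h2
      exact hc0 h2
    classical
    have hn0 : Nat.find hex ≠ 0 := fun h0 => by
      have := Nat.find_spec hex
      rw [h0] at this
      simp at this
    obtain ⟨N, hN⟩ := Nat.exists_eq_succ_of_ne_zero hn0
    have h1 : Ideal.Quotient.mk (Ideal.span {u}) c ∈ Ideal.span {V} ^ N :=
      not_not.mp (Nat.find_min hex (by omega))
    have h2 := Nat.find_spec hex
    rw [hN, Ideal.span_singleton_pow] at h2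
    rw [Ideal.span_singleton_pow] at h1
    obtain ⟨d, hd⟩ := Ideal.mem_span_singleton.mp h1
    obtain ⟨d, rfl⟩ := Ideal.Quotient.mk_surjective d
    have hdu : IsUnit d := hV d fun h => h2 (by
      obtain ⟨b, hb⟩ := Ideal.mem_span_singleton.mp h
      rw [hd, hb]
      exact Ideal.mem_span_singleton.mpr ⟨b, by rw [pow_succ]; ring⟩)
    have h3 : u ∣ v ^ (N + 1) * d := by
      rw [← Ideal.mem_span_singleton, ← Ideal.Quotient.eq_zero_iff_mem, map_mul, map_pow, pow_succ',
        mul_assoc, ← hd, ← map_mul, Ideal.Quotient.eq_zero_iff_mem, Ideal.mem_span_singleton]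
      exact hc
    rw [hdu.dvd_mul_right] at h3
    refine key u hu fun P hP huP => ?_
    rw [huv, Ideal.span_le]
    rintro x (rfl | rfl)
    · exact huP
    · exact hP.mem_of_pow_mem _ (Ideal.mem_of_dvd _ h3 huP)

theorem exists_span_eq_of_isRegularLocalRing {R : Type*} [CommRing R] [IsRegularLocalRing R]
    (hdim : ringKrullDim R = 2) : ∃ u v : R, maximalIdeal R = Ideal.span {u, v} := by
  have h := IsRegularLocalRing.spanFinrank_maximalIdeal (R := R)
  rw [hdim] at h
  have h' : (maximalIdeal R).spanFinrank = 2 := by exact_mod_cast h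
  have h1 := Submodule.FG.generators_ncard (maximalIdeal R).fg_of_isNoetherianRing
  rw [h'] at h1
  obtain ⟨u, v, -, huv⟩ := Set.ncard_eq_two.mp h1
  exact ⟨u, v, by rw [← huv]; exact (Submodule.span_generators _).symm⟩

end Parameters

/-! ### Local rings as subrings of the function field -/

section LocalRings

variable {X : Scheme.{u}} [IsIntegral X]

/-- The local ring of `X` at `x`, as a subring of the function field. -/
noncomputable def localRingAt (x : X) : LocalSubring X.functionField :=
  LocalSubring.range (algebraMap (X.presheaf.stalk x) X.functionField)

theorem stalk_injective (x : X) :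
    Function.Injective (algebraMap (X.presheaf.stalk x) X.functionField) :=
  IsFractionRing.injective _ _

theorem isUnit_stalk_iff {x : X} (a : X.presheaf.stalk x) : IsUnit a ↔
    algebraMap (X.presheaf.stalk x) X.functionField a ≠ 0 ∧
      (algebraMap (X.presheaf.stalk x) X.functionField a)⁻¹ ∈ (localRingAt x).toSubring := by
  constructor
  · intro h
    obtain ⟨b, hb⟩ := isUnit_iff_exists_inv.mp h
    have hb' := congrArg (algebraMap (X.presheaf.stalk x) X.functionField) hb
    rw [map_mul, map_one] at hb'
    exact ⟨left_ne_zero_of_mul_eq_one hb', b, (inv_eq_of_mul_eq_one_right hb').symm⟩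
  · rintro ⟨h0, b, hb⟩
    refine isUnit_iff_exists_inv.mpr ⟨b, stalk_injective x ?_⟩
    rw [map_mul, hb, map_one, mul_inv_cancel₀ h0]

theorem represents_of_germ_eq {U : X.Opens} {a : Γ(X, U)} {g : X.functionField} {x : X}
    (hx : x ∈ U)
    (h : algebraMap (X.presheaf.stalk x) X.functionField (X.presheaf.germ U x hx a) = g) :
    Represents a g := by
  intro y hy
  have : Nonempty U := ⟨⟨x, hx⟩⟩
  rw [← h, Scheme.algebraMap_germ_eq_germToFunctionField,
    Scheme.algebraMap_germ_eq_germToFunctionField]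

theorem Represents.eq {U : X.Opens} {a b : Γ(X, U)} {g : X.functionField} (ha : Represents a g)
    (hb : Represents b g) : a = b := by
  by_cases hU : ∃ x, x ∈ U
  · obtain ⟨x, hx⟩ := hU
    apply germ_injective_of_isIntegral X x hx
    exact stalk_injective x ((ha x hx).trans (hb x hx).symm)
  · obtain rfl : U = ⊥ := by
      ext x
      simpa using fun hx => hU ⟨x, hx⟩
    exact Subsingleton.elim _ _

theorem Represents.res {U V : X.Opens} (i : V ⟶ U) {a : Γ(X, U)} {g : X.functionField}
    (ha : Represents a g) : Represents (X.presheaf.map i.op a) g := by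
  intro x hx
  rw [X.presheaf.germ_res_apply i x hx a]
  exact ha x (i.le hx)

/-- A rational function is regular on an open set if and only if it is regular at its points. -/
theorem isRegularOn_iff {U : X.Opens} {g : X.functionField} :
    IsRegularOn U g ↔ ∀ x ∈ U, g ∈ (localRingAt x).toSubring := by
  constructor
  · rintro ⟨a, ha⟩ x hx
    exact ⟨_, ha x hx⟩
  · intro h
    have h1 : ∀ x : U, ∃ (V : X.Opens) (_ : x.1 ∈ V) (_ : V ≤ U) (a : Γ(X, V)),
        Represents a g := by
      intro x
      obtain ⟨s, hs⟩ := h x.1 x.2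
      obtain ⟨V, hxV, a, ha⟩ := X.presheaf.exists_germ_eq s
      refine ⟨V ⊓ U, ⟨hxV, x.2⟩, inf_le_right, X.presheaf.map (homOfLE inf_le_left).op a, ?_⟩
      exact Represents.res _ (represents_of_germ_eq hxV (by rw [ha, hs]))
    choose V hxV hVU a ha using h1
    obtain ⟨s, hs, -⟩ := X.sheaf.existsUnique_gluing' V U (fun x => homOfLE (hVU x))
      (fun x hx => TopologicalSpace.Opens.mem_iSup.mpr ⟨⟨x, hx⟩, hxV ⟨x, hx⟩⟩) a
      (fun x y => ((ha x).res _).eq ((ha y).res _))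
    refine ⟨s, fun x hx => ?_⟩
    have h2 := ha ⟨x, hx⟩ x (hxV ⟨x, hx⟩)
    rw [← hs ⟨x, hx⟩] at h2
    rw [← h2]
    congr 1
    exact (X.presheaf.germ_res_apply (homOfLE (hVU ⟨x, hx⟩)) x (hxV ⟨x, hx⟩) s).symm

end LocalRings

/-! ### Vanishing ideals -/

section VanishingIdeals

variable {X : Scheme.{u}}

theorem mem_primeIdealOf_iff {U : X.Opens} (hU : IsAffineOpen U) {x : X} (hx : x ∈ U)
    (a : Γ(X, U)) : a ∈ (hU.primeIdealOf ⟨x, hx⟩).asIdeal ↔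
      X.presheaf.germ U x hx a ∈ maximalIdeal (X.presheaf.stalk x) := by
  let : Algebra Γ(X, U) (X.presheaf.stalk x) :=
    TopCat.Presheaf.algebra_section_stalk X.presheaf (⟨x, hx⟩ : U)
  have : IsLocalization.AtPrime (X.presheaf.stalk x) (hU.primeIdealOf ⟨x, hx⟩).asIdeal :=
    hU.isLocalization_stalk ⟨x, hx⟩
  exact (IsLocalization.AtPrime.to_map_mem_maximal_iff (X.presheaf.stalk x)
    (hU.primeIdealOf ⟨x, hx⟩).asIdeal a).symm

theorem mem_vanishingIdeal_iff (Z : TopologicalSpace.Closeds X) (U : X.affineOpens)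
    (a : Γ(X, U.1)) : a ∈ (Scheme.IdealSheafData.vanishingIdeal Z).ideal U ↔
      ∀ (x : X) (hx : x ∈ U.1), x ∈ Z →
        X.presheaf.germ U.1 x hx a ∈ maximalIdeal (X.presheaf.stalk x) := by
  have hU : IsAffineOpen U.1 := U.2
  have hmem : a ∈ (Scheme.IdealSheafData.vanishingIdeal Z).ideal U ↔
      ∀ y : Spec Γ(X, U.1), hU.fromSpec y ∈ Z → a ∈ y.asIdeal :=
    PrimeSpectrum.mem_vanishingIdeal _ _
  rw [hmem]
  constructor
  · intro h x hx hxZ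
    rw [← mem_primeIdealOf_iff hU hx]
    refine h _ ?_
    rwa [hU.fromSpec_primeIdealOf]
  · intro h y hy
    have hyU : hU.fromSpec y ∈ U.1 := by
      have : hU.fromSpec y ∈ (U.1 : Set X) := by
        rw [← hU.range_fromSpec]
        exact ⟨y, rfl⟩
      exact this
    have h1 := (mem_primeIdealOf_iff hU hyU a).mpr (h _ hyU hy)
    have h2 : hU.primeIdealOf ⟨hU.fromSpec y, hyU⟩ = y :=
      hU.fromSpec.isOpenEmbedding.injective (hU.fromSpec_primeIdealOf _)
    rwa [h2] at h1

theorem map_germ_pointIdeal {p : X} (hp : IsClosed {p}) (U : X.affineOpens) (hpU : p ∈ U.1) :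
    ((pointIdeal p hp).ideal U).map (X.presheaf.germ U.1 p hpU).hom =
      maximalIdeal (X.presheaf.stalk p) := by
  have h1 : (pointIdeal p hp).ideal U = (U.2.primeIdealOf ⟨p, hpU⟩).asIdeal := by
    ext a
    rw [mem_primeIdealOf_iff U.2 hpU]
    refine (mem_vanishingIdeal_iff _ U a).trans ⟨fun h => h p hpU rfl, ?_⟩
    intro h x hx hxp
    have e : p = x := Eq.symm hxp
    subst e
    exact h
  let : Algebra Γ(X, U.1) (X.presheaf.stalk p) :=
    TopCat.Presheaf.algebra_section_stalk X.presheaf (⟨p, hpU⟩ : U.1)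
  have : IsLocalization.AtPrime (X.presheaf.stalk p) (U.2.primeIdealOf ⟨p, hpU⟩).asIdeal :=
    U.2.isLocalization_stalk ⟨p, hpU⟩
  rw [h1]
  exact IsLocalization.AtPrime.map_eq_maximalIdeal (U.2.primeIdealOf ⟨p, hpU⟩).asIdeal
    (X.presheaf.stalk p)

theorem map_germ_pointIdeal_of_ne {p x : X} (hp : IsClosed {p}) (hxp : x ≠ p) (U : X.affineOpens)
    (hxU : x ∈ U.1) :
    ((pointIdeal p hp).ideal U).map (X.presheaf.germ U.1 x hxU).hom = ⊤ := by
  by_contra h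
  have h1 := IsLocalRing.le_maximalIdeal h
  have h2 : (pointIdeal p hp).ideal U ≤ (U.2.primeIdealOf ⟨x, hxU⟩).asIdeal := fun a ha =>
    (mem_primeIdealOf_iff U.2 hxU a).mpr (h1 (Ideal.mem_map_of_mem _ ha))
  have hU : IsAffineOpen U.1 := U.2
  have h3 : hU.primeIdealOf ⟨x, hxU⟩ ∈ closure (hU.fromSpec ⁻¹' {p}) := by
    have h4 : closure (hU.fromSpec ⁻¹' {p}) = PrimeSpectrum.zeroLocus
        (PrimeSpectrum.vanishingIdeal (hU.fromSpec ⁻¹' {p})) :=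
      (PrimeSpectrum.zeroLocus_vanishingIdeal_eq_closure _).symm
    rw [h4]
    exact h2
  have h5 : hU.fromSpec (hU.primeIdealOf ⟨x, hxU⟩) = p := by
    have h4 : IsClosed (hU.fromSpec ⁻¹' {p}) := hp.preimage hU.fromSpec.continuous
    exact h4.closure_eq.subset h3
  exact hxp (by rw [← h5, hU.fromSpec_primeIdealOf])

/-- A morphism from an affine scheme which factors through the spectrum of the local ring at `x`
makes an ideal sheaf invertible as soon as the image of this ideal sheaf is generated by a
nonzerodivisor. -/
theorem inverseImageInvertible_specMap (I : X.IdealSheafData) {S : CommRingCat.{u}} {x : X}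
    (φ : X.presheaf.stalk x ⟶ S) (U : X.affineOpens) (hxU : x ∈ U.1) {e : S}
    (he : e ∈ nonZeroDivisors S)
    (h : ((I.ideal U).map (X.presheaf.germ U.1 x hxU).hom).map φ.hom = Ideal.span {e}) :
    InverseImageInvertible I (Spec.map φ ≫ X.fromSpecStalk x) := by
  intro t
  have hle : (⊤ : (Spec S).Opens) ≤ (Spec.map φ ≫ X.fromSpecStalk x) ⁻¹ᵁ U.1 := by
    intro z _
    have h1 : (Spec.map φ ≫ X.fromSpecStalk x) z ∈ Set.range (X.fromSpecStalk x) :=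
      ⟨Spec.map φ z, by rw [Scheme.Hom.comp_apply]⟩
    rw [Scheme.range_fromSpecStalk] at h1
    exact h1.mem_open U.1.isOpen hxU
  have happ : (Spec.map φ ≫ X.fromSpecStalk x).appLE U.1 ⊤ hle =
      X.presheaf.germ U.1 x hxU ≫ φ ≫ (Scheme.ΓSpecIso S).inv := by
    have hle' : (⊤ : (Spec S).Opens) ≤ Spec.map φ ⁻¹ᵁ X.fromSpecStalk x ⁻¹ᵁ U.1 := hle
    have h1 : (Spec.map φ ≫ X.fromSpecStalk x).appLE U.1 ⊤ hle =
        (X.fromSpecStalk x).app U.1 ≫ (Spec.map φ).appLE _ ⊤ hle' := Scheme.Hom.comp_appLE ..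
    rw [h1, Scheme.fromSpecStalk_app hxU, Category.assoc, Category.assoc,
      Scheme.Hom.map_appLE, Scheme.ΓSpecIso_inv_naturality, Scheme.Hom.appTop,
      Scheme.Hom.app_eq_appLE]
    rfl
  refine ⟨U, ⟨⊤, isAffineOpen_top _⟩, hle, trivial, (Scheme.ΓSpecIso S).inv.hom e, ?_, ?_⟩
  · let f : S ≃+* Γ(Spec S, ⊤) := (Scheme.ΓSpecIso S).symm.commRingCatIsoToRingEquiv
    have h1 : (nonZeroDivisors S).map f = nonZeroDivisors Γ(Spec S, ⊤) :=
      MulEquivClass.map_nonZeroDivisors f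
    exact h1 ▸ Submonoid.mem_map_of_mem f he
  · rw [happ, CommRingCat.hom_comp, CommRingCat.hom_comp, ← Ideal.map_map, ← Ideal.map_map, h,
      Ideal.map_span, Set.image_singleton]

theorem exists_affineOpens_mem (x : X) : ∃ U : X.affineOpens, x ∈ U.1 := by
  obtain ⟨_, ⟨U, hU, rfl⟩, hxU, -⟩ :=
    X.isBasis_affineOpens.exists_subset_of_mem_open (Set.mem_univ x) isOpen_univ
  exact ⟨⟨U, hU⟩, hxU⟩

theorem inverseImageInvertible_of_ne {p x : X} (hp : IsClosed {p}) (hxp : x ≠ p)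
    {S : CommRingCat.{u}} (φ : X.presheaf.stalk x ⟶ S) :
    InverseImageInvertible (pointIdeal p hp) (Spec.map φ ≫ X.fromSpecStalk x) := by
  obtain ⟨U, hxU⟩ := exists_affineOpens_mem x
  refine inverseImageInvertible_specMap _ φ U hxU (one_mem _) ?_
  rw [map_germ_pointIdeal_of_ne hp hxp, Ideal.map_top, Ideal.span_singleton_one]

theorem inverseImageInvertible_of_span {p : X} (hp : IsClosed {p}) {S : CommRingCat.{u}}
    (φ : X.presheaf.stalk p ⟶ S) {e : S} (he : e ∈ nonZeroDivisors S)
    (h : (maximalIdeal (X.presheaf.stalk p)).map φ.hom = Ideal.span {e}) :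
    InverseImageInvertible (pointIdeal p hp) (Spec.map φ ≫ X.fromSpecStalk p) := by
  obtain ⟨U, hpU⟩ := exists_affineOpens_mem p
  exact inverseImageInvertible_specMap _ φ U hpU he (by rw [map_germ_pointIdeal, h])

end VanishingIdeals

/-! ### Dominant morphisms and local rings -/

section Dominant

variable {X Y : Scheme.{u}} (π : Y ⟶ X)

/-- The map from the local ring of `X` at `x` to the local ring of `Y` at a point whose image is a
generalization of `x`. -/
noncomputable def stalkMapOfSpecializes {x : X} {y : Y} (h : π y ⤳ x) :
    X.presheaf.stalk x ⟶ Y.presheaf.stalk y :=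
  X.presheaf.stalkSpecializes h ≫ π.stalkMap y

theorem specMap_stalkMapOfSpecializes {x : X} {y : Y} (h : π y ⤳ x) :
    Spec.map (stalkMapOfSpecializes π h) ≫ X.fromSpecStalk x = Y.fromSpecStalk y ≫ π := by
  rw [stalkMapOfSpecializes, Spec.map_comp, Category.assoc,
    Scheme.SpecMap_stalkSpecializes_fromSpecStalk, Scheme.SpecMap_stalkMap_fromSpecStalk]

variable [IsIntegral X] [IsIntegral Y] (hπ : IsDominant π)

theorem algebraMap_stalkMapOfSpecializes {x : X} {y : Y} (h : π y ⤳ x) (a : X.presheaf.stalk x) :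
    algebraMap (Y.presheaf.stalk y) Y.functionField ((stalkMapOfSpecializes π h).hom a) =
      functionFieldMap π hπ (algebraMap (X.presheaf.stalk x) X.functionField a) := by
  have h1 : stalkMapOfSpecializes π h ≫
      Y.presheaf.stalkSpecializes ((genericPoint_spec Y).specializes trivial) =
      X.presheaf.stalkSpecializes ((genericPoint_spec X).specializes trivial) ≫
      X.presheaf.stalkSpecializes (specializes_genericPoint π hπ) ≫
        π.stalkMap (genericPoint Y) := by
    rw [stalkMapOfSpecializes, Category.assoc, ← Scheme.Hom.stalkSpecializes_stalkMap,
      ← Category.assoc, ← Category.assoc, TopCat.Presheaf.stalkSpecializes_comp,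
      TopCat.Presheaf.stalkSpecializes_comp]
  exact congr($(h1).hom a)

theorem algebraMap_stalkMap (y : Y) (a : X.presheaf.stalk (π y)) :
    algebraMap (Y.presheaf.stalk y) Y.functionField ((π.stalkMap y).hom a) =
      functionFieldMap π hπ (algebraMap (X.presheaf.stalk (π y)) X.functionField a) := by
  rw [← algebraMap_stalkMapOfSpecializes π hπ (specializes_refl (π y)) a]
  simp [stalkMapOfSpecializes]

end Dominant

/-! ### The points of a blowing-up -/

section BlowUpPoints

variable {X Y : Scheme.{u}} {π : Y ⟶ X} {p : X} {hp : IsClosed {p}}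

theorem IsBlowUpAt.hom_ext (hπ : IsBlowUpAt π p hp) {T : Scheme.{u}} {g : T ⟶ X}
    (hg : InverseImageInvertible (pointIdeal p hp) g) {h h' : T ⟶ Y} (e : h ≫ π = g)
    (e' : h' ≫ π = g) : h = h' :=
  (hπ.existsUnique_lift T g hg).unique e e'

theorem isLocalHom_stalkMapOfSpecializes {y : Y} {x : X} (h : π y = x) :
    IsLocalHom (stalkMapOfSpecializes π (specializes_of_eq h)).hom := by
  subst h
  have : stalkMapOfSpecializes π (specializes_of_eq (rfl : π y = π y)) = π.stalkMap y := by
    simp [stalkMapOfSpecializes]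
  rw [this]
  infer_instance

/-- The closed point of the spectrum of a local ring. -/
noncomputable def specClosedPoint (R : CommRingCat.{u}) [IsLocalRing R] : Spec R := closedPoint R

theorem specMap_specClosedPoint {R S : CommRingCat.{u}} [IsLocalRing R] [IsLocalRing S] (f : R ⟶ S)
    [IsLocalHom f.hom] : Spec.map f (specClosedPoint S) = specClosedPoint R :=
  IsLocalRing.comap_closedPoint f.hom

theorem fromSpecStalk_specClosedPoint (x : X) :
    X.fromSpecStalk x (specClosedPoint (X.presheaf.stalk x)) = x :=
  Scheme.fromSpecStalk_closedPoint

/-- The map of local rings at the closed point which is induced by a morphism from the spectrum of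
a local ring. -/
theorem exists_specMap_eq {R : CommRingCat.{u}} [IsLocalRing R] (h : Spec R ⟶ X) :
    ∃ f : X.presheaf.stalk (h (specClosedPoint R)) ⟶ R, IsLocalHom f.hom ∧
      Spec.map f ≫ X.fromSpecStalk (h (specClosedPoint R)) = h :=
  ⟨Scheme.stalkClosedPointTo h, Scheme.isLocalHom_stalkClosedPointTo h,
    Scheme.Spec_stalkClosedPointTo_fromSpecStalk h⟩

theorem IsBlowUpAt.exists_of_ne (hπ : IsBlowUpAt π p hp) {x : X} (hx : x ≠ p) :
    ∃ y : Y, π y = x ∧ (∀ y' : Y, π y' = x → y' = y) ∧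
      Function.Surjective (π.stalkMap y).hom := by
  have hinv : ∀ {S : CommRingCat.{u}} (φ : X.presheaf.stalk x ⟶ S),
      InverseImageInvertible (pointIdeal p hp) (Spec.map φ ≫ X.fromSpecStalk x) :=
    fun φ => inverseImageInvertible_of_ne hp hx φ
  obtain ⟨h, hh, -⟩ := hπ.existsUnique_lift _ _ (hinv (𝟙 _))
  rw [Spec.map_id, Category.id_comp] at hh
  have key : ∀ (y' : Y) (hy' : π y' = x),
      Spec.map (stalkMapOfSpecializes π (specializes_of_eq hy')) ≫ h = Y.fromSpecStalk y' := by
    intro y' hy'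
    refine hπ.hom_ext (hinv (stalkMapOfSpecializes π (specializes_of_eq hy'))) ?_ ?_
    · rw [Category.assoc, hh]
    · rw [specMap_stalkMapOfSpecializes]
  obtain ⟨f, -, hf⟩ := exists_specMap_eq h
  generalize hy : h (specClosedPoint (X.presheaf.stalk x)) = y at f hf
  have hπy : π y = x := by
    rw [← hy, ← Scheme.Hom.comp_apply, hh, fromSpecStalk_specClosedPoint]
  refine ⟨y, hπy, fun y' hy' => ?_, ?_⟩
  · have := isLocalHom_stalkMapOfSpecializes hy'
    rw [← hy, ← fromSpecStalk_specClosedPoint y', ← key y' hy', Scheme.Hom.comp_apply,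
      specMap_specClosedPoint]
  · have h1 := key y hπy
    rw [← hf, ← Category.assoc, ← Spec.map_comp] at h1
    have h2 : f ≫ stalkMapOfSpecializes π (specializes_of_eq hπy) = 𝟙 _ := by
      rw [← Spec.map_inj, ← cancel_mono (Y.fromSpecStalk _), h1, Spec.map_id, Category.id_comp]
    intro b
    refine ⟨(X.presheaf.stalkSpecializes (specializes_of_eq hπy)).hom (f.hom b), ?_⟩
    exact congr($(h2).hom b)

theorem IsBlowUpAt.stalkMap_surjective (hπ : IsBlowUpAt π p hp) {y : Y} (hy : π y ≠ p) :
    Function.Surjective (π.stalkMap y).hom := by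
  obtain ⟨y', -, h, hs⟩ := hπ.exists_of_ne hy
  rw [← h y rfl] at hs
  exact hs

theorem map_pointIdeal_germ {U : X.affineOpens} {W : Y.affineOpens} (hW : W.1 ≤ π ⁻¹ᵁ U.1)
    {a : Γ(Y, W.1)}
    (ha : ((pointIdeal p hp).ideal U).map (π.appLE U.1 W.1 hW).hom = Ideal.span {a}) {y : Y}
    (hy : y ∈ W.1) (hyU : π y ∈ U.1) :
    (((pointIdeal p hp).ideal U).map (X.presheaf.germ U.1 (π y) hyU).hom).map
      (π.stalkMap y).hom = Ideal.span {Y.presheaf.germ W.1 y hy a} := by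
  have h1 : X.presheaf.germ U.1 (π y) hyU ≫ π.stalkMap y =
      π.appLE U.1 W.1 hW ≫ Y.presheaf.germ W.1 y hy := by
    rw [Scheme.Hom.germ_stalkMap, Scheme.Hom.appLE, Category.assoc, TopCat.Presheaf.germ_res]
  rw [Ideal.map_map, ← CommRingCat.hom_comp, h1, CommRingCat.hom_comp, ← Ideal.map_map, ha,
    Ideal.map_span, Set.image_singleton]

theorem isUnit_germ_of_ne {U : X.affineOpens} {W : Y.affineOpens} (hW : W.1 ≤ π ⁻¹ᵁ U.1)
    {a : Γ(Y, W.1)}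
    (ha : ((pointIdeal p hp).ideal U).map (π.appLE U.1 W.1 hW).hom = Ideal.span {a}) {y : Y}
    (hy : y ∈ W.1) (hyp : π y ≠ p) : IsUnit (Y.presheaf.germ W.1 y hy a) := by
  have hyU : π y ∈ U.1 := hW hy
  have h := map_pointIdeal_germ hW ha hy hyU
  rw [map_germ_pointIdeal_of_ne hp hyp, Ideal.map_top] at h
  exact Ideal.span_singleton_eq_top.mp h.symm

theorem map_maximalIdeal_eq_span {U : X.affineOpens} {W : Y.affineOpens} (hW : W.1 ≤ π ⁻¹ᵁ U.1)
    {a : Γ(Y, W.1)}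
    (ha : ((pointIdeal p hp).ideal U).map (π.appLE U.1 W.1 hW).hom = Ideal.span {a}) {y : Y}
    (hy : y ∈ W.1) (hyp : π y = p) : (maximalIdeal (X.presheaf.stalk p)).map
      (stalkMapOfSpecializes π (specializes_of_eq hyp)).hom =
        Ideal.span {Y.presheaf.germ W.1 y hy a} := by
  subst hyp
  have hyU : π y ∈ U.1 := hW hy
  have h := map_pointIdeal_germ hW ha hy hyU
  rw [map_germ_pointIdeal] at h
  rw [← h]
  simp [stalkMapOfSpecializes]

variable [IsIntegral X] [IsIntegral Y]

variable (π) in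
/-- The map from the local ring of `X` at `p` to the function field of `Y`. -/
noncomputable def localToFunctionField (hd : IsDominant π) (p : X) :
    X.presheaf.stalk p →+* Y.functionField :=
  (functionFieldMap π hd).comp (algebraMap (X.presheaf.stalk p) X.functionField)

theorem localToFunctionField_injective (hd : IsDominant π) (p : X) :
    Function.Injective (localToFunctionField π hd p) :=
  (functionFieldMap π hd).injective.comp (stalk_injective p)

theorem localToFunctionField_mem (hd : IsDominant π) {y : Y} (hy : π y = p)
    (a : X.presheaf.stalk p) :
    localToFunctionField π hd p a ∈ (localRingAt y).toSubring :=
  ⟨_, algebraMap_stalkMapOfSpecializes π hd (specializes_of_eq hy) a⟩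

/-- The equation `a` of the inverse image of `p` generates the inverse image of the maximal ideal
of `p`. -/
theorem isGenerator_germ (hd : IsDominant π) {U : X.affineOpens} {W : Y.affineOpens}
    (hW : W.1 ≤ π ⁻¹ᵁ U.1) {a : Γ(Y, W.1)} (ha0 : a ∈ nonZeroDivisors Γ(Y, W.1))
    (ha : ((pointIdeal p hp).ideal U).map (π.appLE U.1 W.1 hW).hom = Ideal.span {a}) {y : Y}
    (hy : y ∈ W.1) (hyp : π y = p) :
    IsGenerator (localToFunctionField π hd p) (maximalIdeal (X.presheaf.stalk p))
      (localRingAt y).toSubring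
      (algebraMap (Y.presheaf.stalk y) Y.functionField (Y.presheaf.germ W.1 y hy a)) := by
  have hne : Nonempty W.1 := ⟨⟨y, hy⟩⟩
  have h0 : Y.presheaf.germ W.1 y hy a ≠ 0 := by
    rw [Ne, map_eq_zero_iff _ (germ_injective_of_isIntegral Y y hy)]
    exact nonZeroDivisors.ne_zero ha0
  have h := isGenerator_range (algebraMap (Y.presheaf.stalk y) Y.functionField) (stalk_injective y)
    _ _ h0 (map_maximalIdeal_eq_span hW ha hy hyp)
  have h1 : (algebraMap (Y.presheaf.stalk y) Y.functionField).comp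
      (stalkMapOfSpecializes π (specializes_of_eq hyp)).hom = localToFunctionField π hd p :=
    RingHom.ext fun a => algebraMap_stalkMapOfSpecializes π hd (specializes_of_eq hyp) a
  rw [h1] at h
  exact h

theorem IsBlowUpAt.exists_isGenerator (hπ : IsBlowUpAt π p hp) (hd : IsDominant π) {y : Y}
    (hy : π y = p) : ∃ e, IsGenerator (localToFunctionField π hd p)
      (maximalIdeal (X.presheaf.stalk p)) (localRingAt y).toSubring e := by
  obtain ⟨U, W, hW, hyW, a, ha0, ha⟩ := hπ.invertible y
  exact ⟨_, isGenerator_germ hd hW ha0 ha hyW hy⟩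

theorem algebraMap_genericPoint (a : Y.functionField) :
    @algebraMap (Y.presheaf.stalk (genericPoint Y)) Y.functionField _ _
      (stalkFunctionFieldAlgebra Y (genericPoint Y)) a = a := by
  have h : Y.presheaf.stalkSpecializes ((genericPoint_spec Y).specializes
    (trivial : genericPoint Y ∈ Set.univ)) = 𝟙 _ := Y.presheaf.stalkSpecializes_refl _
  exact congr($(h).hom a)

theorem map_genericPoint (hd : IsDominant π) : π (genericPoint Y) = genericPoint X :=
  (specializes_genericPoint π hd).antisymm (genericPoint_specializes _) |>.eq

theorem IsBlowUpAt.functionFieldMap_surjective (hπ : IsBlowUpAt π p hp) (hd : IsDominant π)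
    (hgen : genericPoint X ≠ p) : Function.Surjective (functionFieldMap π hd) := by
  intro b
  obtain ⟨a, rfl⟩ := hπ.stalkMap_surjective (y := genericPoint Y) (by rwa [map_genericPoint hd]) b
  refine ⟨algebraMap _ _ a, ?_⟩
  exact (algebraMap_stalkMap π hd (genericPoint Y) a).symm.trans (algebraMap_genericPoint _)

/-- Outside of `p`, a rational function is regular at `π y` if and only if its composition with
`π` is regular at `y`. -/
theorem IsBlowUpAt.functionFieldMap_mem_iff (hπ : IsBlowUpAt π p hp) (hd : IsDominant π) {y : Y}
    (hy : π y ≠ p) {g : X.functionField} :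
    functionFieldMap π hd g ∈ (localRingAt y).toSubring ↔ g ∈ (localRingAt (π y)).toSubring := by
  constructor
  · rintro ⟨b, hb⟩
    obtain ⟨a, rfl⟩ := hπ.stalkMap_surjective hy b
    rw [algebraMap_stalkMap π hd] at hb
    exact ⟨a, (functionFieldMap π hd).injective hb⟩
  · rintro ⟨a, rfl⟩
    exact ⟨_, algebraMap_stalkMap π hd y a⟩

/-- A local ring which dominates the local ring at `p`, and in which the maximal ideal of `p`
becomes principal, dominates the local ring of a point of the blowing-up. -/
theorem IsBlowUpAt.exists_localRingAt_le (hπ : IsBlowUpAt π p hp) (hd : IsDominant π)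
    (S : LocalSubring Y.functionField) (hS : ∀ r, localToFunctionField π hd p r ∈ S.toSubring)
    (hm : ∀ r ∈ maximalIdeal (X.presheaf.stalk p),
      ¬ IsUnit (⟨_, hS r⟩ : S.toSubring)) {e : Y.functionField}
    (he : IsGenerator (localToFunctionField π hd p) (maximalIdeal (X.presheaf.stalk p))
      S.toSubring e) : ∃ y : Y, π y = p ∧ localRingAt y ≤ S := by
  let S' : CommRingCat.{u} := CommRingCat.of S.toSubring
  let ψ : X.presheaf.stalk p ⟶ S' :=
    CommRingCat.ofHom ((localToFunctionField π hd p).codRestrict S.toSubring hS)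
  let j : S' ⟶ Y.presheaf.stalk (genericPoint Y) := CommRingCat.ofHom S.toSubring.subtype
  have : IsLocalRing S' := S.isLocalRing
  have hψ : IsLocalHom ψ.hom := ⟨fun r hr => by
    by_contra h
    exact hm r h hr⟩
  have hspan : (maximalIdeal (X.presheaf.stalk p)).map ψ.hom = Ideal.span {(⟨e, he.mem hS⟩ : S')} :=
    he.map_eq_span hS
  have hinv := inverseImageInvertible_of_span hp ψ (mem_nonZeroDivisors_of_ne_zero
    (fun h0 => he.ne_zero (congrArg Subtype.val h0))) hspan
  obtain ⟨h, hh, -⟩ := hπ.existsUnique_lift _ _ hinv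
  have hgenp : π (genericPoint Y) ⤳ p := by
    rw [map_genericPoint hd]
    exact genericPoint_specializes p
  have hψj : ψ ≫ j = stalkMapOfSpecializes π hgenp := by
    ext r
    have h1 := algebraMap_stalkMapOfSpecializes π hd hgenp r
    exact h1.symm.trans (algebraMap_genericPoint _)
  have hinv' : InverseImageInvertible (pointIdeal p hp)
      (Spec.map (ψ ≫ j) ≫ X.fromSpecStalk p) := by
    refine inverseImageInvertible_of_span hp (ψ ≫ j) (e := e)
      (mem_nonZeroDivisors_of_ne_zero he.ne_zero) ?_
    rw [CommRingCat.hom_comp, ← Ideal.map_map, hspan, Ideal.map_span, Set.image_singleton]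
    rfl
  have h1 : Spec.map j ≫ h = Y.fromSpecStalk (genericPoint Y) := by
    refine hπ.hom_ext hinv' ?_ ?_
    · rw [Category.assoc, hh, Spec.map_comp, Category.assoc]
    · rw [hψj, specMap_stalkMapOfSpecializes]
  obtain ⟨f, hf, hfh⟩ := exists_specMap_eq h
  generalize hy : h (specClosedPoint S') = y at f hf hfh
  have hπy : π y = p := by
    rw [← hy, ← Scheme.Hom.comp_apply, hh, Scheme.Hom.comp_apply, specMap_specClosedPoint,
      fromSpecStalk_specClosedPoint]
  have h2 : f ≫ j = Y.presheaf.stalkSpecializes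
      ((genericPoint_spec Y).specializes (trivial : y ∈ Set.univ)) := by
    rw [← Spec.map_inj, ← cancel_mono (Y.fromSpecStalk _), Spec.map_comp, Category.assoc, hfh, h1,
      Scheme.SpecMap_stalkSpecializes_fromSpecStalk]
  have h3 : ∀ a : Y.presheaf.stalk y, ((f.hom a : S.toSubring) :
      Y.functionField) = algebraMap (Y.presheaf.stalk y) Y.functionField a :=
    fun a => congr($(h2).hom a)
  refine ⟨y, hπy, localSubring_le_iff.mpr ⟨?_, ?_⟩⟩
  · rintro _ ⟨a, rfl⟩
    rw [← h3 a]
    exact Subtype.property _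
  · rintro _ ⟨a, rfl⟩ ha
    by_cases ha0 : algebraMap (Y.presheaf.stalk y) Y.functionField a = 0
    · rw [ha0, inv_zero]
      exact zero_mem _
    · refine ((isUnit_stalk_iff a).mp ?_).2
      refine isUnit_of_map_unit f.hom a ?_
      exact (isUnit_subring_iff (f.hom a : S.toSubring).2).mpr ⟨by rwa [h3 a], by rwa [h3 a]⟩

/-- A point of the blowing-up above `p` is determined by a local ring dominated by its own. -/
theorem IsBlowUpAt.eq_of_localRingAt_le (hπ : IsBlowUpAt π p hp) (hd : IsDominant π) {y y' : Y}
    (hy : π y = p) (hy' : π y' = p) (h : localRingAt y ≤ localRingAt y') : y = y' := by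
  obtain ⟨hle, hloc⟩ := h
  let E (z : Y) : Y.presheaf.stalk z ≃+* (localRingAt z).toSubring :=
    RingEquiv.ofBijective (algebraMap (Y.presheaf.stalk z) Y.functionField).rangeRestrict
      ⟨fun a b hab => stalk_injective z (congrArg Subtype.val hab),
        RingHom.rangeRestrict_surjective _⟩
  have hE : ∀ (z : Y) (a : (localRingAt z).toSubring),
      algebraMap (Y.presheaf.stalk z) Y.functionField ((E z).symm a) = a := by
    intro z a
    exact congrArg Subtype.val ((E z).apply_symm_apply a)
  let j' : Y.presheaf.stalk y →+* Y.presheaf.stalk y' :=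
    ((E y').symm : _ →+* _).comp ((Subring.inclusion hle).comp (E y : _ →+* _))
  have hj' : IsLocalHom j' := by
    refine ⟨fun a ha => ?_⟩
    have h1 : IsUnit (Subring.inclusion hle (E y a)) :=
      (MulEquiv.isUnit_map (E y').symm).mp ha
    exact (MulEquiv.isUnit_map (E y)).mp (hloc.map_nonunit _ h1)
  let j : Y.presheaf.stalk y ⟶ Y.presheaf.stalk y' := CommRingCat.ofHom j'
  have hj : IsLocalHom j.hom := hj'
  have halg : ∀ a, algebraMap (Y.presheaf.stalk y') Y.functionField (j.hom a) =
      algebraMap (Y.presheaf.stalk y) Y.functionField a := fun a => hE y' _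
  have hψ : stalkMapOfSpecializes π (specializes_of_eq hy) ≫ j =
      stalkMapOfSpecializes π (specializes_of_eq hy') := by
    ext r
    apply stalk_injective y'
    rw [CommRingCat.comp_apply]
    exact (halg _).trans ((algebraMap_stalkMapOfSpecializes π hd (specializes_of_eq hy) r).trans
      (algebraMap_stalkMapOfSpecializes π hd (specializes_of_eq hy') r).symm)
  obtain ⟨U, W, hW, hyW, a, ha0, ha⟩ := hπ.invertible y'
  have hne : Nonempty W.1 := ⟨⟨y', hyW⟩⟩
  have h0 : Y.presheaf.germ W.1 y' hyW a ≠ 0 := by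
    rw [Ne, map_eq_zero_iff _ (germ_injective_of_isIntegral Y y' hyW)]
    exact nonZeroDivisors.ne_zero ha0
  have hinv := inverseImageInvertible_of_span hp (stalkMapOfSpecializes π (specializes_of_eq hy'))
    (mem_nonZeroDivisors_of_ne_zero h0) (map_maximalIdeal_eq_span hW ha hyW hy')
  have h1 : Spec.map j ≫ Y.fromSpecStalk y = Y.fromSpecStalk y' := by
    refine hπ.hom_ext hinv ?_ ?_
    · rw [Category.assoc, ← specMap_stalkMapOfSpecializes π (specializes_of_eq hy), ← hψ,
        Spec.map_comp, Category.assoc]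
    · rw [specMap_stalkMapOfSpecializes]
  rw [← fromSpecStalk_specClosedPoint y', ← h1, Scheme.Hom.comp_apply, specMap_specClosedPoint,
    fromSpecStalk_specClosedPoint]

end BlowUpPoints

/-! ### The exceptional curves -/

section Exceptional

variable {X Y : Scheme.{u}} [IsIntegral X] [IsIntegral Y] {π : Y ⟶ X} {p : X} {hp : IsClosed {p}}

theorem inv_localToFunctionField_notMem (hd : IsDominant π) {y : Y} (hy : π y = p)
    {r : X.presheaf.stalk p} (hr : r ∈ maximalIdeal (X.presheaf.stalk p)) (hr0 : r ≠ 0) :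
    (localToFunctionField π hd p r)⁻¹ ∉ (localRingAt y).toSubring := by
  intro h
  have := isLocalHom_stalkMapOfSpecializes hy
  refine hr (isUnit_of_map_unit (stalkMapOfSpecializes π (specializes_of_eq hy)).hom r ?_)
  have h1 := algebraMap_stalkMapOfSpecializes π hd (specializes_of_eq hy) r
  rw [isUnit_stalk_iff, h1]
  exact ⟨(map_ne_zero_iff _ (localToFunctionField_injective hd p)).mpr hr0, h⟩

theorem IsBlowUpAt.localRingAt_eq_ofPrime (hπ : IsBlowUpAt π p hp) (hd : IsDominant π)
    {u v : X.presheaf.stalk p} (huv : IsParameterPair u v) {y : Y} (hy : π y = p)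
    (h : localToFunctionField π hd p v / localToFunctionField π hd p u ∈
      (localRingAt y).toSubring) :
    ∃ (q : Ideal (chart (localToFunctionField π hd p) u v)) (_ : q.IsPrime),
      localRingAt y = LocalSubring.ofPrime _ q := by
  have hφ := localToFunctionField_injective hd p
  obtain ⟨q, hq, hle, -⟩ := exists_ofPrime_le (localRingAt y)
    (chart_le (localToFunctionField_mem hd hy) h)
  have hS : ∀ r, localToFunctionField π hd p r ∈ (LocalSubring.ofPrime _ q).toSubring :=
    fun r => LocalSubring.le_ofPrime _ q (map_mem_chart r)
  obtain ⟨y', hy', hle'⟩ := hπ.exists_localRingAt_le hd _ hS (fun r hr hu => by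
      rw [isUnit_subring_iff] at hu
      refine inv_localToFunctionField_notMem hd hy hr (fun h0 => hu.1 ?_) (hle.1 hu.2)
      rw [h0, map_zero])
    (isGenerator_of_div_mem hφ huv.span_eq huv.ne_zero hS
      (LocalSubring.le_ofPrime _ q div_mem_chart))
  obtain rfl := hπ.eq_of_localRingAt_le hd hy' hy (hle'.trans hle)
  exact ⟨q, hq, le_antisymm hle' hle⟩

/-- The inverse image of the maximal ideal of a regular point is a radical ideal of the local rings
of the blowing-up. -/
theorem IsBlowUpAt.div_mem_of_pow_div_mem (hπ : IsBlowUpAt π p hp) (hd : IsDominant π)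
    {u v : X.presheaf.stalk p} (huv : IsParameterPair u v) (hvu : IsParameterPair v u) {y : Y}
    (hy : π y = p) {e x : Y.functionField}
    (he : IsGenerator (localToFunctionField π hd p) (maximalIdeal (X.presheaf.stalk p))
      (localRingAt y).toSubring e) (hx : x ∈ (localRingAt y).toSubring) {n : ℕ}
    (h : x ^ n / e ∈ (localRingAt y).toSubring) : x / e ∈ (localRingAt y).toSubring := by
  have hφ := localToFunctionField_injective hd p
  have key : ∀ {u v : X.presheaf.stalk p}, IsParameterPair u v →
      e / localToFunctionField π hd p u ∈ (localRingAt y).toSubring →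
      x / e ∈ (localRingAt y).toSubring := by
    intro u v huv hu
    have hu0 : localToFunctionField π hd p u ≠ 0 := (map_ne_zero_iff _ hφ).mpr huv.ne_zero
    have hvm : v ∈ maximalIdeal (X.presheaf.stalk p) := huv.span_eq ▸ Ideal.subset_span (by simp)
    have hum : u ∈ maximalIdeal (X.presheaf.stalk p) := huv.span_eq ▸ Ideal.subset_span (by simp)
    have h1 := mul_mem (he.div_mem v hvm) hu
    rw [div_mul_div_cancel₀ he.ne_zero] at h1
    obtain ⟨q, hq, hO⟩ := hπ.localRingAt_eq_ofPrime hd huv hy h1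
    have h2 := mul_mem h hu
    rw [div_mul_div_cancel₀ he.ne_zero, hO] at h2
    rw [hO] at hx
    have h3 := huv.div_mem_of_pow_div_mem hφ q hx h2
    rw [← hO] at h3
    have h4 := mul_mem h3 (he.div_mem u hum)
    rwa [div_mul_div_cancel₀ hu0] at h4
  rcases exists_isUnit_div_of_isGenerator huv.span_eq (localToFunctionField_mem hd hy) he with
    ⟨-, h1⟩ | ⟨-, h1⟩
  · exact key huv h1
  · exact key hvu h1

/-- The rational function `e` is an equation of the inverse image of `p` at the point `y`. -/
structure IsLocalEquation (hd : IsDominant π) (p : X) (y : Y) (e : Y.functionField) : Prop where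
  ne_zero : e ≠ 0
  isGenerator : π y = p → IsGenerator (localToFunctionField π hd p)
    (maximalIdeal (X.presheaf.stalk p)) (localRingAt y).toSubring e
  mem : e ∈ (localRingAt y).toSubring
  inv_mem : π y ≠ p → e⁻¹ ∈ (localRingAt y).toSubring

theorem IsLocalEquation.div_mem {hd : IsDominant π} {y : Y} {e e' : Y.functionField}
    (h : IsLocalEquation hd p y e) (h' : IsLocalEquation hd p y e') :
    e / e' ∈ (localRingAt y).toSubring := by
  by_cases hy : π y = p
  · exact (h'.isGenerator hy).div_mem_of_isGenerator (h.isGenerator hy)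
  · rw [div_eq_mul_inv]
    exact mul_mem h.mem (h'.inv_mem hy)

theorem IsLocalEquation.of_div_mem {hd : IsDominant π} {y : Y} {e e' : Y.functionField}
    (h : IsLocalEquation hd p y e) (h0 : e' ≠ 0) (h1 : e / e' ∈ (localRingAt y).toSubring)
    (h2 : e' / e ∈ (localRingAt y).toSubring) : IsLocalEquation hd p y e' where
  ne_zero := h0
  isGenerator hy := (h.isGenerator hy).of_div_mem h0 h1 h2
  mem := by
    have := mul_mem h2 h.mem
    rwa [div_mul_cancel₀ _ h.ne_zero] at this
  inv_mem hy := by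
    have := mul_mem h1 (h.inv_mem hy)
    rwa [div_mul_eq_mul_div, mul_inv_cancel₀ h.ne_zero, one_div] at this

theorem IsLocalEquation.one {hd : IsDominant π} {y : Y} (hy : π y ≠ p) :
    IsLocalEquation hd p y 1 where
  ne_zero := one_ne_zero
  isGenerator h := absurd h hy
  mem := one_mem _
  inv_mem _ := by
    rw [inv_one]
    exact one_mem _

theorem IsLocalEquation.of_isGenerator {hd : IsDominant π} {y : Y} (hy : π y = p)
    {e : Y.functionField} (he : IsGenerator (localToFunctionField π hd p)
      (maximalIdeal (X.presheaf.stalk p)) (localRingAt y).toSubring e) :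
    IsLocalEquation hd p y e where
  ne_zero := he.ne_zero
  isGenerator _ := he
  mem := he.mem (localToFunctionField_mem hd hy)
  inv_mem h := absurd hy h

theorem IsBlowUpAt.exists_isLocalEquation (hπ : IsBlowUpAt π p hp) (hd : IsDominant π) (y : Y) :
    ∃ (W : Y.Opens) (_ : y ∈ W) (e : Y.functionField), ∀ y' ∈ W, IsLocalEquation hd p y' e := by
  obtain ⟨U, W, hW, hyW, a, ha0, ha⟩ := hπ.invertible y
  have hne : Nonempty W.1 := ⟨⟨y, hyW⟩⟩
  have hrep : Represents a
      (algebraMap (Y.presheaf.stalk y) Y.functionField (Y.presheaf.germ W.1 y hyW a)) :=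
    represents_of_germ_eq hyW rfl
  refine ⟨W.1, hyW, _, fun y' hy' => ⟨?_, fun h => ?_, ⟨_, hrep y' hy'⟩, fun h => ?_⟩⟩
  · rw [map_ne_zero_iff _ (stalk_injective y),
      map_ne_zero_iff _ (germ_injective_of_isIntegral Y y hyW)]
    exact nonZeroDivisors.ne_zero ha0
  · rw [← hrep y' hy']
    exact isGenerator_germ hd hW ha0 ha hy' h
  · rw [← hrep y' hy']
    exact ((isUnit_stalk_iff _).mp (isUnit_germ_of_ne hW ha hy' h)).2

theorem IsLocalEquation.inv_mem_iff {hd : IsDominant π} {y : Y} {e : Y.functionField}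
    (h : IsLocalEquation hd p y e) : e⁻¹ ∈ (localRingAt y).toSubring ↔ π y ≠ p := by
  refine ⟨fun he hy => ?_, h.inv_mem⟩
  have hφ := localToFunctionField_mem hd hy
  obtain ⟨he', hmem⟩ := exists_mem_map_of_mem_span hφ (h.isGenerator hy).mem_span
  have hle : (maximalIdeal (X.presheaf.stalk p)).map
      ((localToFunctionField π hd p).codRestrict _ hφ) ≤
      maximalIdeal (localRingAt y).toSubring := by
    rw [Ideal.map_le_iff_le_comap]
    intro r hr hu
    have hu' := (isUnit_subring_iff (hφ r)).mp hu
    refine inv_localToFunctionField_notMem hd hy hr (fun h0 => hu'.1 ?_) hu'.2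
    rw [h0, map_zero]
  exact hle hmem ((isUnit_subring_iff he').mpr ⟨h.ne_zero, he⟩)

/-- A local equation of the inverse image of a regular point generates the ideal of the functions
which vanish there. -/
theorem IsBlowUpAt.vanishingIdeal_eq_span (hπ : IsBlowUpAt π p hp) (hd : IsDominant π)
    {u v : X.presheaf.stalk p} (huv : IsParameterPair u v) (hvu : IsParameterPair v u)
    (W : Y.affineOpens) {a : Γ(Y, W.1)} {e : Y.functionField} (ha : Represents a e)
    (he : ∀ y ∈ W.1, IsLocalEquation hd p y e) :
    (Scheme.IdealSheafData.vanishingIdeal ⟨π ⁻¹' {p}, hp.preimage π.continuous⟩).ideal W =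
      Ideal.span {a} := by
  have hmem : ∀ (y : Y) (hy : y ∈ W.1),
      Y.presheaf.germ W.1 y hy a ∈ maximalIdeal (Y.presheaf.stalk y) ↔ π y = p := by
    intro y hy
    rw [IsLocalRing.mem_maximalIdeal, mem_nonunits_iff, isUnit_stalk_iff, ha y hy,
      (he y hy).inv_mem_iff]
    simp [(he y hy).ne_zero]
  apply le_antisymm
  · intro b hb
    rw [mem_vanishingIdeal_iff] at hb
    have hW : IsAffineOpen W.1 := W.2
    have hrad : b ∈ (Ideal.span {a}).radical := by
      rw [Ideal.radical_eq_sInf, Submodule.mem_sInf]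
      rintro Q ⟨hQa, hQ⟩
      let z : Spec Γ(Y, W.1) := ⟨Q, hQ⟩
      have hz : hW.fromSpec z ∈ W.1 := by
        have : hW.fromSpec z ∈ (W.1 : Set Y) := by
          rw [← hW.range_fromSpec]
          exact ⟨z, rfl⟩
        exact this
      have hzQ : hW.primeIdealOf ⟨hW.fromSpec z, hz⟩ = z :=
        hW.fromSpec.isOpenEmbedding.injective (hW.fromSpec_primeIdealOf _)
      have h1 : ∀ c : Γ(Y, W.1), c ∈ Q ↔
          Y.presheaf.germ W.1 _ hz c ∈ maximalIdeal (Y.presheaf.stalk _) := by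
        intro c
        rw [← mem_primeIdealOf_iff hW hz, hzQ]
      exact (h1 b).mpr (hb _ hz ((hmem _ hz).mp ((h1 a).mp
        ((Ideal.span_singleton_le_iff_mem _).mp hQa))))
    obtain ⟨n, hn⟩ := Ideal.mem_radical_iff.mp hrad
    obtain ⟨c, hc⟩ := Ideal.mem_span_singleton.mp hn
    by_cases hne : ∃ y, y ∈ W.1
    swap
    · obtain hbot : W.1 = ⊥ := by
        ext y
        simpa using fun hy => hne ⟨y, hy⟩
      have : Subsingleton Γ(Y, W.1) := by
        rw [hbot]
        infer_instance
      rw [Subsingleton.elim b 0]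
      exact zero_mem _
    obtain ⟨y₀, hy₀⟩ := hne
    have hb' := represents_of_germ_eq hy₀ (a := b) rfl
    set g := algebraMap (Y.presheaf.stalk y₀) Y.functionField (Y.presheaf.germ W.1 y₀ hy₀ b)
    have hreg : IsRegularOn W.1 (g / e) := by
      rw [isRegularOn_iff]
      intro y hy
      by_cases hyp : π y = p
      · refine hπ.div_mem_of_pow_div_mem hd huv hvu hyp ((he y hy).isGenerator hyp)
          ⟨_, hb' y hy⟩ (n := n) ⟨Y.presheaf.germ W.1 y hy c, ?_⟩
        rw [eq_div_iff (he y hy).ne_zero, ← ha y hy, ← hb' y hy, ← map_mul, ← map_mul, mul_comm,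
          ← hc, map_pow, map_pow]
      · rw [div_eq_mul_inv]
        exact mul_mem ⟨_, hb' y hy⟩ ((he y hy).inv_mem hyp)
    obtain ⟨d, hd'⟩ := hreg
    refine Ideal.mem_span_singleton.mpr ⟨d, hb'.eq fun y hy => ?_⟩
    rw [map_mul, map_mul, ha y hy, hd' y hy, mul_div_cancel₀ _ (he y hy).ne_zero]
  · rw [Ideal.span_singleton_le_iff_mem, mem_vanishingIdeal_iff]
    exact fun y hy hyp => (hmem y hy).mpr hyp

theorem IsBlowUpAt.exists_isSumOfExceptionalCurves (hπ : IsBlowUpAt π p hp) (hd : IsDominant π)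
    {u v : X.presheaf.stalk p} (huv : IsParameterPair u v) (hvu : IsParameterPair v u) :
    ∃ E : CartierDivisor Y, IsSumOfExceptionalCurves π p hp E := by
  choose W hW e he using hπ.exists_isLocalEquation hd
  refine ⟨⟨Y, W, e, fun y => ⟨y, hW y⟩, fun y => (he y y (hW y)).ne_zero, fun y z => ?_⟩, ?_⟩
  · rw [isRegularOn_iff]
    exact fun x hx => (he y x hx.1).div_mem (he z x hx.2)
  · intro y V hV
    obtain ⟨a, ha⟩ : IsRegularOn V.1 (e y) :=
      isRegularOn_iff.mpr fun x hx => (he y x (hV hx)).mem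
    exact ⟨a, ha, hπ.vanishingIdeal_eq_span hd huv hvu V ha fun x hx => he y x (hV hx)⟩

theorem IsBlowUpAt.isLocalEquation (hπ : IsBlowUpAt π p hp) (hd : IsDominant π)
    {u v : X.presheaf.stalk p} (huv : IsParameterPair u v) (hvu : IsParameterPair v u)
    {E : CartierDivisor Y} (hE : IsSumOfExceptionalCurves π p hp E) {j : E.ι} {y : Y}
    (hy : y ∈ E.U j) : IsLocalEquation hd p y (E.f j) := by
  obtain ⟨W, hyW, e, he⟩ := hπ.exists_isLocalEquation hd y
  obtain ⟨_, ⟨V, hV, rfl⟩, hyV, hVW⟩ :=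
    Y.isBasis_affineOpens.exists_subset_of_mem_open (show y ∈ W ⊓ E.U j from ⟨hyW, hy⟩)
      (W ⊓ E.U j).isOpen
  have hVW' : V ≤ W := fun x hx => (hVW hx).1
  obtain ⟨a, ha, ha'⟩ := hE j ⟨V, hV⟩ fun x hx => (hVW hx).2
  obtain ⟨b, hb⟩ : IsRegularOn V e := isRegularOn_iff.mpr fun x hx => (he x (hVW' hx)).mem
  have hb' := hπ.vanishingIdeal_eq_span hd huv hvu ⟨V, hV⟩ hb fun x hx => he x (hVW' hx)
  rw [ha'] at hb'
  have key : ∀ {a b : Γ(Y, V)} {f g : Y.functionField}, Represents a f → Represents b g → g ≠ 0 →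
      b ∣ a → f / g ∈ (localRingAt y).toSubring := by
    rintro a b f g ha hb hg ⟨c, rfl⟩
    refine ⟨Y.presheaf.germ V y hyV c, ?_⟩
    rw [eq_div_iff hg, ← ha y hyV, ← hb y hyV, map_mul, map_mul, mul_comm]
  refine (he y hyW).of_div_mem (E.ne_zero j) ?_ ?_
  · exact key hb ha (E.ne_zero j) (Ideal.mem_span_singleton.mp
      (hb' ▸ Ideal.mem_span_singleton_self b))
  · exact key ha hb (he y hyW).ne_zero (Ideal.mem_span_singleton.mp
      (hb' ▸ Ideal.mem_span_singleton_self a))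

end Exceptional

/-! ### Regular functions above a point -/

section Sections

variable {X Y : Scheme.{u}} [IsIntegral X] [IsIntegral Y] {π : Y ⟶ X} {p : X} {hp : IsClosed {p}}

/-- A rational function which is regular at the points of a blowing-up above a normal point is
regular at this point. -/
theorem IsBlowUpAt.mem_localRingAt_of_forall (hπ : IsBlowUpAt π p hp) (hd : IsDominant π)
    (hgen : genericPoint X ≠ p) [IsNoetherianRing (X.presheaf.stalk p)]
    [IsIntegrallyClosed (X.presheaf.stalk p)] (hm : maximalIdeal (X.presheaf.stalk p) ≠ ⊥)
    {g : X.functionField}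
    (h : ∀ y, π y = p → functionFieldMap π hd g ∈ (localRingAt y).toSubring) :
    g ∈ (localRingAt p).toSubring := by
  have hφ := localToFunctionField_injective hd p
  let R := LocalSubring.range (localToFunctionField π hd p)
  have hR : ∀ r, localToFunctionField π hd p r ∈ R.toSubring := fun r => ⟨r, rfl⟩
  have hinteg : IsIntegrallyClosedIn R.toSubring Y.functionField := by
    rw [Subring.isIntegrallyClosedIn_iff]
    intro x hx
    obtain ⟨x, rfl⟩ := hπ.functionFieldMap_surjective hd hgen x
    algebraize [localToFunctionField π hd p]
    let : Algebra (X.presheaf.stalk p) R.toSubring :=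
      ((localToFunctionField π hd p).codRestrict R.toSubring hR).toAlgebra
    have : IsScalarTower (X.presheaf.stalk p) R.toSubring Y.functionField :=
      .of_algebraMap_eq fun _ => rfl
    have : Algebra.IsIntegral (X.presheaf.stalk p) R.toSubring :=
      ⟨fun ⟨z, r, hr⟩ => by
        have h0 : algebraMap (X.presheaf.stalk p) R.toSubring r = ⟨z, r, hr⟩ := Subtype.ext hr
        rw [← h0]
        exact isIntegral_algebraMap⟩
    have h1 : IsIntegral (X.presheaf.stalk p) (functionFieldMap π hd x) := isIntegral_trans _ hx
    let f : X.functionField →ₐ[X.presheaf.stalk p] Y.functionField :=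
      { functionFieldMap π hd with commutes' := fun _ => rfl }
    have h2 : IsIntegral (X.presheaf.stalk p) x :=
      (isIntegral_algHom_iff f (functionFieldMap π hd).injective).mp h1
    obtain ⟨r, rfl⟩ := IsIntegrallyClosed.isIntegral_iff.mp h2
    exact hR r
  by_contra hg
  have hg' : functionFieldMap π hd g ∉ R.toSubring := by
    rintro ⟨r, hr⟩
    exact hg ⟨r, (functionFieldMap π hd).injective hr⟩
  obtain ⟨V, hV, hgV⟩ := LocalSubring.exists_le_valuationSubring_of_isIntegrallyClosedIn hg'
  obtain ⟨e, he⟩ := exists_isGenerator_valuationSubring hφ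
    (maximalIdeal (X.presheaf.stalk p)).fg_of_isNoetherianRing hm V fun r => hV.1 (hR r)
  obtain ⟨y, hy, hle⟩ := hπ.exists_localRingAt_le hd V.toLocalSubring (fun r => hV.1 (hR r))
    (fun r hr hu => by
      obtain ⟨h0, h1⟩ := (isUnit_subring_iff _).mp hu
      obtain ⟨s, hs⟩ := (localSubring_le_iff.mp hV).2 _ (hR r) h1
      refine hr (isUnit_iff_exists_inv.mpr ⟨s, hφ ?_⟩)
      rw [map_mul, hs, map_one, mul_inv_cancel₀ h0]) he
  exact hgV (hle.1 (h y hy))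

/-- The functions which have multiplicity at least `n` at a regular point are those which are
divisible by the power `n` of the equation of the exceptional curves. -/
theorem IsBlowUpAt.vanishesToOrder_iff (hπ : IsBlowUpAt π p hp) (hd : IsDominant π)
    (hgen : genericPoint X ≠ p) [IsNoetherianRing (X.presheaf.stalk p)]
    [IsIntegrallyClosed (X.presheaf.stalk p)]
    {u v : X.presheaf.stalk p} (huv : IsParameterPair u v) {n : ℕ} {g : X.functionField} :
    VanishesToOrder p n g ↔ ∀ y, π y = p → ∀ e, IsGenerator (localToFunctionField π hd p)
      (maximalIdeal (X.presheaf.stalk p)) (localRingAt y).toSubring e →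
        functionFieldMap π hd g / e ^ n ∈ (localRingAt y).toSubring := by
  have hφ := localToFunctionField_injective hd p
  have hum : u ∈ maximalIdeal (X.presheaf.stalk p) := huv.span_eq ▸ Ideal.subset_span (by simp)
  constructor
  · rintro ⟨a, ha, rfl⟩ y hy e he
    exact he.div_pow_mem (localToFunctionField_mem hd hy) n a ha
  · intro h
    have hm : maximalIdeal (X.presheaf.stalk p) ≠ ⊥ := fun h0 => huv.ne_zero (by
      rw [h0] at hum
      exact hum)
    obtain ⟨a, rfl⟩ := hπ.mem_localRingAt_of_forall hd hgen hm (g := g) fun y hy => by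
      obtain ⟨e, he⟩ := hπ.exists_isGenerator hd hy
      have := mul_mem (h y hy e he) (pow_mem (he.mem (localToFunctionField_mem hd hy)) n)
      rwa [div_mul_cancel₀ _ (pow_ne_zero n he.ne_zero)] at this
    refine ⟨a, ?_, rfl⟩
    have hq := huv.isPrime_span hφ
    have hle := LocalSubring.le_ofPrime (chart (localToFunctionField π hd p) u v)
      (Ideal.span {(⟨_, map_mem_chart u⟩ : chart (localToFunctionField π hd p) u v)})
    have hS := fun r => hle (map_mem_chart (φ := localToFunctionField π hd p) r)
    have hgenu := isGenerator_of_div_mem hφ huv.span_eq huv.ne_zero hS (hle div_mem_chart)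
    obtain ⟨y, hy, hyle⟩ := hπ.exists_localRingAt_le hd _ hS (fun r hr hu => by
      obtain ⟨h0, h1⟩ := (isUnit_subring_iff _).mp hu
      refine (inv_mem_ofPrime_iff (a := ⟨_, map_mem_chart r⟩)
        fun h2 => h0 (congrArg Subtype.val h2)).mp h1 ?_
      refine Ideal.mem_span_singleton.mpr ⟨⟨_, (isGenerator_of_div_mem hφ huv.span_eq huv.ne_zero
        map_mem_chart div_mem_chart).div_mem r hr⟩, Subtype.ext ?_⟩
      exact (mul_div_cancel₀ _ hgenu.ne_zero).symm) hgenu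
    obtain ⟨e, he⟩ := hπ.exists_isGenerator hd hy
    have h1 := hyle.1 (h y hy e he)
    have h2 := pow_mem (hgenu.div_mem_of_isGenerator (he.mono hyle.1)) n
    have h3 := mul_mem h1 h2
    rw [div_pow, div_mul_div_cancel₀ (pow_ne_zero n he.ne_zero)] at h3
    exact huv.mem_pow_of_div_mem hφ n a h3

end Sections

/-! ### Values of rational functions -/

section Values

variable {k : Type u} [Field k] {X : Scheme.{u}} [X.Over (Spec (CommRingCat.of k))] {x : X}
  {c d : k}

theorem residue_eq_algebraMap_iff (a : X.presheaf.stalk x) :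
    (X.residue x).hom a = algebraMap k (X.residueField x) c ↔
      a - algebraMap k (X.presheaf.stalk x) c ∈ maximalIdeal (X.presheaf.stalk x) := by
  rw [← residue_eq_zero_iff, map_sub, sub_eq_zero]
  rfl

theorem degree_eq_one_iff : degree k X x = 1 ↔
    Function.Bijective (algebraMap k (X.residueField x)) := by
  constructor
  · intro h
    have h1 := Subalgebra.bot_eq_top_of_finrank_eq_one h
    exact ⟨(algebraMap k _).injective, Algebra.surjective_algebraMap_iff.mpr h1.symm⟩
  · intro h
    exact finrank_eq_one_iff_of_nonzero' (1 : X.residueField x) one_ne_zero |>.mpr fun a => by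
      obtain ⟨c, rfl⟩ := h.2 a
      exact ⟨c, by rw [Algebra.smul_def, mul_one]⟩

variable [IsIntegral X] {g h : X.functionField}

theorem hasValueAt_iff : HasValueAt k x g c ↔ ∃ a : X.presheaf.stalk x,
    algebraMap (X.presheaf.stalk x) X.functionField a = g ∧
      a - algebraMap k (X.presheaf.stalk x) c ∈ maximalIdeal (X.presheaf.stalk x) := by
  simp only [← residue_eq_algebraMap_iff]
  rfl

theorem HasValueAt.mem (hg : HasValueAt k x g c) : g ∈ (localRingAt x).toSubring :=
  hg.imp fun _ h => h.1

theorem HasValueAt.eq (hg : HasValueAt k x g c) (hg' : HasValueAt k x g d) : c = d := by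
  obtain ⟨a, ha, ha'⟩ := hg
  obtain ⟨b, hb, hb'⟩ := hg'
  obtain rfl := stalk_injective x (ha.trans hb.symm)
  exact (algebraMap k (X.residueField x)).injective (ha'.symm.trans hb')

theorem HasValueAt.mul (hg : HasValueAt k x g c) (hh : HasValueAt k x h d) :
    HasValueAt k x (g * h) (c * d) := by
  obtain ⟨a, ha, ha'⟩ := hg
  obtain ⟨b, hb, hb'⟩ := hh
  exact ⟨a * b, by rw [map_mul, ha, hb], by rw [map_mul, map_mul, ha', hb']⟩

variable (x c) in
theorem hasValueAt_algebraMap : HasValueAt k x (algebraMap k X.functionField c) c :=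
  ⟨algebraMap k _ c, algebraMap_stalk_functionField x c, rfl⟩

theorem hasValueAt_one : HasValueAt k x (1 : X.functionField) 1 := by
  simpa using hasValueAt_algebraMap x (1 : k)

theorem HasValueAt.pow (hg : HasValueAt k x g c) (n : ℕ) : HasValueAt k x (g ^ n) (c ^ n) := by
  induction n with
  | zero => simpa using hasValueAt_one
  | succ n ih =>
    rw [pow_succ, pow_succ]
    exact ih.mul hg

theorem HasValueAt.aeval {w : Fin 2 → k} (hg : HasValueAt k x g (w 0))
    (hh : HasValueAt k x h (w 1)) (F : MvPolynomial (Fin 2) k) :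
    HasValueAt k x (MvPolynomial.aeval ![g, h] F) (MvPolynomial.eval w F) := by
  induction F using MvPolynomial.induction_on with
  | C c =>
    rw [MvPolynomial.aeval_C, MvPolynomial.eval_C]
    exact hasValueAt_algebraMap x c
  | add F G hF hG =>
    rw [map_add, map_add]
    exact hF.add hG
  | mul_X F i hF =>
    rw [map_mul, map_mul, MvPolynomial.aeval_X, MvPolynomial.eval_X]
    refine hF.mul ?_
    fin_cases i
    · exact hg
    · exact hh

theorem HasValueAt.inv (hg : HasValueAt k x g c) (hc : c ≠ 0) : HasValueAt k x g⁻¹ c⁻¹ := by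
  obtain ⟨a, rfl, ha⟩ := hg
  have hu : IsUnit a := by
    by_contra h
    have h1 : (X.residue x).hom a = 0 := (residue_eq_zero_iff a).mpr h
    exact hc ((map_eq_zero _).mp (ha.symm.trans h1))
  obtain ⟨b, hb⟩ := isUnit_iff_exists_inv.mp hu
  refine ⟨b, eq_inv_of_mul_eq_one_right ?_, ?_⟩
  · rw [← map_mul, hb, map_one]
  · rw [map_inv₀]
    refine eq_inv_of_mul_eq_one_right ?_
    rw [← ha, ← map_mul, hb, map_one]

theorem HasValueAt.ne_zero (hg : HasValueAt k x g c) (hc : c ≠ 0) : g ≠ 0 := by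
  rintro rfl
  exact hc (hg.eq (hasValueAt_zero k x))

theorem HasValueAt.mul_iff {r : X.functionField} {a : k} (hr : HasValueAt k x r a) (ha : a ≠ 0) :
    HasValueAt k x (g * r) (a * c) ↔ HasValueAt k x g c := by
  refine ⟨fun h => ?_, fun h => mul_comm c a ▸ h.mul hr⟩
  have := h.mul (hr.inv ha)
  rwa [mul_inv_cancel_right₀ (hr.ne_zero ha), mul_comm a, mul_inv_cancel_right₀ ha] at this

theorem hasValueAt_zero_iff : HasValueAt k x g 0 ↔
    g ∈ (localRingAt x).toSubring ∧ (g ≠ 0 → g⁻¹ ∉ (localRingAt x).toSubring) := by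
  have key : ∀ a : X.presheaf.stalk x, a ∈ maximalIdeal (X.presheaf.stalk x) ↔
      (algebraMap (X.presheaf.stalk x) X.functionField a ≠ 0 →
        (algebraMap (X.presheaf.stalk x) X.functionField a)⁻¹ ∉ (localRingAt x).toSubring) := by
    intro a
    rw [IsLocalRing.mem_maximalIdeal, mem_nonunits_iff, isUnit_stalk_iff, not_and]
  rw [hasValueAt_iff]
  constructor
  · rintro ⟨a, rfl, ha⟩
    rw [map_zero, sub_zero] at ha
    exact ⟨⟨a, rfl⟩, (key a).mp ha⟩
  · rintro ⟨⟨a, rfl⟩, h⟩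
    refine ⟨a, rfl, ?_⟩
    rw [map_zero, sub_zero]
    exact (key a).mpr h

theorem HasValueAt.mul_mem (hg : HasValueAt k x g 0) (hh : h ∈ (localRingAt x).toSubring) :
    HasValueAt k x (h * g) 0 := by
  rw [hasValueAt_iff] at hg ⊢
  obtain ⟨a, rfl, ha⟩ := hg
  obtain ⟨b, rfl⟩ := hh
  refine ⟨b * a, map_mul _ _ _, ?_⟩
  rw [map_zero, sub_zero] at ha ⊢
  exact Ideal.mul_mem_left _ _ ha

/-- A point is rational if and only if the functions which are regular at this point have a value
in `k`. -/
theorem bijective_algebraMap_residueField_iff :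
    Function.Bijective (algebraMap k (X.residueField x)) ↔
      ∀ g ∈ (localRingAt x).toSubring, ∃ c, HasValueAt k x g c := by
  constructor
  · rintro h _ ⟨a, rfl⟩
    obtain ⟨c, hc⟩ := h.2 ((X.residue x).hom a)
    exact ⟨c, a, rfl, hc.symm⟩
  · refine fun h => ⟨(algebraMap k _).injective, fun b => ?_⟩
    obtain ⟨a, rfl⟩ := residue_surjective b
    obtain ⟨c, a', ha, hc⟩ := h _ ⟨a, rfl⟩
    obtain rfl := stalk_injective x ha
    exact ⟨c, hc.symm⟩

theorem exists_units_hasValueAt (hx : Function.Bijective (algebraMap k (X.residueField x)))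
    (h0 : g ≠ 0) (hg : g ∈ (localRingAt x).toSubring) (hg' : g⁻¹ ∈ (localRingAt x).toSubring) :
    ∃ a : kˣ, HasValueAt k x g a := by
  obtain ⟨c, hc⟩ := bijective_algebraMap_residueField_iff.mp hx g hg
  refine ⟨Units.mk0 c ?_, hc⟩
  rintro rfl
  exact (hasValueAt_zero_iff.mp hc).2 h0 hg'

end Values

section Pullback

variable {k : Type u} [Field k] {X Y : Scheme.{u}} [X.Over (Spec (CommRingCat.of k))]
  [Y.Over (Spec (CommRingCat.of k))] (π : Y ⟶ X) [π.IsOver (Spec (CommRingCat.of k))]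

theorem stalkMap_algebraMap (y : Y) (c : k) :
    (π.stalkMap y).hom (algebraMap k (X.presheaf.stalk (π y)) c) =
      algebraMap k (Y.presheaf.stalk y) c := by
  have h : (X ↘ Spec (CommRingCat.of k)).appTop ≫ X.presheaf.germ ⊤ (π y) trivial ≫ π.stalkMap y =
      (Y ↘ Spec (CommRingCat.of k)).appTop ≫ Y.presheaf.germ ⊤ y trivial := by
    have h1 : X.presheaf.germ ⊤ (π y) trivial ≫ π.stalkMap y =
        π.appTop ≫ Y.presheaf.germ ⊤ y trivial := Scheme.Hom.germ_stalkMap π ⊤ y trivial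
    rw [h1, ← comp_over π (Spec (CommRingCat.of k)), Scheme.Hom.comp_appTop, Category.assoc]
  exact congr($(h).hom ((Scheme.ΓSpecIso (CommRingCat.of k)).inv.hom c))

variable {π}

theorem IsBlowUpAt.eq_of_map_eq {p : X} {hp : IsClosed {p}} (hπ : IsBlowUpAt π p hp) {x : X}
    (hx : x ≠ p) {y y' : Y} (hy : π y = x) (hy' : π y' = x) : y = y' := by
  obtain ⟨z, -, hz, -⟩ := hπ.exists_of_ne hx
  rw [hz y hy, hz y' hy']

variable [IsIntegral X] [IsIntegral Y]

theorem functionFieldMap_algebraMap (hd : IsDominant π) (c : k) :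
    functionFieldMap π hd (algebraMap k X.functionField c) = algebraMap k Y.functionField c := by
  rw [← algebraMap_stalk_functionField (π (genericPoint Y)), ← algebraMap_stalkMap π hd,
    stalkMap_algebraMap, algebraMap_stalk_functionField]

theorem hasValueAt_functionFieldMap_iff (hd : IsDominant π) {x : X} {y : Y} (hy : π y = x)
    {g : X.functionField} (hg : g ∈ (localRingAt x).toSubring) {c : k} :
    HasValueAt k y (functionFieldMap π hd g) c ↔ HasValueAt k x g c := by
  subst hy
  obtain ⟨a, rfl⟩ := hg
  have h1 : (π.stalkMap y).hom a - algebraMap k (Y.presheaf.stalk y) c =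
      (π.stalkMap y).hom (a - algebraMap k (X.presheaf.stalk (π y)) c) := by
    rw [map_sub, stalkMap_algebraMap]
  have h2 : ∀ b : X.presheaf.stalk (π y), (π.stalkMap y).hom b ∈
      maximalIdeal (Y.presheaf.stalk y) ↔ b ∈ maximalIdeal (X.presheaf.stalk (π y)) := by
    intro b
    rw [IsLocalRing.mem_maximalIdeal, mem_nonunits_iff, IsLocalRing.mem_maximalIdeal,
      mem_nonunits_iff, isUnit_map_iff]
  rw [hasValueAt_iff, hasValueAt_iff]
  constructor
  · rintro ⟨b, hb, hbc⟩
    rw [← algebraMap_stalkMap π hd] at hb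
    obtain rfl := stalk_injective y hb
    rw [h1, h2] at hbc
    exact ⟨a, rfl, hbc⟩
  · rintro ⟨b, hb, hbc⟩
    obtain rfl := stalk_injective (π y) hb
    refine ⟨(π.stalkMap y).hom b, algebraMap_stalkMap π hd y b, ?_⟩
    rwa [h1, h2]

/-- The image of a rational point is a rational point. -/
theorem bijective_algebraMap_residueField_map (hd : IsDominant π) {x : X} {y : Y}
    (hy : π y = x) (h : Function.Bijective (algebraMap k (Y.residueField y))) :
    Function.Bijective (algebraMap k (X.residueField x)) := by
  rw [bijective_algebraMap_residueField_iff] at h ⊢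
  intro g hg
  have hg' : functionFieldMap π hd g ∈ (localRingAt y).toSubring := by
    subst hy
    obtain ⟨a, rfl⟩ := hg
    exact ⟨_, algebraMap_stalkMap π hd y a⟩
  obtain ⟨c, hc⟩ := h _ hg'
  exact ⟨c, (hasValueAt_functionFieldMap_iff hd hy hg).mp hc⟩

variable {p : X} {hp : IsClosed {p}}

theorem IsBlowUpAt.functionFieldMap_mem_iff_of_eq (hπ : IsBlowUpAt π p hp) (hd : IsDominant π)
    {x : X} {y : Y} (hy : π y = x) (hx : x ≠ p) {g : X.functionField} :
    functionFieldMap π hd g ∈ (localRingAt y).toSubring ↔ g ∈ (localRingAt x).toSubring := by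
  subst hy
  exact hπ.functionFieldMap_mem_iff hd hx

theorem IsBlowUpAt.hasValueAt_iff (hπ : IsBlowUpAt π p hp) (hd : IsDominant π) {x : X} {y : Y}
    (hy : π y = x) (hx : x ≠ p) {g : X.functionField} {c : k} :
    HasValueAt k y (functionFieldMap π hd g) c ↔ HasValueAt k x g c :=
  ⟨fun h => (hasValueAt_functionFieldMap_iff hd hy
      ((hπ.functionFieldMap_mem_iff_of_eq hd hy hx).mp h.mem)).mp h,
    fun h => (hasValueAt_functionFieldMap_iff hd hy h.mem).mpr h⟩

theorem IsBlowUpAt.bijective_iff (hπ : IsBlowUpAt π p hp) (hd : IsDominant π)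
    (hgen : genericPoint X ≠ p) {x : X} {y : Y} (hy : π y = x) (hx : x ≠ p) :
    Function.Bijective (algebraMap k (Y.residueField y)) ↔
      Function.Bijective (algebraMap k (X.residueField x)) := by
  refine ⟨bijective_algebraMap_residueField_map hd hy, fun h => ?_⟩
  rw [bijective_algebraMap_residueField_iff] at h ⊢
  intro g hg
  obtain ⟨g, rfl⟩ := hπ.functionFieldMap_surjective hd hgen g
  exact (h g ((hπ.functionFieldMap_mem_iff_of_eq hd hy hx).mp hg)).imp
    fun c hc => (hπ.hasValueAt_iff hd hy hx).mpr hc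

/-- Above a rational point different from `p` there is exactly one rational point of the
blowing-up. -/
theorem IsBlowUpAt.exists_rationalPoint (hπ : IsBlowUpAt π p hp) (hd : IsDominant π)
    (hgen : genericPoint X ≠ p) (x : RationalPoint k X) (hx : x.1 ≠ p) :
    ∃ y : RationalPoint k Y, π y.1 = x.1 := by
  obtain ⟨y, hy, -⟩ := hπ.exists_of_ne hx
  exact ⟨⟨y, (hπ.bijective_iff hd hgen hy hx).mpr x.2⟩, hy⟩

end Pullback

/-! ### Global sections -/

section GlobalSections

variable {k : Type u} [Field k] {X Y : Scheme.{u}} [X.Over (Spec (CommRingCat.of k))]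
  [Y.Over (Spec (CommRingCat.of k))] [IsIntegral X] [IsIntegral Y] {π : Y ⟶ X}
  {p : X} {hp : IsClosed {p}}

theorem mem_globalSections_iff {D : CartierDivisor X} {s : X.functionField} :
    s ∈ globalSections k D ↔ ∀ i, ∀ x ∈ D.U i, s * D.f i ∈ (localRingAt x).toSubring :=
  forall_congr' fun _ => isRegularOn_iff

/-- The global sections of the pullback of a Cartier divisor by the blowing-up of a normal
point. -/
theorem IsBlowUpAt.mem_globalSections_pullback_iff (hπ : IsBlowUpAt π p hp) (hd : IsDominant π)
    (hgen : genericPoint X ≠ p) [IsNoetherianRing (X.presheaf.stalk p)]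
    [IsIntegrallyClosed (X.presheaf.stalk p)] (hm : maximalIdeal (X.presheaf.stalk p) ≠ ⊥)
    (D : CartierDivisor X) {s : X.functionField} :
    functionFieldMap π hd s ∈ globalSections k (D.pullback π hd) ↔ s ∈ globalSections k D := by
  refine ⟨fun h => mem_globalSections_iff.mpr fun i x hx => ?_,
    fun h i => by
      have := (h i).comp π hd
      rwa [map_mul] at this⟩
  rw [mem_globalSections_iff] at h
  have h1 : ∀ y, π y = x → functionFieldMap π hd (s * D.f i) ∈ (localRingAt y).toSubring := by
    rintro y rfl
    rw [map_mul]
    exact h i y hx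
  by_cases hxp : x = p
  · subst hxp
    exact hπ.mem_localRingAt_of_forall hd hgen hm h1
  · obtain ⟨y, hy, -⟩ := hπ.exists_of_ne hxp
    exact (hπ.functionFieldMap_mem_iff_of_eq hd hy hxp).mp (h1 y hy)

/-- The global sections of `π^* D - n E`, where `E` is the sum of the exceptional curves of the
blowing-up of a regular point. -/
theorem IsBlowUpAt.mem_globalSections_pullback_sub_iff (hπ : IsBlowUpAt π p hp)
    (hd : IsDominant π) (hgen : genericPoint X ≠ p) [IsNoetherianRing (X.presheaf.stalk p)]
    [IsIntegrallyClosed (X.presheaf.stalk p)] {u v : X.presheaf.stalk p}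
    (huv : IsParameterPair u v) (hvu : IsParameterPair v u) (D : CartierDivisor X)
    {E : CartierDivisor Y} (hE : IsSumOfExceptionalCurves π p hp E) (n : ℕ)
    {s : X.functionField} :
    functionFieldMap π hd s ∈ globalSections k (D.pullback π hd - n • E) ↔
      s ∈ sectionsOfMultiplicity k D p n := by
  have hEq : ∀ {j y}, y ∈ E.U j → IsLocalEquation hd p y (E.f j) :=
    fun hy => hπ.isLocalEquation hd huv hvu hE hy
  have key : ∀ i j, functionFieldMap π hd s * (functionFieldMap π hd (D.f i) / E.f j ^ n) =
      functionFieldMap π hd (s * D.f i) / E.f j ^ n := fun i j => by rw [map_mul, mul_div_assoc]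
  have hmem : functionFieldMap π hd s ∈ globalSections k (D.pullback π hd - n • E) ↔
      ∀ i j y, π y ∈ D.U i → y ∈ E.U j →
        functionFieldMap π hd (s * D.f i) / E.f j ^ n ∈ (localRingAt y).toSubring := by
    rw [mem_globalSections_iff]
    constructor
    · intro h i j y hi hj
      rw [← key]
      exact h (i, j) y ⟨hi, hj⟩
    · rintro h ⟨i, j⟩ y ⟨hi, hj⟩
      exact (key i j).symm ▸ h i j y hi hj
  rw [hmem]
  constructor
  · intro h
    have hvan : ∀ i, p ∈ D.U i → VanishesToOrder p n (s * D.f i) := by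
      intro i hi
      rw [hπ.vanishesToOrder_iff hd hgen huv]
      intro y hy e he
      obtain ⟨j, hj⟩ := E.cover y
      have h1 := h i j y (hy ▸ hi) hj
      have h2 := mul_mem h1 (pow_mem (he.div_mem_of_isGenerator ((hEq hj).isGenerator hy)) n)
      rwa [div_pow, div_mul_div_cancel₀ (pow_ne_zero n (E.ne_zero j))] at h2
    refine ⟨mem_globalSections_iff.mpr fun i x hx => ?_, hvan⟩
    by_cases hxp : x = p
    · subst hxp
      exact (hvan i hx).imp fun a ha => ha.2
    · obtain ⟨y, rfl, -⟩ := hπ.exists_of_ne hxp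
      obtain ⟨j, hj⟩ := E.cover y
      have h2 := mul_mem (h i j y hx hj) (pow_mem (hEq hj).mem n)
      rw [div_mul_cancel₀ _ (pow_ne_zero n (E.ne_zero j))] at h2
      exact (hπ.functionFieldMap_mem_iff hd hxp).mp h2
  · rintro ⟨h, hvan⟩ i j y hi hj
    by_cases hyp : π y = p
    · exact (hπ.vanishesToOrder_iff hd hgen huv).mp (hvan i (hyp ▸ hi)) y hyp _
        ((hEq hj).isGenerator hyp)
    · rw [div_eq_mul_inv, ← inv_pow]
      exact mul_mem ((hπ.functionFieldMap_mem_iff hd hyp).mpr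
        (mem_globalSections_iff.mp h i _ hi)) (pow_mem ((hEq hj).inv_mem hyp) n)

end GlobalSections

/-! ### Homogeneous components -/

section Homogeneous

theorem aeval_div_of_isHomogeneous {k K : Type*} [Field k] [Field K] [Algebra k K]
    {F : MvPolynomial (Fin 2) k} {n : ℕ} (hF : F.IsHomogeneous n) (a b : K) (e : K) :
    MvPolynomial.aeval ![a / e, b / e] F = MvPolynomial.aeval ![a, b] F / e ^ n := by
  rw [MvPolynomial.aeval_def, MvPolynomial.aeval_def, MvPolynomial.eval₂_eq',
    MvPolynomial.eval₂_eq', Finset.sum_div]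
  refine Finset.sum_congr rfl fun d hd => ?_
  have h : d 0 + d 1 = n := by
    have := hF (MvPolynomial.mem_support_iff.mp hd)
    rw [Finsupp.weight_apply, Finsupp.sum_fintype _ _ (by simp), Fin.sum_univ_two] at this
    simpa using this
  rw [Fin.prod_univ_two, Fin.prod_univ_two, mul_div_assoc, ← h, pow_add]
  simp [div_pow, div_mul_div_comm]

variable {k : Type u} [Field k] {X : Scheme.{u}} [X.Over (Spec (CommRingCat.of k))] {p : X}
  {u v : X.presheaf.stalk p}

theorem exists_sub_algebraMap_mem (hk : Function.Bijective (algebraMap k (X.residueField p)))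
    (a : X.presheaf.stalk p) :
    ∃ c : k, a - algebraMap k (X.presheaf.stalk p) c ∈ maximalIdeal (X.presheaf.stalk p) := by
  obtain ⟨c, hc⟩ := hk.2 ((X.residue p).hom a)
  exact ⟨c, (residue_eq_algebraMap_iff a).mp hc.symm⟩

theorem exists_isHomogeneousComponent [IsIntegral X]
    (hk : Function.Bijective (algebraMap k (X.residueField p)))
    (huv : maximalIdeal (X.presheaf.stalk p) = Ideal.span {u, v}) {n : ℕ} {g : X.functionField}
    (hg : VanishesToOrder p n g) : ∃ F, IsHomogeneousComponent k p u v n g F := by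
  obtain ⟨a, ha, rfl⟩ := hg
  have hum : u ∈ maximalIdeal (X.presheaf.stalk p) := huv ▸ Ideal.subset_span (by simp)
  have hvm : v ∈ maximalIdeal (X.presheaf.stalk p) := huv ▸ Ideal.subset_span (by simp)
  obtain ⟨c, hc⟩ := exists_sum_of_mem_span_pair_pow (u := u) (v := v) n a (huv ▸ ha)
  choose c' hc' using fun i => exists_sub_algebraMap_mem hk (c i)
  refine ⟨∑ i ∈ Finset.range (n + 1), MvPolynomial.C (c' i) *
    (MvPolynomial.X 0 ^ (n - i) * MvPolynomial.X 1 ^ i), ?_, a, rfl, ?_⟩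
  · refine MvPolynomial.IsHomogeneous.sum _ _ _ fun i hi => ?_
    have hi' : 0 + ((n - i) + i) = n := by
      have := Finset.mem_range.mp hi
      omega
    have h := (MvPolynomial.isHomogeneous_C (Fin 2) (c' i)).mul
      ((MvPolynomial.isHomogeneous_X_pow (R := k) (0 : Fin 2) (n - i)).mul
        (MvPolynomial.isHomogeneous_X_pow (1 : Fin 2) i))
    rwa [hi'] at h
  · rw [hc, map_sum, ← Finset.sum_sub_distrib]
    refine sum_mem fun i hi => ?_
    have hi' : (n - i) + i = n := by
      have := Finset.mem_range.mp hi
      omega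
    rw [map_mul, map_mul, map_pow, map_pow, MvPolynomial.aeval_C, MvPolynomial.aeval_X,
      MvPolynomial.aeval_X, Matrix.cons_val_zero, Matrix.cons_val_one,
      Matrix.cons_val_fin_one, ← sub_mul, pow_succ']
    refine Ideal.mul_mem_mul (hc' i) ?_
    rw [← hi', pow_add, hi']
    exact Ideal.mul_mem_mul (Ideal.pow_mem_pow hum _) (Ideal.pow_mem_pow hvm _)

end Homogeneous

/-! ### The points above a regular rational point -/

section Directions

variable {k : Type u} [Field k] {X Y : Scheme.{u}} [Y.Over (Spec (CommRingCat.of k))]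
  [IsIntegral X] [IsIntegral Y] {π : Y ⟶ X}
  {p : X} {hp : IsClosed {p}} {u v : X.presheaf.stalk p}

/-- The functions `u, v` are `w 0 * e, w 1 * e` to the first order at the point `y` above `p`, for
some local equation `e` of the inverse image of `p`. -/
def HasDirection (hd : IsDominant π) (u v : X.presheaf.stalk p) (y : Y) (w : Fin 2 → k) : Prop :=
  ∃ e, IsGenerator (localToFunctionField π hd p) (maximalIdeal (X.presheaf.stalk p))
    (localRingAt y).toSubring e ∧ HasValueAt k y (localToFunctionField π hd p u / e) (w 0) ∧
    HasValueAt k y (localToFunctionField π hd p v / e) (w 1)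

theorem HasDirection.symm {hd : IsDominant π} {y : Y} {w w' : Fin 2 → k}
    (h : HasDirection hd u v y w) (h0 : w' 0 = w 1) (h1 : w' 1 = w 0) :
    HasDirection hd v u y w' := by
  obtain ⟨e, he, hu, hv⟩ := h
  exact ⟨e, he, h0 ▸ hv, h1 ▸ hu⟩

theorem HasDirection.smul {hd : IsDominant π} {y : Y} {w : Fin 2 → k}
    (h : HasDirection hd u v y w) {c : k} (hc : c ≠ 0) : HasDirection hd u v y (c • w) := by
  obtain ⟨e, he, hu, hv⟩ := h
  have hc0 : algebraMap k Y.functionField c ≠ 0 := (map_ne_zero _).mpr hc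
  have key : ∀ z, z / (e / algebraMap k Y.functionField c) = c • (z / e) := by
    intro z
    rw [Algebra.smul_def, div_div_eq_mul_div, mul_comm, mul_div_assoc]
  refine ⟨e / algebraMap k Y.functionField c, he.of_div_mem (div_ne_zero he.ne_zero hc0) ?_ ?_,
    ?_, ?_⟩
  · rw [div_div_cancel₀ he.ne_zero]
    exact (hasValueAt_algebraMap y c).mem
  · rw [div_div, mul_comm, ← div_div, div_self he.ne_zero, one_div, ← map_inv₀]
    exact (hasValueAt_algebraMap y c⁻¹).mem
  · rw [key]
    exact hu.smul c
  · rw [key]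
    exact hv.smul c

theorem HasDirection.hasValueAt_div {hd : IsDominant π} {y : Y} {w : Fin 2 → k}
    (h : HasDirection hd u v y w) (hw : w 0 ≠ 0) :
    HasValueAt k y (localToFunctionField π hd p v / localToFunctionField π hd p u)
      (w 1 * (w 0)⁻¹) := by
  obtain ⟨e, he, hu, hv⟩ := h
  have := hv.mul (hu.inv hw)
  rwa [inv_div, div_mul_div_cancel₀ he.ne_zero] at this

theorem HasDirection.exists_smul_eq {hd : IsDominant π} {y : Y}
    (hy : Function.Bijective (algebraMap k (Y.residueField y))) {w w' : Fin 2 → k}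
    (h : HasDirection hd u v y w) (h' : HasDirection hd u v y w') : ∃ a : kˣ, a • w = w' := by
  obtain ⟨e, he, hu, hv⟩ := h
  obtain ⟨e', he', hu', hv'⟩ := h'
  obtain ⟨a, ha⟩ := exists_units_hasValueAt hy (div_ne_zero he.ne_zero he'.ne_zero)
    (he'.div_mem_of_isGenerator he) (by
      rw [inv_div]
      exact he.div_mem_of_isGenerator he')
  refine ⟨a, ?_⟩
  have key : ∀ {z c c'}, HasValueAt k y (z / e) c → HasValueAt k y (z / e') c' →
      (a : k) * c = c' := by
    intro z c c' h h'
    have := h.mul ha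
    rw [div_mul_div_cancel₀ he.ne_zero] at this
    rw [mul_comm]
    exact this.eq h'
  ext i
  fin_cases i
  · exact key hu hu'
  · exact key hv hv'

theorem IsBlowUpAt.exists_hasDirection (hπ : IsBlowUpAt π p hp) (hd : IsDominant π)
    (huv : maximalIdeal (X.presheaf.stalk p) = Ideal.span {u, v}) {y : Y} (hyp : π y = p)
    (hy : Function.Bijective (algebraMap k (Y.residueField y))) :
    ∃ w : Fin 2 → k, w ≠ 0 ∧ HasDirection hd u v y w := by
  have hum : u ∈ maximalIdeal (X.presheaf.stalk p) := huv ▸ Ideal.subset_span (by simp)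
  have hvm : v ∈ maximalIdeal (X.presheaf.stalk p) := huv ▸ Ideal.subset_span (by simp)
  obtain ⟨e, he⟩ := hπ.exists_isGenerator hd hyp
  have hval := bijective_algebraMap_residueField_iff.mp hy
  obtain ⟨a, ha⟩ := hval _ (he.div_mem u hum)
  obtain ⟨b, hb⟩ := hval _ (he.div_mem v hvm)
  refine ⟨![a, b], fun h0 => ?_, e, he, ha, hb⟩
  obtain rfl : a = 0 := congrFun h0 0
  obtain rfl : b = 0 := congrFun h0 1
  have hφ := localToFunctionField_injective hd p
  rcases exists_isUnit_div_of_isGenerator huv (localToFunctionField_mem hd hyp) he with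
    ⟨h1, h2⟩ | ⟨h1, h2⟩
  · exact (hasValueAt_zero_iff.mp ha).2 (div_ne_zero ((map_ne_zero_iff _ hφ).mpr h1) he.ne_zero)
      (by rwa [inv_div])
  · exact (hasValueAt_zero_iff.mp hb).2 (div_ne_zero ((map_ne_zero_iff _ hφ).mpr h1) he.ne_zero)
      (by rwa [inv_div])

variable [X.Over (Spec (CommRingCat.of k))] [π.IsOver (Spec (CommRingCat.of k))]

theorem hasValueAt_localToFunctionField (hd : IsDominant π) {y : Y} (hy : π y = p)
    {a : X.presheaf.stalk p} {c : k}
    (h : a - algebraMap k (X.presheaf.stalk p) c ∈ maximalIdeal (X.presheaf.stalk p)) :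
    HasValueAt k y (localToFunctionField π hd p a) c :=
  (hasValueAt_functionFieldMap_iff hd hy ⟨a, rfl⟩).mpr (hasValueAt_iff.mpr ⟨a, rfl, h⟩)

theorem IsBlowUpAt.eq_of_hasValueAt (hπ : IsBlowUpAt π p hp) (hd : IsDominant π)
    (hk : Function.Bijective (algebraMap k (X.residueField p)))
    (huv : maximalIdeal (X.presheaf.stalk p) = Ideal.span {u, v}) (hu : u ≠ 0) {y y' : Y}
    (hy : π y = p) (hy' : π y' = p) {b : k}
    (h : HasValueAt k y (localToFunctionField π hd p v / localToFunctionField π hd p u) b)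
    (h' : HasValueAt k y' (localToFunctionField π hd p v / localToFunctionField π hd p u) b) :
    y = y' := by
  have hφ := localToFunctionField_injective hd p
  have hval : ∀ z ∈ chart (localToFunctionField π hd p) u v,
      ∃ c : k, HasValueAt k y z c ∧ HasValueAt k y' z c := by
    rintro _ ⟨P, rfl⟩
    induction P using Polynomial.induction_on' with
    | add P Q hP hQ =>
      obtain ⟨c, hc, hc'⟩ := hP
      obtain ⟨d, hd, hd'⟩ := hQ
      exact ⟨c + d, by rw [map_add]; exact hc.add hd, by rw [map_add]; exact hc'.add hd'⟩
    | monomial n a =>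
      obtain ⟨c, hc⟩ := exists_sub_algebraMap_mem hk a
      refine ⟨c * b ^ n, ?_⟩
      rw [Polynomial.coe_eval₂RingHom, Polynomial.eval₂_monomial]
      exact ⟨(hasValueAt_localToFunctionField hd hy hc).mul (h.pow n),
        (hasValueAt_localToFunctionField hd hy' hc).mul (h'.pow n)⟩
  have hle := chart_le (localToFunctionField_mem hd hy) h.mem
  have hle' := chart_le (localToFunctionField_mem hd hy') h'.mem
  obtain ⟨q, hq, hqy, hqmem⟩ := exists_ofPrime_le (localRingAt y) hle
  obtain ⟨q', hq', hqy', hqmem'⟩ := exists_ofPrime_le (localRingAt y') hle'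
  have key : ∀ {y : Y} {z : Y.functionField} (hz : z ∈ (localRingAt y).toSubring) {c : k},
      HasValueAt k y z c → (¬ IsUnit (⟨z, hz⟩ : (localRingAt y).toSubring) ↔ c = 0) := by
    intro y z hz c hc
    rw [isUnit_subring_iff, not_and]
    constructor
    · intro h0
      exact hc.eq (hasValueAt_zero_iff.mpr ⟨hz, h0⟩)
    · rintro rfl
      exact (hasValueAt_zero_iff.mp hc).2
  obtain rfl : q = q' := by
    ext z
    obtain ⟨c, hc, hc'⟩ := hval z z.2
    rw [hqmem, hqmem', key (hle z.2) hc, key (hle' z.2) hc']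
  have hS : ∀ r, localToFunctionField π hd p r ∈ (LocalSubring.ofPrime _ q).toSubring :=
    fun r => LocalSubring.le_ofPrime _ q (map_mem_chart r)
  obtain ⟨y₀, hy₀, hle₀⟩ := hπ.exists_localRingAt_le hd _ hS (fun r hr hu => by
      rw [isUnit_subring_iff] at hu
      refine inv_localToFunctionField_notMem hd hy hr (fun h0 => hu.1 ?_) (hqy.1 hu.2)
      rw [h0, map_zero])
    (isGenerator_of_div_mem hφ huv hu hS (LocalSubring.le_ofPrime _ q div_mem_chart))
  rw [← hπ.eq_of_localRingAt_le hd hy₀ hy (hle₀.trans hqy),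
    ← hπ.eq_of_localRingAt_le hd hy₀ hy' (hle₀.trans hqy')]

/-- A point above `p` is determined by its direction. -/
theorem IsBlowUpAt.eq_of_hasDirection (hπ : IsBlowUpAt π p hp) (hd : IsDominant π)
    (hk : Function.Bijective (algebraMap k (X.residueField p))) (huv : IsParameterPair u v)
    (hvu : IsParameterPair v u) {y y' : Y} (hy : π y = p) (hy' : π y' = p) {w : Fin 2 → k}
    (hw : w ≠ 0) (h : HasDirection hd u v y w) (h' : HasDirection hd u v y' w) : y = y' := by
  by_cases h0 : w 0 = 0
  · have h1 : w 1 ≠ 0 := fun h1 => hw (by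
      ext i
      fin_cases i
      · exact h0
      · exact h1)
    have key : ∀ {y}, HasDirection hd u v y w → HasDirection hd v u y ![w 1, w 0] :=
      fun h => h.symm rfl rfl
    exact hπ.eq_of_hasValueAt hd hk hvu.span_eq hvu.ne_zero hy hy'
      ((key h).hasValueAt_div h1) ((key h').hasValueAt_div h1)
  · exact hπ.eq_of_hasValueAt hd hk huv.span_eq huv.ne_zero hy hy'
      (h.hasValueAt_div h0) (h'.hasValueAt_div h0)

theorem IsBlowUpAt.exists_hasValueAt (hπ : IsBlowUpAt π p hp) (hd : IsDominant π)
    (hk : Function.Bijective (algebraMap k (X.residueField p))) (huv : IsParameterPair u v)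
    (b : k) : ∃ y : RationalPoint k Y, π y.1 = p ∧ HasDirection hd u v y.1 ![1, b] := by
  have hφ := localToFunctionField_injective hd p
  let ε : X.presheaf.stalk p →+* k :=
    ((RingEquiv.ofBijective (algebraMap k (X.residueField p)) hk).symm : _ →+* k).comp
      (X.residue p).hom
  have hε : ∀ a c, a - algebraMap k (X.presheaf.stalk p) c ∈
      maximalIdeal (X.presheaf.stalk p) → ε a = c := by
    intro a c h
    change (RingEquiv.ofBijective (algebraMap k (X.residueField p)) hk).symm
      ((X.residue p).hom a) = c
    rw [RingEquiv.symm_apply_eq]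
    exact (residue_eq_algebraMap_iff a).mpr h
  obtain ⟨χ, hχ, hχb⟩ := huv.exists_ringHom hφ ε (fun r hr => hε r 0 (by simpa using hr)) b
  have hq : (RingHom.ker χ).IsPrime := RingHom.ker_isPrime χ
  have hle := LocalSubring.le_ofPrime _ (RingHom.ker χ)
  have hS : ∀ r, localToFunctionField π hd p r ∈
      (LocalSubring.ofPrime _ (RingHom.ker χ)).toSubring := fun r => hle (map_mem_chart r)
  have hgen := isGenerator_of_div_mem hφ huv.span_eq huv.ne_zero hS (hle div_mem_chart)
  obtain ⟨y, hy, hyle⟩ := hπ.exists_localRingAt_le hd _ hS (fun r hr hu => by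
      obtain ⟨h0, h1⟩ := (isUnit_subring_iff _).mp hu
      refine (inv_mem_ofPrime_iff (a := ⟨_, map_mem_chart r⟩)
        fun h2 => h0 (congrArg Subtype.val h2)).mp h1 ?_
      rw [RingHom.mem_ker, hχ]
      exact hε r 0 (by simpa using hr)) hgen
  obtain ⟨e, he⟩ := hπ.exists_isGenerator hd hy
  have hyS := huv.eq_ofPrime_of_le hφ _ (localToFunctionField_mem hd hy) he hyle
  have hval : ∀ z : chart (localToFunctionField π hd p) u v, HasValueAt k y z (χ z) := by
    intro z
    have h1 : χ ⟨_, map_mem_chart (algebraMap k (X.presheaf.stalk p) (χ z))⟩ = χ z := by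
      rw [hχ]
      exact hε _ _ (by simp)
    have h2 : z - ⟨_, map_mem_chart (algebraMap k (X.presheaf.stalk p) (χ z))⟩ ∈
        RingHom.ker χ := by
      rw [RingHom.mem_ker, map_sub, h1, sub_self]
    have h3 : HasValueAt k y ((z - ⟨_, map_mem_chart (algebraMap k (X.presheaf.stalk p) (χ z))⟩ :
        chart (localToFunctionField π hd p) u v) : Y.functionField) 0 := by
      rw [hasValueAt_zero_iff, hyS]
      exact ⟨hle (Subtype.property _), fun h0 h =>
        (inv_mem_ofPrime_iff fun h4 => h0 (congrArg Subtype.val h4)).mp h h2⟩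
    have h4 := h3.add (hasValueAt_localToFunctionField hd hy
      (a := algebraMap k (X.presheaf.stalk p) (χ z)) (c := χ z) (by simp))
    rw [zero_add] at h4
    convert h4 using 1
    exact (sub_add_cancel _ _).symm
  have hrat : Function.Bijective (algebraMap k (Y.residueField y)) := by
    rw [bijective_algebraMap_residueField_iff]
    intro g hg
    rw [hyS, mem_ofPrime_iff] at hg
    obtain ⟨a, s, hs, rfl⟩ := hg
    rw [div_eq_mul_inv]
    exact ⟨_, (hval a).mul ((hval s).inv hs)⟩
  refine ⟨⟨y, hrat⟩, hy, localToFunctionField π hd p u, ?_, ?_, ?_⟩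
  · rw [hyS]
    exact hgen
  · rw [div_self hgen.ne_zero]
    exact hasValueAt_one
  · have := hval ⟨_, div_mem_chart⟩
    rwa [hχb] at this

/-- Every direction is the direction of a rational point. -/
theorem IsBlowUpAt.exists_rationalPoint_hasDirection (hπ : IsBlowUpAt π p hp) (hd : IsDominant π)
    (hk : Function.Bijective (algebraMap k (X.residueField p))) (huv : IsParameterPair u v)
    (hvu : IsParameterPair v u) (w : Fin 2 → k) (hw : w ≠ 0) :
    ∃ y : RationalPoint k Y, π y.1 = p ∧ HasDirection hd u v y.1 w := by
  by_cases h0 : w 0 = 0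
  · have h1 : w 1 ≠ 0 := fun h1 => hw (by
      ext i
      fin_cases i
      · exact h0
      · exact h1)
    obtain ⟨y, hy, h⟩ := hπ.exists_hasValueAt hd hk hvu 0
    exact ⟨y, hy, (h.smul h1).symm (by simp [h0]) (by simp)⟩
  · obtain ⟨y, hy, h⟩ := hπ.exists_hasValueAt hd hk huv (w 1 * (w 0)⁻¹)
    refine ⟨y, hy, ?_⟩
    convert h.smul h0 using 1
    ext i
    fin_cases i
    · simp
    · simp [mul_comm (w 1), h0]

/-- The value of a function of multiplicity at least `n` at the point of given direction. -/
theorem IsHomogeneousComponent.hasValueAt (hd : IsDominant π) {n : ℕ} {g : X.functionField}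
    {F : MvPolynomial (Fin 2) k} (hF : IsHomogeneousComponent k p u v n g F) {y : Y}
    (hy : π y = p) {e : Y.functionField}
    (he : IsGenerator (localToFunctionField π hd p) (maximalIdeal (X.presheaf.stalk p))
      (localRingAt y).toSubring e) {w : Fin 2 → k}
    (hu : HasValueAt k y (localToFunctionField π hd p u / e) (w 0))
    (hv : HasValueAt k y (localToFunctionField π hd p v / e) (w 1)) :
    HasValueAt k y (functionFieldMap π hd g / e ^ n) (MvPolynomial.eval w F) := by
  obtain ⟨hF, a, rfl, ha⟩ := hF
  have hφ := localToFunctionField_mem hd hy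
  have h1 : localToFunctionField π hd p (MvPolynomial.aeval ![u, v] F) =
      MvPolynomial.aeval ![localToFunctionField π hd p u, localToFunctionField π hd p v] F := by
    let f : X.presheaf.stalk p →ₐ[k] Y.functionField :=
      { localToFunctionField π hd p with
        commutes' := fun c => (congrArg _ (algebraMap_stalk_functionField p c)).trans
          (functionFieldMap_algebraMap hd c) }
    refine (MvPolynomial.comp_aeval_apply ![u, v] f F).trans ?_
    congr 2
    ext i
    fin_cases i <;> rfl
  have h2 : HasValueAt k y e 0 := by
    have hloc := IsLocalEquation.of_isGenerator hy he
    exact hasValueAt_zero_iff.mpr ⟨hloc.mem, fun _ h => hloc.inv_mem_iff.mp h hy⟩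
  have h3 := (hu.aeval hv F).add (h2.mul_mem (he.div_pow_mem hφ (n + 1) _ ha))
  rw [add_zero, aeval_div_of_isHomogeneous hF, ← h1, map_sub, pow_succ, div_mul_eq_mul_div,
    mul_div_mul_right _ _ he.ne_zero, ← add_div, add_sub_cancel] at h3
  exact h3

end Directions

/-! ### Equivalence of codes -/

section Codes

variable {k : Type u} [Field k] {X Y : Scheme.{u}} [Y.Over (Spec (CommRingCat.of k))]
  [IsIntegral X] [IsIntegral Y] {π : Y ⟶ X} {p : X} {hp : IsClosed {p}} {u v : X.presheaf.stalk p}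

theorem CartierDivisor.div_mem (D : CartierDivisor X) {x : X} {i j : D.ι} (hi : x ∈ D.U i)
    (hj : x ∈ D.U j) : D.f i / D.f j ∈ (localRingAt x).toSubring :=
  isRegularOn_iff.mp (D.compat i j) x ⟨hi, hj⟩

/-- The local equations of the pullback of a Cartier divisor at a point are the compositions of
its local equations with `π`, up to an invertible function. -/
theorem CartierDivisor.exists_hasValueAt_pullback (D : CartierDivisor X) (hd : IsDominant π)
    (y : RationalPoint k Y) {x : X} (hy : π y.1 = x) {i : D.ι} (hi : x ∈ D.U i) :
    ∃ a : kˣ, HasValueAt k y.1 (functionFieldMap π hd (D.f i) /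
      functionFieldMap π hd (D.f (D.index x))) a := by
  subst hy
  have hmem : ∀ {i j}, π y.1 ∈ D.U i → π y.1 ∈ D.U j →
      functionFieldMap π hd (D.f i) / functionFieldMap π hd (D.f j) ∈
        (localRingAt y.1).toSubring := fun {i j} hi hj => by
    rw [← map_div₀]
    obtain ⟨a, ha⟩ := D.div_mem hi hj
    rw [← ha]
    exact ⟨_, algebraMap_stalkMap π hd y.1 a⟩
  refine exists_units_hasValueAt y.2 (div_ne_zero ((map_ne_zero _).mpr (D.ne_zero _))
    ((map_ne_zero _).mpr (D.ne_zero _))) (hmem hi (D.mem_index _)) ?_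
  rw [inv_div]
  exact hmem (D.mem_index _) hi

/-- A comparison of the local equations of `π^* D - n E` with those of `D`. -/
theorem IsBlowUpAt.exists_hasValueAt_pullback_sub (hπ : IsBlowUpAt π p hp) (hd : IsDominant π)
    (huv : IsParameterPair u v) (hvu : IsParameterPair v u) (D : CartierDivisor X)
    {E : CartierDivisor Y} (hE : IsSumOfExceptionalCurves π p hp E) (n : ℕ)
    (y : RationalPoint k Y) {x : X} (hy : π y.1 = x) {e : Y.functionField}
    (he : IsLocalEquation hd p y.1 e) :
    ∃ a : kˣ, HasValueAt k y.1 ((D.pullback π hd - n • E).f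
      ((D.pullback π hd - n • E).index y.1) /
        (functionFieldMap π hd (D.f (D.index x)) / e ^ n)) a := by
  obtain ⟨i, j, hi, hj, hij⟩ : ∃ i j, π y.1 ∈ D.U i ∧ y.1 ∈ E.U j ∧
      (D.pullback π hd - n • E).f ((D.pullback π hd - n • E).index y.1) =
        functionFieldMap π hd (D.f i) / E.f j ^ n :=
    ⟨_, _, ((D.pullback π hd - n • E).mem_index y.1).1,
      ((D.pullback π hd - n • E).mem_index y.1).2, rfl⟩
  have hEj := hπ.isLocalEquation hd huv hvu hE hj
  obtain ⟨a, ha⟩ := D.exists_hasValueAt_pullback hd y hy (hy ▸ hi)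
  obtain ⟨b, hb⟩ := exists_units_hasValueAt y.2 (div_ne_zero he.ne_zero hEj.ne_zero)
    (he.div_mem hEj) (by
      rw [inv_div]
      exact hEj.div_mem he)
  refine ⟨a * b ^ n, ?_⟩
  rw [hij, Units.val_mul, Units.val_pow_eq_pow_val]
  convert ha.mul (hb.pow n) using 1
  rw [div_pow, div_div_div_eq, div_mul_div_comm, mul_comm (E.f j ^ n)]

variable [X.Over (Spec (CommRingCat.of k))] [π.IsOver (Spec (CommRingCat.of k))]

/-- If the global sections of `D'` are those of `V`, and if `D'` is equivalent to the pullback of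
`D` at the rational points, then the codes of `D'` and of `V` are equivalent. -/
theorem IsBlowUpAt.equivalentVia_codeOfSections (hπ : IsBlowUpAt π p hp) (hd : IsDominant π)
    (hgen : genericPoint X ≠ p) (D : CartierDivisor X) (D' : CartierDivisor Y)
    (V : Submodule k X.functionField)
    (hV : ∀ s, functionFieldMap π hd s ∈ globalSections k D' ↔ s ∈ V)
    (e : RationalPoint k Y ≃ RationalPoint k X) (he : ∀ y, π y.1 = (e y).1)
    (hne : ∀ x : RationalPoint k X, x.1 ≠ p)
    (hr : ∀ y : RationalPoint k Y, ∃ a : kˣ, HasValueAt k y.1 (D'.f (D'.index y.1) /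
      functionFieldMap π hd (D.f (D.index (e y).1))) a) :
    EquivalentVia e (evaluationCode k D' id) (codeOfSections k D id V) := by
  choose a ha using hr
  have key : ∀ (s : X.functionField) (y : RationalPoint k Y) (c : k),
      HasValueAt k y.1 (functionFieldMap π hd s * D'.f (D'.index y.1)) (a y * c) ↔
        HasValueAt k (e y).1 (s * D.f (D.index (e y).1)) c := by
    intro s y c
    rw [← hπ.hasValueAt_iff hd (he y) (hne _), ← (ha y).mul_iff (a y).ne_zero
      (g := functionFieldMap π hd (s * D.f (D.index (e y).1))), map_mul, mul_assoc,
      mul_div_cancel₀ _ ((map_ne_zero _).mpr (D.ne_zero _))]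
  refine ⟨a, fun w => ⟨?_, ?_⟩⟩
  · rintro ⟨s, hs, hw⟩
    exact ⟨_, (hV s).mpr hs, fun y => (key s y _).mpr (hw (e y))⟩
  · rintro ⟨t, ht, hw⟩
    obtain ⟨s, rfl⟩ := hπ.functionFieldMap_surjective hd hgen t
    refine ⟨s, (hV s).mp ht, fun x => ?_⟩
    obtain ⟨y, rfl⟩ := e.surjective x
    exact (key s y _).mp (hw y)

/-- If `p` is not rational, the rational points of the blowing-up are those of `X`. -/
theorem IsBlowUpAt.exists_rationalPoint_equiv (hπ : IsBlowUpAt π p hp) (hd : IsDominant π)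
    (hgen : genericPoint X ≠ p) (hne : ∀ x : RationalPoint k X, x.1 ≠ p) :
    ∃ e : RationalPoint k Y ≃ RationalPoint k X, ∀ y, π y.1 = (e y).1 := by
  let f : RationalPoint k Y → RationalPoint k X := fun y =>
    ⟨π y.1, bijective_algebraMap_residueField_map hd rfl y.2⟩
  refine ⟨Equiv.ofBijective f ⟨fun y y' h => ?_, fun x => ?_⟩, fun y => rfl⟩
  · exact Subtype.ext (hπ.eq_of_map_eq (hne (f y)) rfl (congrArg Subtype.val h).symm)
  · obtain ⟨y, hy⟩ := hπ.exists_rationalPoint hd hgen x (hne x)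
    exact ⟨y, Subtype.ext hy⟩

/-- The rational points of the blowing-up of a regular rational point. -/
theorem IsBlowUpAt.exists_rationalPoint_equiv_sum (hπ : IsBlowUpAt π p hp) (hd : IsDominant π)
    (hgen : genericPoint X ≠ p) (hk : Function.Bijective (algebraMap k (X.residueField p)))
    (huv : IsParameterPair u v) (hvu : IsParameterPair v u) :
    ∃ e : RationalPoint k Y ≃
        {x : RationalPoint k X // x.1 ≠ p} ⊕ Projectivization k (Fin 2 → k),
      (∀ x, π (e.symm (Sum.inl x)).1 = x.1.1) ∧ (∀ t, π (e.symm (Sum.inr t)).1 = p) ∧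
      ∀ t, HasDirection hd u v (e.symm (Sum.inr t)).1 t.rep := by
  choose f hf using fun x : {x : RationalPoint k X // x.1 ≠ p} =>
    hπ.exists_rationalPoint hd hgen x.1 x.2
  choose f' hf' hdir using fun t : Projectivization k (Fin 2 → k) =>
    hπ.exists_rationalPoint_hasDirection hd hk huv hvu t.rep t.rep_nonzero
  have hbij : Function.Bijective (Sum.elim f f') := by
    constructor
    · rintro (x | t) (x' | t') h
      · have h1 : x.1.1 = x'.1.1 := by
          rw [← hf x, ← hf x']
          exact congrArg (fun y => π y.1) h
        exact congrArg Sum.inl (Subtype.ext (Subtype.ext h1))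
      · refine absurd ?_ x.2
        rw [← hf x, ← hf' t']
        exact congrArg (fun y => π y.1) h
      · refine absurd ?_ x'.2
        rw [← hf x', ← hf' t]
        exact congrArg (fun y => π y.1) h.symm
      · have h1 : f' t = f' t' := h
        obtain ⟨a, ha⟩ := (hdir t').exists_smul_eq (f' t').2 (h1 ▸ hdir t)
        rw [← t.mk_rep, ← t'.mk_rep]
        exact congrArg Sum.inr ((Projectivization.mk_eq_mk_iff k _ _ _ _).mpr ⟨a, ha⟩)
    · intro y
      by_cases hy : π y.1 = p
      · obtain ⟨w, hw, hyw⟩ := hπ.exists_hasDirection hd huv.span_eq hy y.2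
        obtain ⟨a, ha⟩ := Projectivization.exists_smul_eq_mk_rep k w hw
        have h1 := hyw.smul a.ne_zero
        refine ⟨Sum.inr (Projectivization.mk k w hw), Subtype.ext ?_⟩
        refine hπ.eq_of_hasDirection hd hk huv hvu (hf' _) hy
          (Projectivization.rep_nonzero _) (hdir _) ?_
        rw [← ha]
        exact h1
      · refine ⟨Sum.inl ⟨⟨π y.1, bijective_algebraMap_residueField_map hd rfl y.2⟩, hy⟩,
          Subtype.ext ?_⟩
        exact hπ.eq_of_map_eq hy (hf _) rfl
  exact ⟨(Equiv.ofBijective _ hbij).symm, hf, hf', hdir⟩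

/-- The code of `π^* D - n E` on the blowing-up of a regular rational point. -/
theorem IsBlowUpAt.equivalentVia_extendedCode (hπ : IsBlowUpAt π p hp) (hd : IsDominant π)
    (hgen : genericPoint X ≠ p) (hk : Function.Bijective (algebraMap k (X.residueField p)))
    [IsNoetherianRing (X.presheaf.stalk p)] [IsIntegrallyClosed (X.presheaf.stalk p)]
    (huv : IsParameterPair u v) (hvu : IsParameterPair v u) (D : CartierDivisor X)
    {E : CartierDivisor Y} (hE : IsSumOfExceptionalCurves π p hp E) (n : ℕ)
    (e : RationalPoint k Y ≃
      {x : RationalPoint k X // x.1 ≠ p} ⊕ Projectivization k (Fin 2 → k))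
    (he : ∀ x, π (e.symm (Sum.inl x)).1 = x.1.1) (he' : ∀ t, π (e.symm (Sum.inr t)).1 = p)
    (hdir : ∀ t, HasDirection hd u v (e.symm (Sum.inr t)).1 t.rep) :
    EquivalentVia e (evaluationCode k (D.pullback π hd - n • E) id)
      (extendedCode k D p u v n) := by
  have hV := fun s => hπ.mem_globalSections_pullback_sub_iff (k := k) hd hgen huv hvu D hE n
    (s := s)
  have hscal := fun y {x} hy {e} he =>
    hπ.exists_hasValueAt_pullback_sub (k := k) hd huv hvu D hE n y (x := x) hy (e := e) he
  set D' := D.pullback π hd - n • E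
  have h0 : ∀ i, functionFieldMap π hd (D.f i) ≠ 0 := fun i => (map_ne_zero _).mpr (D.ne_zero i)
  choose a ha using fun x => hscal (e.symm (Sum.inl x)) (he x)
    (IsLocalEquation.one (fun h => x.2 ((he x).symm.trans h)))
  choose ε hε hu hv using hdir
  choose b hb using fun t => hscal (e.symm (Sum.inr t)) (he' t)
    (IsLocalEquation.of_isGenerator (he' t) (hε t))
  have hinl : ∀ s x c, HasValueAt k (e.symm (Sum.inl x)).1
      (functionFieldMap π hd s * D'.f (D'.index (e.symm (Sum.inl x)).1)) (a x * c) ↔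
        HasValueAt k x.1.1 (s * D.f (D.index x.1.1)) c := by
    intro s x c
    rw [← hπ.hasValueAt_iff hd (he x) x.2, ← (ha x).mul_iff (a x).ne_zero
      (g := functionFieldMap π hd (s * D.f (D.index x.1.1))), map_mul, one_pow, div_one, mul_assoc,
      mul_div_cancel₀ _ (h0 _)]
  have hinr : ∀ s t c, HasValueAt k (e.symm (Sum.inr t)).1
      (functionFieldMap π hd s * D'.f (D'.index (e.symm (Sum.inr t)).1)) (b t * c) ↔
        HasValueAt k (e.symm (Sum.inr t)).1
          (functionFieldMap π hd (s * D.f (D.index p)) / ε t ^ n) c := by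
    intro s t c
    rw [← (hb t).mul_iff (b t).ne_zero
      (g := functionFieldMap π hd (s * D.f (D.index p)) / ε t ^ n), map_mul, mul_div_assoc,
      mul_assoc, mul_div_cancel₀ _ (div_ne_zero (h0 _) (pow_ne_zero n (hε t).ne_zero))]
  have hall : ∀ (s : X.functionField)
      (w : {x : RationalPoint k X // x.1 ≠ p} ⊕ Projectivization k (Fin 2 → k) → k),
      (∀ y : RationalPoint k Y, HasValueAt k y.1 (functionFieldMap π hd s * D'.f (D'.index y.1))
        ((Sum.elim a b (e y) : kˣ) * w (e y))) ↔
      (∀ x, HasValueAt k x.1.1 (s * D.f (D.index x.1.1)) (w (Sum.inl x))) ∧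
      ∀ t, HasValueAt k (e.symm (Sum.inr t)).1
          (functionFieldMap π hd (s * D.f (D.index p)) / ε t ^ n) (w (Sum.inr t)) := by
    intro s w
    simp only [e.symm.surjective.forall, Sum.forall, Equiv.apply_symm_apply, Sum.elim_inl,
      Sum.elim_inr, hinl, hinr]
  refine ⟨fun y => Sum.elim a b (e y), fun w => ⟨?_, ?_⟩⟩
  · rintro ⟨s, hs, hw, F, hF, hwF⟩
    refine ⟨_, (hV s).mpr hs, (hall s w).mpr ⟨hw, fun t => ?_⟩⟩
    rw [hwF]
    exact hF.hasValueAt hd (he' t) (hε t) (hu t) (hv t)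
  · rintro ⟨t, ht, hw⟩
    obtain ⟨s, rfl⟩ := hπ.functionFieldMap_surjective hd hgen t
    have hs := (hV s).mp ht
    obtain ⟨F, hF⟩ := exists_isHomogeneousComponent hk huv.span_eq (hs.2 _ (D.mem_index p))
    obtain ⟨h1, h2⟩ := (hall s w).mp hw
    exact ⟨s, hs, h1, F, hF, fun t =>
      (h2 t).eq (hF.hasValueAt hd (he' t) (hε t) (hu t) (hv t))⟩

end Codes

end BlowUpCode

theorem mainTheorem10 {k : Type u} [Field k] [Finite k] {X Y : Scheme.{u}}
    [X.Over (Spec (CommRingCat.of k))] [Y.Over (Spec (CommRingCat.of k))]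
    [IsIntegral X] [IsIntegral Y] (hX : IsNormalSurface k X)
    (p : X) (hp : IsClosed {p}) (π : Y ⟶ X) [π.IsOver (Spec (CommRingCat.of k))]
    (hπ : IsBlowUpAt π p hp) (D : CartierDivisor X) :
    (1 < degree k X p →
      ∃ e : RationalPoint k Y ≃ RationalPoint k X, (∀ y, π y.1 = (e y).1) ∧
        EquivalentVia e
          (evaluationCode k (D.pullback π (hπ.isDominant hX.dim_eq_two)) id)
          (evaluationCode k D id) ∧
        (IsRegularLocalRing (X.presheaf.stalk p) →
          ∀ E : CartierDivisor Y, IsSumOfExceptionalCurves π p hp E → ∀ n : ℕ,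
            EquivalentVia e
              (evaluationCode k (D.pullback π (hπ.isDominant hX.dim_eq_two) - n • E) id)
              (codeOfSections k D id (sectionsOfMultiplicity k D p n)))) ∧
    (degree k X p = 1 → IsRegularLocalRing (X.presheaf.stalk p) →
      ∀ u v : X.presheaf.stalk p,
        IsLocalRing.maximalIdeal (X.presheaf.stalk p) = Ideal.span {u, v} →
        ∃ e : RationalPoint k Y ≃
            {x : RationalPoint k X // x.1 ≠ p} ⊕ Projectivization k (Fin 2 → k),
          (∀ x, π (e.symm (Sum.inl x)).1 = x.1.1) ∧ (∀ t, π (e.symm (Sum.inr t)).1 = p) ∧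
          ∀ E : CartierDivisor Y, IsSumOfExceptionalCurves π p hp E → ∀ n : ℕ,
            EquivalentVia e
              (evaluationCode k (D.pullback π (hπ.isDominant hX.dim_eq_two) - n • E) id)
              (extendedCode k D p u v n)) ∧
    (IsRegularLocalRing (X.presheaf.stalk p) →
      ∃ E : CartierDivisor Y, IsSumOfExceptionalCurves π p hp E) := by
  have hd := hπ.isDominant hX.dim_eq_two
  have := hX.locallyOfFiniteType
  have := hX.normal p
  have : IsLocallyNoetherian X :=
    LocallyOfFiniteType.isLocallyNoetherian (X ↘ Spec (CommRingCat.of k))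
  have hdim : ringKrullDim (X.presheaf.stalk p) = 2 :=
    (ringKrullDim_stalk_eq_topologicalKrullDim (k := k) hp).trans hX.dim_eq_two
  have hnf : ¬ IsField (X.presheaf.stalk p) := fun h => by
    rw [ringKrullDim_eq_zero_of_isField h] at hdim
    exact absurd hdim (by decide)
  have hm : IsLocalRing.maximalIdeal (X.presheaf.stalk p) ≠ ⊥ := fun h =>
    hnf (IsLocalRing.isField_iff_maximalIdeal_eq.mpr h)
  have hgen : genericPoint X ≠ p := by
    rintro rfl
    exact hnf (Field.toIsField X.functionField)
  have hpair : ∀ {u v : X.presheaf.stalk p},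
      IsLocalRing.maximalIdeal (X.presheaf.stalk p) = Ideal.span {u, v} →
        IsParameterPair u v ∧ IsParameterPair v u := fun h =>
    ⟨isParameterPair_of_span_eq hdim h,
      isParameterPair_of_span_eq hdim (h.trans (by rw [Set.pair_comm]))⟩
  refine ⟨fun hdeg => ?_, fun hdeg hreg u v huv => ?_, fun hreg => ?_⟩
  · have hne : ∀ x : RationalPoint k X, x.1 ≠ p := by
      rintro x rfl
      exact hdeg.ne' (degree_eq_one_iff.mpr x.2)
    obtain ⟨e, he⟩ := hπ.exists_rationalPoint_equiv hd hgen hne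
    refine ⟨e, he, ?_, fun hreg E hE n => ?_⟩
    · exact hπ.equivalentVia_codeOfSections hd hgen D _ _
        (fun s => hπ.mem_globalSections_pullback_iff hd hgen hm D) e he hne
        fun y => D.exists_hasValueAt_pullback hd y (he y)
          (he y ▸ (D.pullback π hd).mem_index y.1)
    · obtain ⟨u, v, huv⟩ := exists_span_eq_of_isRegularLocalRing hdim
      obtain ⟨huv, hvu⟩ := hpair huv
      refine hπ.equivalentVia_codeOfSections hd hgen D _ _
        (fun s => hπ.mem_globalSections_pullback_sub_iff hd hgen huv hvu D hE n) e he hne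
        fun y => ?_
      have h := hπ.exists_hasValueAt_pullback_sub hd huv hvu D hE n y (he y)
        (IsLocalEquation.one (he y ▸ hne (e y)))
      rwa [one_pow, div_one] at h
  · obtain ⟨huv, hvu⟩ := hpair huv
    have hk := degree_eq_one_iff.mp hdeg
    obtain ⟨e, he, he', hdir⟩ := hπ.exists_rationalPoint_equiv_sum hd hgen hk huv hvu
    exact ⟨e, he, he', fun E hE n =>
      hπ.equivalentVia_extendedCode hd hgen hk huv hvu D hE n e he he' hdir⟩
  · obtain ⟨u, v, huv⟩ := exists_span_eq_of_isRegularLocalRing hdim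
    obtain ⟨huv, hvu⟩ := hpair huv
    exact hπ.exists_isSumOfExceptionalCurves hd huv hvu
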